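/- **Lichnerowicz formula.** Let $(M,g)$ be a smooth Riemannian manifold of dimension $n$ (Hausdorff, second countable, without boundary, not necessarily compact), equipped with a spin structure, given by smooth local orthonormal frames $e^i=(e^i_1,\dots,e^i_n)$ over the sets $U_i$ of an open cover together with smooth maps $g_{ij}\colon U_i\cap U_j\to \mathrm{Spin}(n)$ that satisfy the cocycle condition $g_{ij}g_{jk}=g_{ik}$ and lift the transition functions of the frames. Let $\Delta$ be a complex spinor module: a finite-dimensional Hermitian vector space carrying an irreducible complex representation of the Clifford algebra of $\mathbb R^n$ (with $v\cdot v=-|v|^2$) in which vectors act by skew-Hermitian maps. Let $\mathbb S$ be the associated spinor bundle, whose sections are the families $\psi_i\colon U_i\to\Delta$ with $\psi_i=g_{ij}\psi_j$ on $U_i\cap U_j$. Let $\nabla$ be the connection on $\mathbb S$ induced by the Levi-Civita connection, which over $U_i$ is $$\nabla_v\psi=d\psi(v)+\tfrac14\sum_{a,b}\langle\nabla_v e_a,e_b\rangle\, e_a\cdot e_b\cdot\psi ,$$ let $D\psi=\sum_a e_a\cdot\nabla_{e_a}\psi$ be the Dirac operator, let $R$ be the scalar curvature of $g$, and for a smooth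 one-form $\eta$ with values in $\mathbb S$ put $\nabla^*\eta=-\sum_a(\nabla_{e_a}\eta)(e_a)$. Then $\nabla$, $D$ and $\nabla^*$ map smooth sections to smooth sections; $\nabla^*$ is the formal adjoint of $\nabla$, i.e. for every smooth compactly supported spinor field $\varphi$ and every smooth one-form $\eta$ with values in $\mathbb S$ the following integrals with respect to the Riemannian volume exist and satisfy $$\int_M\langle\nabla\varphi,\eta\rangle\,d\mathrm{vol}_g=\int_M\langle\varphi,\nabla^*\eta\rangle\,d\mathrm{vol}_g ;$$ and for every smooth spinor field $\psi$, everywhere on $M$, $$D^2\psi=\nabla^*\nabla\psi+\frac R4\,\psi .$$ -/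

import Mathlib

open Bundle FiberBundle VectorField MeasureTheory
open scoped Manifold ContDiff Topology

namespace SpinGeometry
noncomputable section

section LeviCivita
variable {E : Type*} [NormedAddCommGroup E] [NormedSpace ℝ E] [FiniteDimensional ℝ E]
  {H : Type*} [TopologicalSpace H] {I : ModelWithCorners ℝ E H}
  {M : Type*} [TopologicalSpace M] [ChartedSpace H M] [IsManifold I 2 M]
  [RiemannianBundle (fun x : M ↦ TangentSpace I x)]
  [IsContMDiffRiemannianBundle I 1 E (fun x : M ↦ TangentSpace I x)]

set_option linter.unusedSectionVars false

/-- Twice the right-hand side of the Koszul formula. -/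
def koszul (X Y Z : Π x : M, TangentSpace I x) (x : M) : ℝ :=
  mvfderiv I (fun y ↦ inner ℝ (Y y) (Z y)) x (X x)
    + mvfderiv I (fun y ↦ inner ℝ (Z y) (X y)) x (Y x)
    - mvfderiv I (fun y ↦ inner ℝ (X y) (Y y)) x (Z x)
    + inner ℝ (mlieBracket I X Y x) (Z x)
    - inner ℝ (mlieBracket I Y Z x) (X x)
    + inner ℝ (mlieBracket I Z X x) (Y x)

theorem mdifferentiableAt_inner {Y Z : Π x : M, TangentSpace I x} {x : M} (hY : MDiffAt (T% Y) x)
    (hZ : MDiffAt (T% Z) x) : MDiffAt (fun y ↦ (inner ℝ (Y y) (Z y) : ℝ)) x :=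
  MDifferentiableAt.inner_bundle (F := E) (E := fun x : M ↦ TangentSpace I x) (b := id) hY hZ

theorem koszul_tensorial_left (Y Z : Π x : M, TangentSpace I x) {x : M}
    (hY : MDiffAt (T% Y) x) (hZ : MDiffAt (T% Z) x) :
    TensorialAt I E (fun X ↦ koszul X Y Z x) x where
  smul {f X} hf hX := by
    have h1 := mvfderiv_mul hf (mdifferentiableAt_inner hZ hX)
    have h2 := mvfderiv_mul hf (mdifferentiableAt_inner hX hY)
    simp only [koszul, Pi.smul_apply', inner_smul_left, inner_smul_right, map_smul]
    have e1 : (fun y ↦ f y * inner ℝ (Z y) (X y)) = f * (fun y ↦ inner ℝ (Z y) (X y)) := rfl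
    have e2 : (fun y ↦ (starRingEnd ℝ) (f y) * inner ℝ (X y) (Y y)) =
      f * (fun y ↦ inner ℝ (X y) (Y y)) := rfl
    rw [e1, e2, h1, h2, mlieBracket_smul_left hf hX, mlieBracket_smul_right hf hX]
    simp [inner_add_left, inner_smul_left, real_inner_comm]
    ring
  add {X X'} hX hX' := by
    have h1 := mvfderiv_add (mdifferentiableAt_inner hZ hX) (mdifferentiableAt_inner hZ hX')
    have h2 := mvfderiv_add (mdifferentiableAt_inner hX hY) (mdifferentiableAt_inner hX' hY)
    simp only [koszul, Pi.add_apply, inner_add_left, inner_add_right, map_add]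
    have e1 : (fun y ↦ inner ℝ (Z y) (X y) + inner ℝ (Z y) (X' y)) =
      (fun y ↦ inner ℝ (Z y) (X y)) + (fun y ↦ inner ℝ (Z y) (X' y)) := rfl
    have e2 : (fun y ↦ inner ℝ (X y) (Y y) + inner ℝ (X' y) (Y y)) =
      (fun y ↦ inner ℝ (X y) (Y y)) + (fun y ↦ inner ℝ (X' y) (Y y)) := rfl
    rw [e1, e2, h1, h2, mlieBracket_add_left hX hX', mlieBracket_add_right hX hX']
    simp [inner_add_left]
    ring

theorem koszul_tensorial_right (X Y : Π x : M, TangentSpace I x) {x : M}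
    (hX : MDiffAt (T% X) x) (hY : MDiffAt (T% Y) x) :
    TensorialAt I E (fun Z ↦ koszul X Y Z x) x where
  smul {f Z} hf hZ := by
    have h1 := mvfderiv_mul hf (mdifferentiableAt_inner hY hZ)
    have h2 := mvfderiv_mul hf (mdifferentiableAt_inner hZ hX)
    simp only [koszul, Pi.smul_apply', inner_smul_left, inner_smul_right, map_smul]
    have e1 : (fun y ↦ f y * inner ℝ (Y y) (Z y)) = f * (fun y ↦ inner ℝ (Y y) (Z y)) := rfl
    have e2 : (fun y ↦ (starRingEnd ℝ) (f y) * inner ℝ (Z y) (X y)) =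
      f * (fun y ↦ inner ℝ (Z y) (X y)) := rfl
    rw [e1, e2, h1, h2, mlieBracket_smul_left hf hZ, mlieBracket_smul_right hf hZ]
    simp [inner_add_left, inner_smul_left, real_inner_comm]
    ring
  add {Z Z'} hZ hZ' := by
    have h1 := mvfderiv_add (mdifferentiableAt_inner hY hZ) (mdifferentiableAt_inner hY hZ')
    have h2 := mvfderiv_add (mdifferentiableAt_inner hZ hX) (mdifferentiableAt_inner hZ' hX)
    simp only [koszul, Pi.add_apply, inner_add_left, inner_add_right, map_add]
    have e1 : (fun y ↦ inner ℝ (Y y) (Z y) + inner ℝ (Y y) (Z' y)) =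
      (fun y ↦ inner ℝ (Y y) (Z y)) + (fun y ↦ inner ℝ (Y y) (Z' y)) := rfl
    have e2 : (fun y ↦ inner ℝ (Z y) (X y) + inner ℝ (Z' y) (X y)) =
      (fun y ↦ inner ℝ (Z y) (X y)) + (fun y ↦ inner ℝ (Z' y) (X y)) := rfl
    rw [e1, e2, h1, h2, mlieBracket_add_left hZ hZ', mlieBracket_add_right hZ hZ']
    simp [inner_add_left]
    ring

theorem koszul_add (X Y Y' Z : Π x : M, TangentSpace I x) {x : M}
    (hX : MDiffAt (T% X) x) (hY : MDiffAt (T% Y) x) (hY' : MDiffAt (T% Y') x)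
    (hZ : MDiffAt (T% Z) x) :
    koszul X (Y + Y') Z x = koszul X Y Z x + koszul X Y' Z x := by
  have h1 := mvfderiv_add (mdifferentiableAt_inner hY hZ) (mdifferentiableAt_inner hY' hZ)
  have h2 := mvfderiv_add (mdifferentiableAt_inner hX hY) (mdifferentiableAt_inner hX hY')
  simp only [koszul, Pi.add_apply, inner_add_left, inner_add_right, map_add]
  have e1 : (fun y ↦ inner ℝ (Y y) (Z y) + inner ℝ (Y' y) (Z y)) =
    (fun y ↦ inner ℝ (Y y) (Z y)) + (fun y ↦ inner ℝ (Y' y) (Z y)) := rfl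
  have e2 : (fun y ↦ inner ℝ (X y) (Y y) + inner ℝ (X y) (Y' y)) =
    (fun y ↦ inner ℝ (X y) (Y y)) + (fun y ↦ inner ℝ (X y) (Y' y)) := rfl
  rw [e1, e2, h1, h2, mlieBracket_add_left hY hY', mlieBracket_add_right hY hY']
  simp [inner_add_left]
  ring

theorem koszul_smul (X Y Z : Π x : M, TangentSpace I x) {f : M → ℝ} {x : M}
    (hf : MDiffAt f x) (hX : MDiffAt (T% X) x) (hY : MDiffAt (T% Y) x)
    (hZ : MDiffAt (T% Z) x) :
    koszul X (f • Y) Z x =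
      f x * koszul X Y Z x + 2 * (mvfderiv I f x (X x) * inner ℝ (Y x) (Z x)) := by
  have h1 := mvfderiv_mul hf (mdifferentiableAt_inner hY hZ)
  have h2 := mvfderiv_mul hf (mdifferentiableAt_inner hX hY)
  simp only [koszul, Pi.smul_apply', inner_smul_left, inner_smul_right, map_smul]
  have e1 : (fun y ↦ (starRingEnd ℝ) (f y) * inner ℝ (Y y) (Z y)) =
    f * (fun y ↦ inner ℝ (Y y) (Z y)) := rfl
  have e2 : (fun y ↦ f y * inner ℝ (X y) (Y y)) =
    f * (fun y ↦ inner ℝ (X y) (Y y)) := rfl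
  rw [e1, e2, h1, h2, mlieBracket_smul_left hf hY, mlieBracket_smul_right hf hY]
  simp [inner_add_left, inner_smul_left, real_inner_comm]
  ring

open scoped Classical in
/-- The covariant derivative determined by the Koszul formula. -/
def koszulDeriv (Y : Π x : M, TangentSpace I x) (x : M) :
    TangentSpace I x →L[ℝ] TangentSpace I x :=
  letI : FiniteDimensional ℝ (TangentSpace I x) :=
    inferInstanceAs (FiniteDimensional ℝ E)
  if hY : MDiffAt (T% Y) x then
    (1 / 2 : ℝ) • (InnerProductSpace.toDual ℝ
        (TangentSpace I x)).symm.toContinuousLinearEquiv.toContinuousLinearMap.comp <|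
      TensorialAt.mkHom₂ (fun X Z ↦ koszul X Y Z x) x
        (fun Z hZ ↦ koszul_tensorial_left Y Z hY hZ)
        (fun X hX ↦ koszul_tensorial_right X Y hX hY)
  else 0

theorem inner_koszulDeriv {X Y Z : Π x : M, TangentSpace I x} {x : M}
    (hX : MDiffAt (T% X) x) (hY : MDiffAt (T% Y) x) (hZ : MDiffAt (T% Z) x) :
    inner ℝ (koszulDeriv Y x (X x)) (Z x) = 1 / 2 * koszul X Y Z x := by
  rw [koszulDeriv, dif_pos hY, ← TensorialAt.mkHom₂_apply (V := (TangentSpace I : M → Type _))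
    (V' := (TangentSpace I : M → Type _)) (F := E)
    (F' := E)
    (fun Z hZ ↦ koszul_tensorial_left Y Z hY hZ)
    (fun X hX ↦ koszul_tensorial_right X Y hX hY) hX hZ]
  simp [inner_smul_left]

/-- The Levi-Civita connection, given by the Koszul formula. -/
def leviCivita : CovariantDerivative I E (TangentSpace I : M → Type _) where
  toFun := koszulDeriv
  isCovariantDerivativeOnUniv :=
    { add := by
        intro Y Y' x hY hY' _
        ext v
        refine ext_inner_right ℝ fun w ↦ ?_
        have hv := mdifferentiableAt_extend I E v
        have hw := mdifferentiableAt_extend I E w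
        have h1 := inner_koszulDeriv hv hY hw
        have h2 := inner_koszulDeriv hv hY' hw
        have h3 := inner_koszulDeriv hv (mdifferentiableAt_add_section hY hY') hw
        rw [koszul_add _ _ _ _ hv hY hY' hw] at h3
        simp only [extend_apply_self] at h1 h2 h3
        rw [add_apply, inner_add_left, h1, h2]
        refine h3.trans ?_
        ring
      leibniz := by
        intro Y f x hY hf _
        ext v
        refine ext_inner_right ℝ fun w ↦ ?_
        have hv := mdifferentiableAt_extend I E v
        have hw := mdifferentiableAt_extend I E w
        have h1 := inner_koszulDeriv hv hY hw
        have h3 := inner_koszulDeriv hv (hf.smul_section hY) hw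
        have h4 := koszul_smul _ _ _ hf hv hY hw
        simp only [extend_apply_self] at h1 h3 h4
        rw [h3, h4, add_apply, inner_add_left, smul_apply,
          inner_smul_left, h1, ContinuousLinearMap.smulRight_apply, inner_smul_left]
        simp
        ring }

theorem koszul_formula {X Y Z : Π x : M, TangentSpace I x} {x : M}
    (hX : MDiffAt (T% X) x) (hY : MDiffAt (T% Y) x) (hZ : MDiffAt (T% Z) x) :
    2 * inner ℝ (leviCivita Y x (X x)) (Z x) = koszul X Y Z x := by
  rw [show leviCivita Y x = koszulDeriv Y x from rfl, inner_koszulDeriv hX hY hZ]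
  ring

theorem leviCivita_metric {X Y Z : Π x : M, TangentSpace I x} {x : M}
    (hX : MDiffAt (T% X) x) (hY : MDiffAt (T% Y) x) (hZ : MDiffAt (T% Z) x) :
    mvfderiv I (fun y ↦ (inner ℝ (Y y) (Z y) : ℝ)) x (X x) =
      inner ℝ (leviCivita Y x (X x)) (Z x) + inner ℝ (Y x) (leviCivita Z x (X x)) := by
  have h1 := koszul_formula hX hY hZ
  have h2 := koszul_formula hX hZ hY
  rw [real_inner_comm] at h2
  simp only [koszul] at h1 h2
  rw [mlieBracket_swap_apply (V := Z) (W := X)] at h1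
  rw [mlieBracket_swap_apply (V := Z) (W := Y), mlieBracket_swap_apply (V := Y) (W := X)] at h2
  simp only [inner_neg_left, real_inner_comm] at h1 h2 ⊢
  linarith

theorem leviCivita_torsion : (leviCivita (I := I) (M := M)).torsion = 0 := by
  rw [CovariantDerivative.torsion_eq_zero_iff]
  intro X Y x hX hY
  refine ext_inner_right ℝ fun w ↦ ?_
  have hw := mdifferentiableAt_extend I E w
  have h1 := koszul_formula hX hY hw
  have h2 := koszul_formula hY hX hw
  simp only [koszul, extend_apply_self] at h1 h2
  rw [inner_sub_left]
  rw [mlieBracket_swap_apply (V := Y) (W := X), mlieBracket_swap_apply (V := X) (W := extend E w),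
    mlieBracket_swap_apply (V := extend E w) (W := Y)] at h2
  simp only [inner_neg_left, real_inner_comm] at h1 h2 ⊢
  linarith

/-- The Riemann curvature `R(X, Y)Z = ∇_X ∇_Y Z - ∇_Y ∇_X Z - ∇_[X, Y] Z` of the Levi-Civita
connection, for vector fields that are smooth near the point of evaluation. -/
def riemannCurvature (X Y Z : Π x : M, TangentSpace I x) (x : M) : TangentSpace I x :=
  leviCivita (fun y ↦ leviCivita Z y (Y y)) x (X x)
    - leviCivita (fun y ↦ leviCivita Z y (X y)) x (Y x)
    - leviCivita Z x (mlieBracket I X Y x)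

variable (I) in
/-- The scalar curvature `∑ a c, ⟨R(e_a, e_c)e_c, e_a⟩`, for an orthonormal basis `e` of the
tangent space at `x`; the basis vectors are extended to vector fields that are smooth near `x`. -/
def scalarCurvature (x : M) : ℝ :=
  letI : FiniteDimensional ℝ (TangentSpace I x) := inferInstanceAs (FiniteDimensional ℝ E)
  let e := stdOrthonormalBasis ℝ (TangentSpace I x)
  ∑ a, ∑ c, inner ℝ
    (riemannCurvature (extend E (e a)) (extend E (e c)) (extend E (e c)) x) (e a)

end LeviCivita

section Volume

variable (n : ℕ) {M : Type*} [TopologicalSpace M] [ChartedSpace (EuclideanSpace ℝ (Fin n)) M]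
  [IsManifold (𝓡 n) ∞ M] [RiemannianBundle (fun x : M ↦ TangentSpace (𝓡 n) x)]

/-- The Riemannian density `√det(g_ab)` in the preferred chart at `p`, where
`g_ab = ⟨∂_a, ∂_b⟩` are the components of the metric in this chart. -/
def volumeDensity (p : M) (y : EuclideanSpace ℝ (Fin n)) : ℝ :=
  √(Matrix.det (Matrix.of fun a b : Fin n ↦
    (inner ℝ
      (mfderiv (𝓡 n) (𝓡 n) (extChartAt (𝓡 n) p).symm y (EuclideanSpace.single a (1 : ℝ)) :
        TangentSpace (𝓡 n) ((extChartAt (𝓡 n) p).symm y))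
      (mfderiv (𝓡 n) (𝓡 n) (extChartAt (𝓡 n) p).symm y (EuclideanSpace.single b (1 : ℝ)) :
        TangentSpace (𝓡 n) ((extChartAt (𝓡 n) p).symm y)) : ℝ)))

/-- The measure `√det(g_ab) dx` of the preferred chart at `p`, as a measure on `M` that is
carried by the domain of this chart. -/
def chartVolume [MeasurableSpace M] (p : M) : Measure M :=
  Measure.map (extChartAt (𝓡 n) p).symm
    ((volume.restrict (extChartAt (𝓡 n) p).target).withDensity
      fun y ↦ ENNReal.ofReal (volumeDensity n p y))

/-- The Riemannian volume measure. The measures `√det(g_ab) dx` of any two charts agree on the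
overlap of their domains, so their supremum is the measure obtained by gluing them. -/
def riemannianVolume [MeasurableSpace M] : Measure M := ⨆ p : M, chartVolume n p

end Volume

section Clifford

/-- The quadratic form `-|v|²` on `ℝⁿ`: in its Clifford algebra `v * v = -|v|²`. -/
abbrev cliffordForm (n : ℕ) : QuadraticForm ℝ (Fin n → ℝ) :=
  QuadraticMap.weightedSumSquares ℝ (fun _ : Fin n ↦ (-1 : ℝ))

/-- The generator `e_a` of the Clifford algebra of `ℝⁿ`. -/
def cliffordGen {n : ℕ} (a : Fin n) : CliffordAlgebra (cliffordForm n) :=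
  CliffordAlgebra.ι (cliffordForm n) (Pi.single a 1)

/-- The structure of a complex spinor module of `ℝⁿ` on a Hermitian vector space `Δ`: an
irreducible complex representation of the Clifford algebra for which Clifford multiplication by
vectors is skew-Hermitian. Its restriction to `Spin(n)` is the spin representation. -/
structure SpinorModule (n : ℕ) (Δ : Type*) [NormedAddCommGroup Δ] [InnerProductSpace ℂ Δ] where
  rep : CliffordAlgebra (cliffordForm n) →ₐ[ℝ] Module.End ℂ Δ
  skew : ∀ (v : Fin n → ℝ) (φ ψ : Δ),
    inner ℂ (rep (CliffordAlgebra.ι (cliffordForm n) v) φ) ψ =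
      -inner ℂ φ (rep (CliffordAlgebra.ι (cliffordForm n) v) ψ)
  nontrivial : Nontrivial Δ
  irreducible : ∀ W : Submodule ℂ Δ,
    (∀ v : Fin n → ℝ, ∀ w ∈ W, rep (CliffordAlgebra.ι (cliffordForm n) v) w ∈ W) → W = ⊥ ∨ W = ⊤

/-- Clifford multiplication by the `a`-th standard basis vector on spinors. -/
def SpinorModule.gamma {n : ℕ} {Δ : Type*} [NormedAddCommGroup Δ] [InnerProductSpace ℂ Δ]
    (S : SpinorModule n Δ) (a : Fin n) : Module.End ℂ Δ :=
  S.rep (cliffordGen a)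

end Clifford

section Spin

variable {n : ℕ} {M : Type*} [TopologicalSpace M] [ChartedSpace (EuclideanSpace ℝ (Fin n)) M]
  [IsManifold (𝓡 n) ∞ M] [RiemannianBundle (fun x : M ↦ TangentSpace (𝓡 n) x)]
  [IsContMDiffRiemannianBundle (𝓡 n) ∞ (EuclideanSpace ℝ (Fin n))
    (fun x : M ↦ TangentSpace (𝓡 n) x)]

instance isContMDiffRiemannianBundle_one :
    IsContMDiffRiemannianBundle (𝓡 n) 1 (EuclideanSpace ℝ (Fin n))
      (fun x : M ↦ TangentSpace (𝓡 n) x) :=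
  IsContMDiffRiemannianBundle.of_le (n := ∞) (by exact_mod_cast le_top)

variable (n M) in
/-- A spin structure on a Riemannian manifold, as a cocycle: an open cover by domains `U i` of
smooth orthonormal frames `e i`, and smooth functions `g i j : U i ∩ U j → Spin(n)` with
`g i j * g j k = g i k` which lift the transition functions of the frames, that is, the rotation
`v ↦ g v g⁻¹` with `g = g i j x` takes `e i x` to `e j x` (`g⁻¹ = star g` in the spin group).
Smoothness of a map to the Clifford algebra, a finite-dimensional real vector space, is tested on
linear functionals. The manifold carries the orientation for which the frames are positive. -/
structure SpinStructure where
  Index : Type*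
  U : Index → Set M
  isOpen_U : ∀ i, IsOpen (U i)
  cover : ∀ x, ∃ i, x ∈ U i
  e : Index → Fin n → Π x : M, TangentSpace (𝓡 n) x
  contMDiffOn_e : ∀ i a, ContMDiffOn (𝓡 n) ((𝓡 n).prod 𝓘(ℝ, EuclideanSpace ℝ (Fin n))) ∞
    (fun x ↦ (⟨x, e i a x⟩ : TangentBundle (𝓡 n) M)) (U i)
  orthonormal_e : ∀ i, ∀ x ∈ U i, Orthonormal ℝ (fun a ↦ e i a x)
  g : Index → Index → M → CliffordAlgebra (cliffordForm n)
  g_mem : ∀ i j, ∀ x ∈ U i ∩ U j, g i j x ∈ spinGroup (cliffordForm n)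
  contMDiffOn_g : ∀ i j (l : CliffordAlgebra (cliffordForm n) →ₗ[ℝ] ℝ),
    ContMDiffOn (𝓡 n) 𝓘(ℝ) ∞ (fun x ↦ l (g i j x)) (U i ∩ U j)
  cocycle : ∀ i j k, ∀ x ∈ U i ∩ U j ∩ U k, g i j x * g j k x = g i k x
  lift : ∀ i j, ∀ x ∈ U i ∩ U j, ∀ a, g i j x * cliffordGen a * star (g i j x) =
    CliffordAlgebra.ι (cliffordForm n) (fun b ↦ inner ℝ (e i b x) (e j a x))

namespace SpinStructure

variable (P : SpinStructure n M) {Δ : Type*} [NormedAddCommGroup Δ] [InnerProductSpace ℂ Δ]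
  (S : SpinorModule n Δ)

/-- A smooth section of the spinor bundle, the bundle associated to the spin structure by the spin
representation: smooth functions `ψ i : U i → Δ` with `ψ i = g i j • ψ j` on `U i ∩ U j`.
Only the values of `ψ i` on `U i` matter. -/
structure IsSpinor (ψ : P.Index → M → Δ) : Prop where
  contMDiffOn : ∀ i, ContMDiffOn (𝓡 n) 𝓘(ℝ, Δ) ∞ (ψ i) (P.U i)
  transition : ∀ i j, ∀ x ∈ P.U i ∩ P.U j, ψ i x = S.rep (P.g i j x) (ψ j x)

/-- A smooth one-form with values in the spinor bundle. -/
structure IsSpinorForm (η : P.Index → Π x : M, TangentSpace (𝓡 n) x →L[ℝ] Δ) : Prop where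
  contMDiffOn : ∀ i a, ContMDiffOn (𝓡 n) 𝓘(ℝ, Δ) ∞ (fun x ↦ η i x (P.e i a x)) (P.U i)
  transition : ∀ i j, ∀ x ∈ P.U i ∩ P.U j, ∀ v, η i x v = S.rep (P.g i j x) (η j x v)

/-- The covariant derivative of spinors induced by the Levi-Civita connection, in the frame `e i`:
`∇_v f = df(v) + 1/4 ∑ a b, ⟨∇_v e_a, e_b⟩ e_a · e_b · f`. -/
def localNabla (i : P.Index) (f : M → Δ) (x : M) : TangentSpace (𝓡 n) x →L[ℝ] Δ :=
  mvfderiv (𝓡 n) f x + ∑ a, ∑ b, ((1 / 4 : ℝ) •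
    ((innerSL ℝ (P.e i b x)).comp (leviCivita (I := 𝓡 n) (P.e i a) x))).smulRight
      (S.gamma a (S.gamma b (f x)))

/-- The covariant derivative `∇ψ` of a spinor `ψ`. -/
def nabla (ψ : P.Index → M → Δ) (i : P.Index) (x : M) : TangentSpace (𝓡 n) x →L[ℝ] Δ :=
  P.localNabla S i (ψ i) x

/-- The Dirac operator `D = ∑ a, e_a · ∇_{e_a}`. -/
def dirac (ψ : P.Index → M → Δ) (i : P.Index) (x : M) : Δ :=
  ∑ a, S.gamma a (P.nabla S ψ i x (P.e i a x))

/-- The operator `∇^* η = -∑ a, (∇_{e_a} η)(e_a) = -∑ a, (∇_{e_a} (η(e_a)) - η(∇_{e_a} e_a))` from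
one-forms with values in the spinor bundle to spinors. -/
def nablaStar (η : P.Index → Π x : M, TangentSpace (𝓡 n) x →L[ℝ] Δ) (i : P.Index) (x : M) : Δ :=
  -∑ a, (P.localNabla S i (fun y ↦ η i y (P.e i a y)) x (P.e i a x)
    - η i x (leviCivita (I := 𝓡 n) (P.e i a) x (P.e i a x)))

/-- A member of the cover that contains `x`. -/
def index (x : M) : P.Index := (P.cover x).choose

/-- The pointwise Hermitian product of two spinors; it does not depend on the frame. -/
def pairing (φ ψ : P.Index → M → Δ) (x : M) : ℂ :=
  inner ℂ (φ (P.index x) x) (ψ (P.index x) x)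

/-- The pointwise Hermitian product `∑ a, ⟨η(e_a), θ(e_a)⟩` of two one-forms with values in the
spinor bundle; it does not depend on the frame. -/
def formPairing (η θ : P.Index → Π x : M, TangentSpace (𝓡 n) x →L[ℝ] Δ) (x : M) : ℂ :=
  ∑ a, inner ℂ (η (P.index x) x (P.e (P.index x) a x)) (θ (P.index x) x (P.e (P.index x) a x))

/-- The spinor `ψ` has compact support. -/
def HasCompactSpinorSupport (ψ : P.Index → M → Δ) : Prop :=
  ∃ K : Set M, IsCompact K ∧ ∀ i, ∀ x ∈ P.U i, x ∉ K → ψ i x = 0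

end SpinStructure

end Spin

end

end SpinGeometry

/-! Everything is computed in one local orthonormal frame, with no frame assumed parallel at a
point. Write $\omega_v$ for the connection form and
$N_{ab}=\nabla_{e_a}\nabla_{e_b}\psi-\nabla_{\nabla_{e_a}e_b}\psi$. Clifford multiplication is
parallel (`frameNabla_gam`), so $D^2\psi=\sum_{a,b} e_a e_b N_{ab}$. The Clifford relations split
this sum (`sum_gam_gam`) into $-\sum_a N_{aa}=\nabla^*\nabla\psi$ and $\frac12\sum_{a,b} e_a
e_b(N_{ab}-N_{ba})$. As the torsion vanishes, $N_{ab}-N_{ba}$ is the spinor curvature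
$\frac14\sum_{k,l} R_{abkl}e_ke_l\psi$ (`frameNabla_commutator`). In the contraction $\sum
R_{abkl}e_ae_be_ke_l$ the Bianchi identity reduces three generators to a Ricci contraction
(`IsCliffordFamily.sum_bianchi`), and the symmetry of Ricci leaves only its trace
(`IsCliffordFamily.sum_curvature`). The value is $2R$, and $\frac12\cdot\frac14\cdot 2R=\frac R4$.

That $\nabla$, $D$ and $\nabla^*$ are globally defined rests on $dg_{ij}+\omega^i
g_{ij}=g_{ij}\omega^j$ (`SpinStructure.mvfderiv_op_g`). The operator
$dg\,g^{-1}+\omega^i-g\omega^jg^{-1}$ commutes with all vectors, because both connection forms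
induce the Levi-Civita connection on vectors (`commute_of_conjugate`). It lies in the span of even
words, hence is a real scalar (`IsCliffordFamily.exists_eq_smul_one_of_commute`). It is also
skew-Hermitian, so it is zero.

For the adjoint, $\langle\nabla\varphi,\eta\rangle-\langle\varphi,\nabla^*\eta\rangle$ is the sum
over $a$ of the divergences of $\alpha_a e_a$ with $\alpha_a=\langle\varphi,\eta(e_a)\rangle$
(`SpinStructure.formPairing_sub_pairing`). In a chart the Riemannian density is the reciprocal of
$|\det|$ of the frame (`volumeDensity_eq_inv`), so the divergence of $e_a$ comes from
differentiating a determinant and is given by Lie brackets, that is, by connection coefficients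
(`trace_fderiv_smul_frame`, `trace_fderiv_volumeDensity_smul`). The integral then vanishes by the
Euclidean divergence theorem, and a partition of unity reduces general compact supports to supports
inside one chart and one frame domain. -/

namespace SpinGeometry
noncomputable section

/-! ### Calculus of vector-valued functions on a manifold. -/

section Calculus

variable {E : Type*} [NormedAddCommGroup E] [NormedSpace ℝ E]
  {H : Type*} [TopologicalSpace H] {I : ModelWithCorners ℝ E H}
  {M : Type*} [TopologicalSpace M] [ChartedSpace H M]
  {V W Z : Type*} [NormedAddCommGroup V] [NormedSpace ℝ V] [NormedAddCommGroup W] [NormedSpace ℝ W]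
  [NormedAddCommGroup Z] [NormedSpace ℝ Z]

theorem mvfderiv_clm_comp (L : V →L[ℝ] W) {f : M → V} {x : M}
    (hf : MDifferentiableAt I 𝓘(ℝ, V) f x) (v : TangentSpace I x) :
    mvfderiv I (fun y ↦ L (f y)) x v = L (mvfderiv I f x v) := by
  have h := HasMFDerivAt.comp x (L.hasFDerivAt (x := f x)).hasMFDerivAt hf.hasMFDerivAt
  exact congrArg (fun T ↦ T v) h.mfderiv

theorem mvfderiv_bilin (L : V →L[ℝ] W →L[ℝ] Z) {f : M → V} {g : M → W} {x : M}
    (hf : MDifferentiableAt I 𝓘(ℝ, V) f x) (hg : MDifferentiableAt I 𝓘(ℝ, W) g x)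
    (v : TangentSpace I x) :
    mvfderiv I (fun y ↦ L (f y) (g y)) x v =
      L (mvfderiv I f x v) (g x) + L (f x) (mvfderiv I g x v) := by
  have h1 := (L.isBoundedBilinearMap.hasFDerivAt (f x, g x)).hasMFDerivAt
  have h2 : HasMFDerivAt I 𝓘(ℝ, V × W) (fun y ↦ (f y, g y)) x
      ((mfderiv I 𝓘(ℝ, V) f x).prod (mfderiv I 𝓘(ℝ, W) g x)) := by
    exact ⟨hf.hasMFDerivAt.1.prodMk hg.hasMFDerivAt.1, hf.hasMFDerivAt.2.prodMk hg.hasMFDerivAt.2⟩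
  have h := HasMFDerivAt.comp x h1 h2
  have h3 := congrArg (fun T ↦ T v) h.mfderiv
  refine Eq.trans h3 ?_
  exact add_comm _ _

theorem mdifferentiableAt_bilin (L : V →L[ℝ] W →L[ℝ] Z) {f : M → V} {g : M → W} {x : M}
    (hf : MDifferentiableAt I 𝓘(ℝ, V) f x) (hg : MDifferentiableAt I 𝓘(ℝ, W) g x) :
    MDifferentiableAt I 𝓘(ℝ, Z) (fun y ↦ L (f y) (g y)) x :=
  (L.isBoundedBilinearMap.hasFDerivAt (f x, g x)).hasMFDerivAt.mdifferentiableAt.comp x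
    (hf.prodMk_space hg)

theorem contMDiffOn_bilin (L : V →L[ℝ] W →L[ℝ] Z) {f : M → V} {g : M → W} {U : Set M}
    (hf : ContMDiffOn I 𝓘(ℝ, V) ∞ f U) (hg : ContMDiffOn I 𝓘(ℝ, W) ∞ g U) :
    ContMDiffOn I 𝓘(ℝ, Z) ∞ (fun y ↦ L (f y) (g y)) U :=
  (L.isBoundedBilinearMap.contDiff.contMDiff.comp_contMDiffOn (hf.prodMk_space hg))

theorem contMDiffOn_clm_comp (L : V →L[ℝ] W) {f : M → V} {U : Set M}
    (hf : ContMDiffOn I 𝓘(ℝ, V) ∞ f U) : ContMDiffOn I 𝓘(ℝ, W) ∞ (fun y ↦ L (f y)) U :=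
  L.contDiff.contMDiff.comp_contMDiffOn hf

theorem mvfderiv_smul_apply {f : M → ℝ} {g : M → V} {x : M}
    (hf : MDifferentiableAt I 𝓘(ℝ) f x) (hg : MDifferentiableAt I 𝓘(ℝ, V) g x)
    (v : TangentSpace I x) :
    mvfderiv I (fun y ↦ f y • g y) x v = mvfderiv I f x v • g x + f x • mvfderiv I g x v :=
  mvfderiv_bilin (ContinuousLinearMap.lsmul ℝ ℝ) hf hg v

theorem mdifferentiableAt_sum {ι : Type*} (s : Finset ι) {f : ι → M → V} {x : M}
    (hf : ∀ i ∈ s, MDifferentiableAt I 𝓘(ℝ, V) (f i) x) :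
    MDifferentiableAt I 𝓘(ℝ, V) (fun y ↦ ∑ i ∈ s, f i y) x := by
  classical
  induction s using Finset.induction_on with
  | empty => simpa using mdifferentiableAt_const
  | insert a s ha ih =>
    simp only [Finset.sum_insert ha]
    exact (hf a (Finset.mem_insert_self a s)).add
      (ih fun i hi ↦ hf i (Finset.mem_insert_of_mem hi))

theorem mvfderiv_sum {ι : Type*} (s : Finset ι) {f : ι → M → V} {x : M}
    (hf : ∀ i ∈ s, MDifferentiableAt I 𝓘(ℝ, V) (f i) x) :
    mvfderiv I (fun y ↦ ∑ i ∈ s, f i y) x = ∑ i ∈ s, mvfderiv I (f i) x := by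
  classical
  induction s using Finset.induction_on with
  | empty => simpa using mvfderiv_const (0 : V)
  | insert a s ha ih =>
    simp only [Finset.sum_insert ha]
    rw [← ih fun i hi ↦ hf i (Finset.mem_insert_of_mem hi)]
    exact mvfderiv_add (hf a (Finset.mem_insert_self a s))
      (mdifferentiableAt_sum s fun i hi ↦ hf i (Finset.mem_insert_of_mem hi))

theorem contMDiffOn_sum {ι : Type*} (s : Finset ι) {f : ι → M → V} {U : Set M}
    (hf : ∀ i ∈ s, ContMDiffOn I 𝓘(ℝ, V) ∞ (f i) U) :
    ContMDiffOn I 𝓘(ℝ, V) ∞ (fun y ↦ ∑ i ∈ s, f i y) U := by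
  classical
  induction s using Finset.induction_on with
  | empty => simpa using contMDiffOn_const
  | insert a s ha ih =>
    simp only [Finset.sum_insert ha]
    exact (hf a (Finset.mem_insert_self a s)).add
      (ih fun i hi ↦ hf i (Finset.mem_insert_of_mem hi))

theorem mvfderiv_congr {f g : M → V} {x : M} (h : f =ᶠ[𝓝 x] g) :
    mvfderiv I f x = mvfderiv I g x := by
  ext v
  exact congrArg (fun T : E →L[ℝ] V ↦ T v) (show (mfderiv I 𝓘(ℝ, V) f x : E →L[ℝ] V) =
    mfderiv I 𝓘(ℝ, V) g x from h.mfderiv_eq)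

theorem mdifferentiableAt_of_contMDiffOn {f : M → V} {U : Set M} (hU : IsOpen U)
    (hf : ContMDiffOn I 𝓘(ℝ, V) ∞ f U) {x : M} (hx : x ∈ U) : MDifferentiableAt I 𝓘(ℝ, V) f x :=
  (hf.contMDiffAt (hU.mem_nhds hx)).mdifferentiableAt (by simp)

/-- The function is the fibre component of the tangent map of `f` composed with the section `X`; at
order `∞` no derivative is lost. -/
theorem contMDiffOn_mvfderiv_apply [IsManifold I ∞ M] {f : M → V} {U : Set M} (hU : IsOpen U)
    (hf : ContMDiffOn I 𝓘(ℝ, V) ∞ f U) {X : Π x : M, TangentSpace I x}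
    (hX : ContMDiffOn I (I.prod 𝓘(ℝ, E)) ∞ (fun x ↦ (⟨x, X x⟩ : TangentBundle I M)) U) :
    ContMDiffOn I 𝓘(ℝ, V) ∞ (fun x ↦ mvfderiv I f x (X x)) U := by
  have h1 := (hf.contMDiffOn_tangentMapWithin (m := ∞) (by simp) hU.uniqueMDiffOn).comp hX
    (fun x hx ↦ hx)
  have h2 := (contMDiff_snd_tangentBundle_modelSpace V 𝓘(ℝ, V) (n := ∞)).comp_contMDiffOn h1
  refine h2.congr fun x hx ↦ ?_
  simp only [Function.comp, tangentMapWithin]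
  rw [mfderivWithin_of_isOpen hU hx]
  rfl

end Calculus

/-! ### The Lie bracket as a commutator of derivations. -/

section Bracket

set_option linter.unusedSectionVars false
set_option linter.unusedVariables false

variable {E : Type*} [NormedAddCommGroup E] [NormedSpace ℝ E] [FiniteDimensional ℝ E]
  {H : Type*} [TopologicalSpace H] {I : ModelWithCorners ℝ E H}
  {M : Type*} [TopologicalSpace M] [ChartedSpace H M] [IsManifold I ∞ M]
  {F : Type*} [NormedAddCommGroup F] [NormedSpace ℝ F]

theorem contMDiffOn_mlieBracket {X Y : Π x : M, TangentSpace I x} {U : Set M} (hU : IsOpen U)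
    (hX : ContMDiffOn I (I.prod 𝓘(ℝ, E)) ∞ (T% X) U)
    (hY : ContMDiffOn I (I.prod 𝓘(ℝ, E)) ∞ (T% Y) U) :
    ContMDiffOn I (I.prod 𝓘(ℝ, E)) ∞ (T% (mlieBracket I X Y)) U := by
  intro x hx
  have : IsManifold I (((⊤ : ℕ∞) : ℕ∞ω) + 1) M := by simpa using ‹IsManifold I ∞ M›
  have : IsManifold I (minSmoothness ℝ 2) M := by
    rw [minSmoothness_of_isRCLikeNormedField]
    infer_instance
  exact (ContMDiffAt.mlieBracket_vectorField (m := ⊤) (n := ⊤) (hX.contMDiffAt (hU.mem_nhds hx))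
    (hY.contMDiffAt (hU.mem_nhds hx)) (by simp)).contMDiffWithinAt

theorem mdifferentiableAt_section_of_contMDiffOn {X : Π x : M, TangentSpace I x} {U : Set M}
    (hU : IsOpen U) (hX : ContMDiffOn I (I.prod 𝓘(ℝ, E)) ∞ (T% X) U) {x : M} (hx : x ∈ U) :
    MDiffAt (T% X) x :=
  (hX.contMDiffAt (hU.mem_nhds hx)).mdifferentiableAt (by simp)

/-- Two applications of the Leibniz rule. The second derivative of `f` appears as the coefficient of
`W`, which is what the Jacobi argument below isolates. -/
theorem mlieBracket_mlieBracket_smul {f : M → ℝ} {X Y W : Π x : M, TangentSpace I x}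
    {U : Set M} (hU : IsOpen U) (hf : ContMDiffOn I 𝓘(ℝ) ∞ f U)
    (hX : ContMDiffOn I (I.prod 𝓘(ℝ, E)) ∞ (T% X) U)
    (hY : ContMDiffOn I (I.prod 𝓘(ℝ, E)) ∞ (T% Y) U)
    (hW : ContMDiffOn I (I.prod 𝓘(ℝ, E)) ∞ (T% W) U) {x : M} (hx : x ∈ U) :
    mlieBracket I X (mlieBracket I Y (f • W)) x =
      mvfderiv I (fun y ↦ mvfderiv I f y (Y y)) x (X x) • W x
        + mvfderiv I f x (Y x) • mlieBracket I X W x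
        + mvfderiv I f x (X x) • mlieBracket I Y W x
        + f x • mlieBracket I X (mlieBracket I Y W) x := by
  have hdf := contMDiffOn_mvfderiv_apply hU hf hY
  have hYW := contMDiffOn_mlieBracket hU hY hW
  have h1 : mlieBracket I Y (f • W) =ᶠ[𝓝 x]
      (fun y ↦ mvfderiv I f y (Y y)) • W + f • mlieBracket I Y W := by
    filter_upwards [hU.mem_nhds hx] with y hy
    exact mlieBracket_smul_right (mdifferentiableAt_of_contMDiffOn hU hf hy)
      (mdifferentiableAt_section_of_contMDiffOn hU hW hy)
  have df := mdifferentiableAt_of_contMDiffOn hU hf hx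
  have ddf := mdifferentiableAt_of_contMDiffOn hU hdf hx
  have dW := mdifferentiableAt_section_of_contMDiffOn hU hW hx
  have dYW := mdifferentiableAt_section_of_contMDiffOn hU hYW hx
  refine (Filter.EventuallyEq.mlieBracket_vectorField_eq Filter.EventuallyEq.rfl h1).trans ?_
  rw [mlieBracket_add_right (ddf.smul_section dW) (df.smul_section dYW),
    mlieBracket_smul_right ddf dW, mlieBracket_smul_right df dYW]
  abel

/-- Apply the Jacobi identity to `X`, `Y`, `W` and to `X`, `Y`, `f • W`. After the Leibniz expansion
all terms cancel except the asserted identity times `W`, and `W` is chosen nonzero at `x`. -/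
theorem mvfderiv_mlieBracket_real {f : M → ℝ} {X Y : Π x : M, TangentSpace I x}
    {U : Set M} (hU : IsOpen U) (hf : ContMDiffOn I 𝓘(ℝ) ∞ f U)
    (hX : ContMDiffOn I (I.prod 𝓘(ℝ, E)) ∞ (T% X) U)
    (hY : ContMDiffOn I (I.prod 𝓘(ℝ, E)) ∞ (T% Y) U) {x : M} (hx : x ∈ U) :
    mvfderiv I f x (mlieBracket I X Y x) =
      mvfderiv I (fun y ↦ mvfderiv I f y (Y y)) x (X x)
        - mvfderiv I (fun y ↦ mvfderiv I f y (X y)) x (Y x) := by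
  -- In dimension zero no nonzero `W` exists, but then all tangent vectors vanish.
  by_cases hE : Subsingleton E
  · have h0 (v : TangentSpace I x) : v = 0 := Subsingleton.elim (α := E) _ _
    rw [h0 (mlieBracket I X Y x), h0 (X x), h0 (Y x)]
    simp
  obtain ⟨w, hw⟩ : ∃ w : TangentSpace I x, w ≠ 0 := by
    by_contra! h
    exact hE ⟨fun a b ↦ (h a).trans (h b).symm⟩
  obtain ⟨t, ht, hxt, hWt⟩ : ∃ t : Set M, IsOpen t ∧ x ∈ t ∧
      ContMDiffOn I (I.prod 𝓘(ℝ, E)) ∞ (T% (FiberBundle.extend E w)) t := by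
    obtain ⟨s, hs, h⟩ := exists_contMDiffOn_extend (k := ∞) I E w
    obtain ⟨t, hts, ht, hxt⟩ := mem_nhds_iff.1 hs
    exact ⟨t, ht, hxt, h.mono hts⟩
  set W := FiberBundle.extend E w with hWdef
  have hWx : W x = w := extend_apply_self _ _
  have hUt := hU.inter ht
  have hf := hf.mono (Set.inter_subset_left (t := t))
  have hX := hX.mono (Set.inter_subset_left (t := t))
  have hY := hY.mono (Set.inter_subset_left (t := t))
  have hW := hWt.mono (Set.inter_subset_right (s := U))
  have hxm : x ∈ U ∩ t := ⟨hx, hxt⟩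
  have : IsManifold I (minSmoothness ℝ 3) M := by
    rw [minSmoothness_of_isRCLikeNormedField]
    infer_instance
  have j (Z : Π x : M, TangentSpace I x) (hZ : ContMDiffOn I (I.prod 𝓘(ℝ, E)) ∞ (T% Z) (U ∩ t)) :=
    leibniz_identity_mlieBracket_apply (I := I) (U := X) (V := Y) (W := Z) (x := x)
      ((hX.contMDiffAt (hUt.mem_nhds hxm)).of_le (by simpa using ENat.LEInfty.out))
      ((hY.contMDiffAt (hUt.mem_nhds hxm)).of_le (by simpa using ENat.LEInfty.out))
      ((hZ.contMDiffAt (hUt.mem_nhds hxm)).of_le (by simpa using ENat.LEInfty.out))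
  have j1 := j W hW
  have j2 := j (f • W) (hf.smul_section hW)
  rw [mlieBracket_mlieBracket_smul hUt hf hX hY hW hxm,
    mlieBracket_mlieBracket_smul hUt hf hY hX hW hxm,
    mlieBracket_smul_right (mdifferentiableAt_of_contMDiffOn hUt hf hxm)
      (mdifferentiableAt_section_of_contMDiffOn hUt hW hxm), j1] at j2
  have h3 : (mvfderiv I (fun y ↦ mvfderiv I f y (Y y)) x (X x)
        - mvfderiv I (fun y ↦ mvfderiv I f y (X y)) x (Y x)
        - mvfderiv I f x (mlieBracket I X Y x)) • W x = 0 := by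
    rw [← sub_eq_zero] at j2
    rw [← j2]
    module
  rcases smul_eq_zero.1 h3 with h | h
  · linarith
  · exact absurd (hWx.symm.trans h) hw

/-- The Lie bracket of vector fields is the commutator of the derivatives along them. -/
theorem mvfderiv_mlieBracket {f : M → F} {X Y : Π x : M, TangentSpace I x}
    {U : Set M} (hU : IsOpen U) (hf : ContMDiffOn I 𝓘(ℝ, F) ∞ f U)
    (hX : ContMDiffOn I (I.prod 𝓘(ℝ, E)) ∞ (T% X) U)
    (hY : ContMDiffOn I (I.prod 𝓘(ℝ, E)) ∞ (T% Y) U) {x : M} (hx : x ∈ U) :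
    mvfderiv I f x (mlieBracket I X Y x) =
      mvfderiv I (fun y ↦ mvfderiv I f y (Y y)) x (X x)
        - mvfderiv I (fun y ↦ mvfderiv I f y (X y)) x (Y x) := by
  -- Continuous functionals separate the points of `F`, which reduces the claim to real-valued
  -- functions.
  refine (SeparatingDual.eq_iff_forall_dual_eq (R := ℝ)).2 fun l ↦ ?_
  have h := mvfderiv_mlieBracket_real hU (contMDiffOn_clm_comp l hf) hX hY hx
  have hc (Z : Π x : M, TangentSpace I x)
      (hZ : ContMDiffOn I (I.prod 𝓘(ℝ, E)) ∞ (T% Z) U) (v : TangentSpace I x) :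
      mvfderiv I (fun y ↦ mvfderiv I (fun y ↦ l (f y)) y (Z y)) x v =
        l (mvfderiv I (fun y ↦ mvfderiv I f y (Z y)) x v) := by
    rw [← mvfderiv_clm_comp l (mdifferentiableAt_of_contMDiffOn hU
      (contMDiffOn_mvfderiv_apply hU hf hZ) hx)]
    congr 1
    refine mvfderiv_congr ?_
    filter_upwards [hU.mem_nhds hx] with y hy
    exact mvfderiv_clm_comp l (mdifferentiableAt_of_contMDiffOn hU hf hy) _
  rw [hc Y hY, hc X hX, mvfderiv_clm_comp l (mdifferentiableAt_of_contMDiffOn hU hf hx)] at h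
  rw [map_sub, h]

end Bracket

/-! ### Instance shortcuts for the tangent bundle. -/

section Shortcuts

variable {n : ℕ} {M : Type*} [TopologicalSpace M] [ChartedSpace (EuclideanSpace ℝ (Fin n)) M]
  [IsManifold (𝓡 n) ∞ M]

@[reducible] scoped instance topologicalSpaceTangentBundle : TopologicalSpace
    (TotalSpace (EuclideanSpace ℝ (Fin n)) (fun x : M ↦ TangentSpace (𝓡 n) x)) := inferInstance

scoped instance isManifold_two : IsManifold (𝓡 n) 2 M := inferInstance

end Shortcuts

/-! ### Orthonormal frames and their connection coefficients. -/

section Frame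

set_option linter.unusedSectionVars false

variable {n : ℕ} {M : Type*} [TopologicalSpace M] [ChartedSpace (EuclideanSpace ℝ (Fin n)) M]
  [IsManifold (𝓡 n) ∞ M] [RiemannianBundle (fun x : M ↦ TangentSpace (𝓡 n) x)]
  [IsContMDiffRiemannianBundle (𝓡 n) ∞ (EuclideanSpace ℝ (Fin n))
    (fun x : M ↦ TangentSpace (𝓡 n) x)]

/-- Smoothness of a vector field on a set. -/
abbrev SmoothFieldOn (X : Π x : M, TangentSpace (𝓡 n) x) (U : Set M) : Prop :=
  ContMDiffOn (𝓡 n) ((𝓡 n).prod 𝓘(ℝ, EuclideanSpace ℝ (Fin n))) ∞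
    (fun x ↦ (⟨x, X x⟩ : TangentBundle (𝓡 n) M)) U

/-- Differentiability of a vector field at a point. -/
abbrev DiffFieldAt (X : Π x : M, TangentSpace (𝓡 n) x) (x : M) : Prop :=
  MDifferentiableAt (𝓡 n) ((𝓡 n).prod 𝓘(ℝ, EuclideanSpace ℝ (Fin n)))
    (fun x ↦ (⟨x, X x⟩ : TangentBundle (𝓡 n) M)) x

/-- A smooth orthonormal frame over an open set. -/
structure IsOrthonormalFrame (e : Fin n → Π x : M, TangentSpace (𝓡 n) x) (U : Set M) : Prop where
  isOpen : IsOpen U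
  smooth : ∀ a, SmoothFieldOn (e a) U
  orthonormal : ∀ x ∈ U, Orthonormal ℝ (fun a ↦ e a x)

/-- The connection coefficients `⟨∇_{e_a} e_b, e_c⟩` of a frame. -/
def connCoeff (e : Fin n → Π x : M, TangentSpace (𝓡 n) x) (a b c : Fin n) (x : M) : ℝ :=
  inner ℝ (leviCivita (I := 𝓡 n) (e b) x (e a x)) (e c x)

theorem SmoothFieldOn.mdifferentiableAt {X : Π x : M, TangentSpace (𝓡 n) x} {U : Set M}
    (hX : SmoothFieldOn X U) (hU : IsOpen U) {x : M} (hx : x ∈ U) : DiffFieldAt X x :=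
  mdifferentiableAt_section_of_contMDiffOn hU hX hx

theorem SmoothFieldOn.inner {X Y : Π x : M, TangentSpace (𝓡 n) x} {U : Set M}
    (hX : SmoothFieldOn X U) (hY : SmoothFieldOn Y U) :
    ContMDiffOn (𝓡 n) 𝓘(ℝ) ∞ (fun x ↦ (inner ℝ (X x) (Y x) : ℝ)) U :=
  ContMDiffOn.inner_bundle (F := EuclideanSpace ℝ (Fin n))
    (E := fun x : M ↦ TangentSpace (𝓡 n) x) (b := id) hX hY

theorem SmoothFieldOn.smul {f : M → ℝ} {X : Π x : M, TangentSpace (𝓡 n) x} {U : Set M}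
    (hf : ContMDiffOn (𝓡 n) 𝓘(ℝ) ∞ f U) (hX : SmoothFieldOn X U) :
    SmoothFieldOn (fun x ↦ f x • X x) U :=
  ContMDiffOn.smul_section hf hX

theorem SmoothFieldOn.add {X Y : Π x : M, TangentSpace (𝓡 n) x} {U : Set M}
    (hX : SmoothFieldOn X U) (hY : SmoothFieldOn Y U) : SmoothFieldOn (fun x ↦ X x + Y x) U :=
  ContMDiffOn.add_section hX hY

theorem SmoothFieldOn.sum {ι : Type*} (s : Finset ι) {X : ι → Π x : M, TangentSpace (𝓡 n) x}
    {U : Set M} (hX : ∀ i ∈ s, SmoothFieldOn (X i) U) :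
    SmoothFieldOn (fun x ↦ ∑ i ∈ s, X i x) U :=
  ContMDiffOn.sum_section hX

theorem leviCivita_congr {X Y : Π x : M, TangentSpace (𝓡 n) x} {U : Set M} (hU : IsOpen U)
    (hX : SmoothFieldOn X U) (h : ∀ y ∈ U, X y = Y y) {x : M} (hx : x ∈ U) :
    leviCivita (I := 𝓡 n) X x = leviCivita (I := 𝓡 n) Y x := by
  have hY : SmoothFieldOn Y U := hX.congr fun y hy ↦ by rw [h y hy]
  exact (leviCivita (I := 𝓡 n) (M := M)).isCovariantDerivativeOnUniv.congr_of_eventuallyEq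
    (hX.mdifferentiableAt hU hx) (hY.mdifferentiableAt hU hx) Filter.univ_mem
    (Filter.eventually_of_mem (hU.mem_nhds hx) h)

theorem leviCivita_add {X Y : Π x : M, TangentSpace (𝓡 n) x} {x : M}
    (hX : DiffFieldAt X x) (hY : DiffFieldAt Y x) :
    leviCivita (I := 𝓡 n) (fun y ↦ X y + Y y) x =
      leviCivita (I := 𝓡 n) X x + leviCivita (I := 𝓡 n) Y x :=
  (leviCivita (I := 𝓡 n) (M := M)).isCovariantDerivativeOnUniv.add hX hY

theorem leviCivita_smul {f : M → ℝ} {X : Π x : M, TangentSpace (𝓡 n) x} {x : M}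
    (hf : MDifferentiableAt (𝓡 n) 𝓘(ℝ) f x) (hX : DiffFieldAt X x) (v : TangentSpace (𝓡 n) x) :
    leviCivita (I := 𝓡 n) (fun y ↦ f y • X y) x v =
      f x • leviCivita (I := 𝓡 n) X x v + mvfderiv (𝓡 n) f x v • X x := by
  have h := (leviCivita (I := 𝓡 n) (M := M)).isCovariantDerivativeOnUniv.leibniz hX hf
  exact congrArg (fun T ↦ T v) h

theorem leviCivita_sum {ι : Type*} (s : Finset ι) {X : ι → Π x : M, TangentSpace (𝓡 n) x} {x : M}
    (hX : ∀ i ∈ s, DiffFieldAt (X i) x) :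
    leviCivita (I := 𝓡 n) (fun y ↦ ∑ i ∈ s, X i y) x =
      ∑ i ∈ s, leviCivita (I := 𝓡 n) (X i) x := by
  classical
  induction s using Finset.induction_on with
  | empty =>
    simp only [Finset.sum_empty]
    exact congrFun (leviCivita (I := 𝓡 n) (M := M)).zero x
  | insert a s ha ih =>
    simp only [Finset.sum_insert ha]
    rw [← ih fun i hi ↦ hX i (Finset.mem_insert_of_mem hi)]
    exact leviCivita_add (hX a (Finset.mem_insert_self a s))
      (MDifferentiableAt.sum_section fun i hi ↦ hX i (Finset.mem_insert_of_mem hi))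

theorem leviCivita_sub_leviCivita {X Y : Π x : M, TangentSpace (𝓡 n) x} {x : M}
    (hX : DiffFieldAt X x) (hY : DiffFieldAt Y x) :
    leviCivita (I := 𝓡 n) Y x (X x) - leviCivita (I := 𝓡 n) X x (Y x) =
      mlieBracket (𝓡 n) X Y x := by
  exact ((CovariantDerivative.torsion_eq_zero_iff (leviCivita (I := 𝓡 n) (M := M))).1
    leviCivita_torsion :) hX hY

namespace IsOrthonormalFrame

variable {e : Fin n → Π x : M, TangentSpace (𝓡 n) x} {U : Set M} (F : IsOrthonormalFrame e U)
include F

theorem mdifferentiableAt (a : Fin n) {x : M} (hx : x ∈ U) : DiffFieldAt (e a) x :=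
  (F.smooth a).mdifferentiableAt F.isOpen hx

theorem inner_eq {x : M} (hx : x ∈ U) (a b : Fin n) :
    (inner ℝ (e a x) (e b x) : ℝ) = if a = b then 1 else 0 :=
  orthonormal_iff_ite.1 (F.orthonormal x hx) a b

theorem exists_orthonormalBasis {x : M} (hx : x ∈ U) :
    ∃ b : OrthonormalBasis (Fin n) ℝ (TangentSpace (𝓡 n) x), ∀ a, b a = e a x := by
  have : FiniteDimensional ℝ (TangentSpace (𝓡 n) x) :=
    inferInstanceAs (FiniteDimensional ℝ (EuclideanSpace ℝ (Fin n)))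
  have hcard : Fintype.card (Fin n) = Module.finrank ℝ (TangentSpace (𝓡 n) x) :=
    (finrank_euclideanSpace (𝕜 := ℝ) (ι := Fin n)).symm
  have hn : n = 0 ∨ Nonempty (Fin n) := by
    rcases Nat.eq_zero_or_pos n with h | h
    · exact Or.inl h
    · exact Or.inr ⟨⟨0, h⟩⟩
  have hspan : ⊤ ≤ Submodule.span ℝ (Set.range fun a ↦ e a x) := by
    rw [((F.orthonormal x hx).linearIndependent.span_eq_top_of_card_eq_finrank' hcard)]
  exact ⟨OrthonormalBasis.mk (F.orthonormal x hx) hspan, fun a ↦ by simp⟩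

theorem sum_inner_smul {x : M} (hx : x ∈ U) (v : TangentSpace (𝓡 n) x) :
    ∑ a, (inner ℝ (e a x) v : ℝ) • e a x = v := by
  obtain ⟨b, hb⟩ := F.exists_orthonormalBasis hx
  simpa [hb] using b.sum_repr' v

theorem sum_inner_mul_inner {x : M} (hx : x ∈ U) (v w : TangentSpace (𝓡 n) x) :
    ∑ a, (inner ℝ (e a x) v : ℝ) * inner ℝ (e a x) w = inner ℝ v w := by
  conv_rhs => rw [← F.sum_inner_smul hx v]
  simp [sum_inner, inner_smul_left]

theorem smooth_of_inner {X : Π x : M, TangentSpace (𝓡 n) x}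
    (h : ∀ a, ContMDiffOn (𝓡 n) 𝓘(ℝ) ∞ (fun x ↦ (inner ℝ (e a x) (X x) : ℝ)) U) :
    SmoothFieldOn X U :=
  (SmoothFieldOn.sum Finset.univ fun a _ ↦ SmoothFieldOn.smul (h a) (F.smooth a)).congr
    fun x hx ↦ congrArg _ (F.sum_inner_smul hx (X x)).symm

/-- By the Koszul formula the frame components are sums of derivatives of inner products and of
inner products with brackets, all smooth. -/
theorem smooth_leviCivita {X Y : Π x : M, TangentSpace (𝓡 n) x} (hX : SmoothFieldOn X U)
    (hY : SmoothFieldOn Y U) :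
    SmoothFieldOn (fun x ↦ leviCivita (I := 𝓡 n) Y x (X x)) U := by
  refine F.smooth_of_inner fun c ↦ ?_
  have hZ := F.smooth c
  have hk : ContMDiffOn (𝓡 n) 𝓘(ℝ) ∞
      (fun x ↦ (1 / 2 : ℝ) * koszul (I := 𝓡 n) X Y (e c) x) U := by
    refine contMDiffOn_const.mul ?_
    have br {A B C : Π x : M, TangentSpace (𝓡 n) x} (hA : SmoothFieldOn A U)
        (hB : SmoothFieldOn B U) (hC : SmoothFieldOn C U) : ContMDiffOn (𝓡 n) 𝓘(ℝ) ∞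
          (fun x ↦ (inner ℝ (mlieBracket (𝓡 n) A B x) (C x) : ℝ)) U :=
      SmoothFieldOn.inner (contMDiffOn_mlieBracket F.isOpen hA hB) hC
    have dv {A B C : Π x : M, TangentSpace (𝓡 n) x} (hA : SmoothFieldOn A U)
        (hB : SmoothFieldOn B U) (hC : SmoothFieldOn C U) : ContMDiffOn (𝓡 n) 𝓘(ℝ) ∞
          (fun x ↦ mvfderiv (𝓡 n) (fun y ↦ (inner ℝ (A y) (B y) : ℝ)) x (C x)) U :=
      contMDiffOn_mvfderiv_apply F.isOpen (hA.inner hB) hC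
    exact (((((dv hY hZ hX).add (dv hZ hX hY)).sub (dv hX hY hZ)).add (br hX hY hZ)).sub
      (br hY hZ hX)).add (br hZ hX hY)
  refine hk.congr fun x hx ↦ ?_
  have := koszul_formula (hX.mdifferentiableAt F.isOpen hx) (hY.mdifferentiableAt F.isOpen hx)
    (hZ.mdifferentiableAt F.isOpen hx)
  rw [real_inner_comm, ← this]
  ring

theorem contMDiffOn_connCoeff (a b c : Fin n) :
    ContMDiffOn (𝓡 n) 𝓘(ℝ) ∞ (connCoeff e a b c) U :=
  SmoothFieldOn.inner (F.smooth_leviCivita (F.smooth a) (F.smooth b)) (F.smooth c)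

theorem leviCivita_eq_sum {x : M} (hx : x ∈ U) (a b : Fin n) :
    leviCivita (I := 𝓡 n) (e b) x (e a x) = ∑ c, connCoeff e a b c x • e c x := by
  rw [← F.sum_inner_smul hx (leviCivita (I := 𝓡 n) (e b) x (e a x))]
  simp [connCoeff, real_inner_comm]

/-- Differentiate the constant $\langle e_b,e_c\rangle=\delta_{bc}$ and use that the connection is
metric. -/
theorem inner_leviCivita_skew {x : M} (hx : x ∈ U) (v : TangentSpace (𝓡 n) x) (b c : Fin n) :
    (inner ℝ (leviCivita (I := 𝓡 n) (e b) x v) (e c x) : ℝ) =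
      -inner ℝ (leviCivita (I := 𝓡 n) (e c) x v) (e b x) := by
  have hv := mdifferentiableAt_extend (𝓡 n) (EuclideanSpace ℝ (Fin n)) v
  have h := leviCivita_metric hv (F.mdifferentiableAt b hx) (F.mdifferentiableAt c hx)
  rw [extend_apply_self, real_inner_comm _ (e b x)] at h
  have h0 : mvfderiv (𝓡 n) (fun y ↦ (inner ℝ (e b y) (e c y) : ℝ)) x = 0 := by
    rw [mvfderiv_congr (g := fun _ ↦ if b = c then 1 else 0)
      (Filter.eventually_of_mem (F.isOpen.mem_nhds hx) fun y hy ↦ F.inner_eq hy b c)]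
    exact mvfderiv_const _
  rw [h0] at h
  simp only [zero_apply] at h
  linarith

theorem connCoeff_skew {x : M} (hx : x ∈ U) (a b c : Fin n) :
    connCoeff e a b c x = -connCoeff e a c b x :=
  F.inner_leviCivita_skew hx _ b c

theorem mlieBracket_eq_sum {x : M} (hx : x ∈ U) (a b : Fin n) :
    mlieBracket (𝓡 n) (e a) (e b) x =
      ∑ c, (connCoeff e a b c x - connCoeff e b a c x) • e c x := by
  have h := leviCivita_sub_leviCivita (F.mdifferentiableAt a hx) (F.mdifferentiableAt b hx)
  rw [← h, F.leviCivita_eq_sum hx, F.leviCivita_eq_sum hx]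
  simp [sub_smul, Finset.sum_sub_distrib]

end IsOrthonormalFrame
end Frame

/-! ### Tensoriality of the curvature and the first Bianchi identity. -/

section Curvature

set_option linter.unusedSectionVars false

variable {n : ℕ} {M : Type*} [TopologicalSpace M] [ChartedSpace (EuclideanSpace ℝ (Fin n)) M]
  [IsManifold (𝓡 n) ∞ M] [RiemannianBundle (fun x : M ↦ TangentSpace (𝓡 n) x)]
  [IsContMDiffRiemannianBundle (𝓡 n) ∞ (EuclideanSpace ℝ (Fin n))
    (fun x : M ↦ TangentSpace (𝓡 n) x)]

section Tensoriality

variable {X X' Y Z Z' : Π x : M, TangentSpace (𝓡 n) x} {U : Set M}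

/-- Curvature is local; this is what permits replacing a vector field by its frame expansion, which
agrees with it on `U` only. -/
theorem riemannCurvature_congr {X₁ Y₁ Z₁ : Π x : M, TangentSpace (𝓡 n) x}
    {e : Fin n → Π x : M, TangentSpace (𝓡 n) x} (F : IsOrthonormalFrame e U)
    (hX : SmoothFieldOn X U) (hY : SmoothFieldOn Y U) (hZ : SmoothFieldOn Z U)
    (h1 : ∀ y ∈ U, X y = X₁ y) (h2 : ∀ y ∈ U, Y y = Y₁ y) (h3 : ∀ y ∈ U, Z y = Z₁ y)
    {x : M} (hx : x ∈ U) :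
    riemannCurvature (I := 𝓡 n) X Y Z x = riemannCurvature (I := 𝓡 n) X₁ Y₁ Z₁ x := by
  have hb : mlieBracket (𝓡 n) X Y x = mlieBracket (𝓡 n) X₁ Y₁ x :=
    Filter.EventuallyEq.mlieBracket_vectorField_eq
      (Filter.eventually_of_mem (F.isOpen.mem_nhds hx) h1)
      (Filter.eventually_of_mem (F.isOpen.mem_nhds hx) h2)
  have hc (A B : Π x : M, TangentSpace (𝓡 n) x) (hA : SmoothFieldOn A U)
      (hAB : ∀ y ∈ U, A y = B y) :
      leviCivita (I := 𝓡 n) (fun y ↦ leviCivita (I := 𝓡 n) Z y (A y)) x =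
        leviCivita (I := 𝓡 n) (fun y ↦ leviCivita (I := 𝓡 n) Z₁ y (B y)) x :=
    leviCivita_congr F.isOpen (F.smooth_leviCivita hA hZ)
      (fun y hy ↦ by rw [leviCivita_congr F.isOpen hZ h3 hy, hAB y hy]) hx
  simp only [riemannCurvature]
  rw [hb, hc X X₁ hX h1, hc Y Y₁ hY h2, leviCivita_congr F.isOpen hZ h3 hx, h1 x hx, h2 x hx]

theorem riemannCurvature_swap (x : M) :
    riemannCurvature (I := 𝓡 n) Y X Z x = -riemannCurvature (I := 𝓡 n) X Y Z x := by
  simp only [riemannCurvature]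
  rw [mlieBracket_swap_apply (V := Y) (W := X), map_neg]
  abel

variable {e : Fin n → Π x : M, TangentSpace (𝓡 n) x} (F : IsOrthonormalFrame e U)
include F

/-- The term $(Yf)\nabla_XZ$ from $\nabla_Y(f\nabla_XZ)$ cancels against the one from
$[fX,Y]=f[X,Y]-(Yf)X$. -/
theorem riemannCurvature_smul_left {f : M → ℝ} (hf : ContMDiffOn (𝓡 n) 𝓘(ℝ) ∞ f U)
    (hX : SmoothFieldOn X U) (hZ : SmoothFieldOn Z U)
    {x : M} (hx : x ∈ U) :
    riemannCurvature (I := 𝓡 n) (fun y ↦ f y • X y) Y Z x =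
      f x • riemannCurvature (I := 𝓡 n) X Y Z x := by
  have df := mdifferentiableAt_of_contMDiffOn F.isOpen hf hx
  simp only [riemannCurvature, map_smul]
  rw [leviCivita_smul df ((F.smooth_leviCivita hX hZ).mdifferentiableAt F.isOpen hx),
    show mlieBracket (𝓡 n) (fun y ↦ f y • X y) Y x = _ from
      mlieBracket_smul_left df (hX.mdifferentiableAt F.isOpen hx)]
  simp only [map_add, map_smul, neg_smul, map_neg]
  module

theorem riemannCurvature_add_left (hX : SmoothFieldOn X U) (hX' : SmoothFieldOn X' U)
    (hZ : SmoothFieldOn Z U) {x : M} (hx : x ∈ U) :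
    riemannCurvature (I := 𝓡 n) (fun y ↦ X y + X' y) Y Z x =
      riemannCurvature (I := 𝓡 n) X Y Z x + riemannCurvature (I := 𝓡 n) X' Y Z x := by
  simp only [riemannCurvature, map_add]
  rw [leviCivita_add ((F.smooth_leviCivita hX hZ).mdifferentiableAt F.isOpen hx)
    ((F.smooth_leviCivita hX' hZ).mdifferentiableAt F.isOpen hx),
    show mlieBracket (𝓡 n) (fun y ↦ X y + X' y) Y x = _ from
      mlieBracket_add_left (hX.mdifferentiableAt F.isOpen hx) (hX'.mdifferentiableAt F.isOpen hx)]
  simp only [map_add, add_apply]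
  abel

/-- The mixed first-order terms are symmetric in `X` and `Y` and cancel; the second derivatives of
`f` combine to $X(Yf)-Y(Xf)-[X,Y]f=0$. -/
theorem riemannCurvature_smul_right {f : M → ℝ} (hf : ContMDiffOn (𝓡 n) 𝓘(ℝ) ∞ f U)
    (hX : SmoothFieldOn X U) (hY : SmoothFieldOn Y U) (hZ : SmoothFieldOn Z U)
    {x : M} (hx : x ∈ U) :
    riemannCurvature (I := 𝓡 n) X Y (fun y ↦ f y • Z y) x =
      f x • riemannCurvature (I := 𝓡 n) X Y Z x := by
  have df {y : M} (hy : y ∈ U) := mdifferentiableAt_of_contMDiffOn F.isOpen hf hy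
  have key (A : Π x : M, TangentSpace (𝓡 n) x) (hA : SmoothFieldOn A U)
      (v : TangentSpace (𝓡 n) x) :
      leviCivita (I := 𝓡 n) (fun y ↦ leviCivita (I := 𝓡 n) (fun y ↦ f y • Z y) y (A y)) x v =
        f x • leviCivita (I := 𝓡 n) (fun y ↦ leviCivita (I := 𝓡 n) Z y (A y)) x v
        + mvfderiv (𝓡 n) f x v • leviCivita (I := 𝓡 n) Z x (A x)
        + (mvfderiv (𝓡 n) f x (A x) • leviCivita (I := 𝓡 n) Z x v
        + mvfderiv (𝓡 n) (fun y ↦ mvfderiv (𝓡 n) f y (A y)) x v • Z x) := by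
    have hAZ := F.smooth_leviCivita hA hZ
    have hfA := contMDiffOn_mvfderiv_apply F.isOpen hf hA
    rw [leviCivita_congr F.isOpen (F.smooth_leviCivita hA (SmoothFieldOn.smul hf hZ))
      (fun y hy ↦ leviCivita_smul (df hy) (hZ.mdifferentiableAt F.isOpen hy) (A y)) hx,
      leviCivita_add ((SmoothFieldOn.smul hf hAZ).mdifferentiableAt F.isOpen hx)
        ((SmoothFieldOn.smul hfA hZ).mdifferentiableAt F.isOpen hx), add_apply,
      leviCivita_smul (df hx) (hAZ.mdifferentiableAt F.isOpen hx),
      leviCivita_smul (mdifferentiableAt_of_contMDiffOn F.isOpen hfA hx)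
        (hZ.mdifferentiableAt F.isOpen hx)]
  simp only [riemannCurvature]
  rw [key Y hY, key X hX, leviCivita_smul (df hx) (hZ.mdifferentiableAt F.isOpen hx),
    mvfderiv_mlieBracket F.isOpen hf hX hY hx]
  module

theorem riemannCurvature_add_right (hX : SmoothFieldOn X U) (hY : SmoothFieldOn Y U)
    (hZ : SmoothFieldOn Z U) (hZ' : SmoothFieldOn Z' U) {x : M} (hx : x ∈ U) :
    riemannCurvature (I := 𝓡 n) X Y (fun y ↦ Z y + Z' y) x =
      riemannCurvature (I := 𝓡 n) X Y Z x + riemannCurvature (I := 𝓡 n) X Y Z' x := by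
  have key (A : Π x : M, TangentSpace (𝓡 n) x) (hA : SmoothFieldOn A U)
      (v : TangentSpace (𝓡 n) x) :
      leviCivita (I := 𝓡 n) (fun y ↦ leviCivita (I := 𝓡 n) (fun y ↦ Z y + Z' y) y (A y)) x v =
        leviCivita (I := 𝓡 n) (fun y ↦ leviCivita (I := 𝓡 n) Z y (A y)) x v
        + leviCivita (I := 𝓡 n) (fun y ↦ leviCivita (I := 𝓡 n) Z' y (A y)) x v := by
    rw [leviCivita_congr F.isOpen (F.smooth_leviCivita hA (SmoothFieldOn.add hZ hZ'))
      (fun y hy ↦ by rw [leviCivita_add (hZ.mdifferentiableAt F.isOpen hy)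
        (hZ'.mdifferentiableAt F.isOpen hy), add_apply]) hx,
      leviCivita_add ((F.smooth_leviCivita hA hZ).mdifferentiableAt F.isOpen hx)
        ((F.smooth_leviCivita hA hZ').mdifferentiableAt F.isOpen hx), add_apply]
  simp only [riemannCurvature]
  rw [key Y hY, key X hX, leviCivita_add (hZ.mdifferentiableAt F.isOpen hx)
        (hZ'.mdifferentiableAt F.isOpen hx), add_apply]
  abel

theorem riemannCurvature_sum_left {ι : Type*} (s : Finset ι) {f : ι → M → ℝ}
    {A : ι → Π x : M, TangentSpace (𝓡 n) x} (hf : ∀ i, ContMDiffOn (𝓡 n) 𝓘(ℝ) ∞ (f i) U)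
    (hA : ∀ i, SmoothFieldOn (A i) U) (hZ : SmoothFieldOn Z U) {x : M} (hx : x ∈ U) :
    riemannCurvature (I := 𝓡 n) (fun y ↦ ∑ i ∈ s, f i y • A i y) Y Z x =
      ∑ i ∈ s, f i x • riemannCurvature (I := 𝓡 n) (A i) Y Z x := by
  classical
  induction s using Finset.induction_on with
  | empty =>
    -- The empty sum is the zero field, seen here as the function `0` times a smooth field.
    have h := riemannCurvature_smul_left (Y := Y) F
      (contMDiffOn_const (c := (0 : ℝ))) hZ hZ hx
    simpa using h
  | insert a s ha ih =>
    simp only [Finset.sum_insert ha]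
    rw [riemannCurvature_add_left F (SmoothFieldOn.smul (hf a) (hA a))
      (SmoothFieldOn.sum s fun i _ ↦ SmoothFieldOn.smul (hf i) (hA i)) hZ hx, ih,
      riemannCurvature_smul_left F (hf a) (hA a) hZ hx]

theorem riemannCurvature_sum_right {ι : Type*} (s : Finset ι) {f : ι → M → ℝ}
    {A : ι → Π x : M, TangentSpace (𝓡 n) x} (hf : ∀ i, ContMDiffOn (𝓡 n) 𝓘(ℝ) ∞ (f i) U)
    (hA : ∀ i, SmoothFieldOn (A i) U) (hX : SmoothFieldOn X U) (hY : SmoothFieldOn Y U)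
    {x : M} (hx : x ∈ U) :
    riemannCurvature (I := 𝓡 n) X Y (fun y ↦ ∑ i ∈ s, f i y • A i y) x =
      ∑ i ∈ s, f i x • riemannCurvature (I := 𝓡 n) X Y (A i) x := by
  classical
  induction s using Finset.induction_on with
  | empty =>
    have h := riemannCurvature_smul_right F
      (contMDiffOn_const (c := (0 : ℝ))) hX hY hX hx
    simpa using h
  | insert a s ha ih =>
    simp only [Finset.sum_insert ha]
    rw [riemannCurvature_add_right F hX hY (SmoothFieldOn.smul (hf a) (hA a))
      (SmoothFieldOn.sum s fun i _ ↦ SmoothFieldOn.smul (hf i) (hA i)) hx, ih,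
      riemannCurvature_smul_right F (hf a) hX hY (hA a) hx]

/-- The curvature at a point depends on the values of the vector fields at this point only. -/
theorem riemannCurvature_eq_sum (hX : SmoothFieldOn X U) (hY : SmoothFieldOn Y U)
    (hZ : SmoothFieldOn Z U) {x : M} (hx : x ∈ U) :
    riemannCurvature (I := 𝓡 n) X Y Z x = ∑ a, ∑ b, ∑ c,
      ((inner ℝ (e a x) (X x) : ℝ) * inner ℝ (e b x) (Y x) * inner ℝ (e c x) (Z x)) •
        riemannCurvature (I := 𝓡 n) (e a) (e b) (e c) x := by
  have hs (A : Π x : M, TangentSpace (𝓡 n) x) (y : M) (hy : y ∈ U) :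
      A y = ∑ a, (inner ℝ (e a y) (A y) : ℝ) • e a y := (F.sum_inner_smul hy (A y)).symm
  rw [riemannCurvature_congr F hX hY hZ (hs X) (fun _ _ ↦ rfl) (fun _ _ ↦ rfl) hx,
    riemannCurvature_sum_left F _ (fun a ↦ (F.smooth a).inner hX) F.smooth hZ hx]
  refine Finset.sum_congr rfl fun a _ ↦ ?_
  rw [riemannCurvature_swap,
    riemannCurvature_congr F hY (F.smooth a) hZ (hs Y) (fun _ _ ↦ rfl) (fun _ _ ↦ rfl) hx,
    riemannCurvature_sum_left F _ (fun b ↦ (F.smooth b).inner hY) F.smooth hZ hx,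
    ← Finset.sum_neg_distrib, Finset.smul_sum]
  refine Finset.sum_congr rfl fun b _ ↦ ?_
  rw [← smul_neg, ← riemannCurvature_swap,
    riemannCurvature_congr F (F.smooth a) (F.smooth b) hZ (fun _ _ ↦ rfl) (fun _ _ ↦ rfl)
      (hs Z) hx,
    riemannCurvature_sum_right F _ (fun c ↦ (F.smooth c).inner hZ) F.smooth (F.smooth a)
      (F.smooth b) hx, Finset.smul_sum, Finset.smul_sum]
  exact Finset.sum_congr rfl fun c _ ↦ by module

/-- Vanishing torsion turns the cyclic sum of curvatures into the cyclic sum of double brackets,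
which is zero by the Jacobi identity. -/
theorem riemannCurvature_bianchi (hX : SmoothFieldOn X U) (hY : SmoothFieldOn Y U)
    (hZ : SmoothFieldOn Z U) {x : M} (hx : x ∈ U) :
    riemannCurvature (I := 𝓡 n) X Y Z x + riemannCurvature (I := 𝓡 n) Y Z X x
      + riemannCurvature (I := 𝓡 n) Z X Y x = 0 := by
  -- Torsion-freeness used twice: $\nabla_BC-\nabla_CB=[B,C]$, and then
  -- $\nabla_A[B,C]-\nabla_{[B,C]}A=[A,[B,C]]$.
  have t (A B C : Π x : M, TangentSpace (𝓡 n) x) (hA : SmoothFieldOn A U)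
      (hB : SmoothFieldOn B U) (hC : SmoothFieldOn C U) :
      leviCivita (I := 𝓡 n) (fun y ↦ leviCivita (I := 𝓡 n) C y (B y)) x (A x)
        - leviCivita (I := 𝓡 n) (fun y ↦ leviCivita (I := 𝓡 n) B y (C y)) x (A x)
        - leviCivita (I := 𝓡 n) A x (mlieBracket (𝓡 n) B C x) =
      mlieBracket (𝓡 n) A (mlieBracket (𝓡 n) B C) x := by
    have hBC := contMDiffOn_mlieBracket F.isOpen hB hC
    rw [← leviCivita_sub_leviCivita (hA.mdifferentiableAt F.isOpen hx)
      (SmoothFieldOn.mdifferentiableAt hBC F.isOpen hx), sub_left_inj, sub_eq_iff_eq_add,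
      ← add_apply, ← leviCivita_add (SmoothFieldOn.mdifferentiableAt hBC F.isOpen hx)
        ((F.smooth_leviCivita hC hB).mdifferentiableAt F.isOpen hx)]
    congr 1
    refine leviCivita_congr F.isOpen (F.smooth_leviCivita hB hC) (fun y hy ↦ ?_) hx
    rw [← leviCivita_sub_leviCivita (hB.mdifferentiableAt F.isOpen hy)
      (hC.mdifferentiableAt F.isOpen hy)]
    abel
  have : IsManifold (𝓡 n) (minSmoothness ℝ 3) M := by
    rw [minSmoothness_of_isRCLikeNormedField]
    infer_instance
  have jac := leibniz_identity_mlieBracket_apply (I := 𝓡 n) (U := X) (V := Y) (W := Z) (x := x)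
      ((hX.contMDiffAt (F.isOpen.mem_nhds hx)).of_le (by simpa using ENat.LEInfty.out))
      ((hY.contMDiffAt (F.isOpen.mem_nhds hx)).of_le (by simpa using ENat.LEInfty.out))
      ((hZ.contMDiffAt (F.isOpen.mem_nhds hx)).of_le (by simpa using ENat.LEInfty.out))
  have h1 := t X Y Z hX hY hZ
  have h2 := t Y Z X hY hZ hX
  have h3 := t Z X Y hZ hX hY
  rw [mlieBracket_swap_apply (V := mlieBracket (𝓡 n) X Y) (W := Z),
    mlieBracket_swap (V := X) (W := Z), ← h1, ← h3,
    show mlieBracket (𝓡 n) Y (-mlieBracket (𝓡 n) Z X) x =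
      -mlieBracket (𝓡 n) Y (mlieBracket (𝓡 n) Z X) x by
      have := mlieBracket_const_smul_right (I := 𝓡 n) (V := Y) (c := (-1 : ℝ))
        (SmoothFieldOn.mdifferentiableAt (contMDiffOn_mlieBracket F.isOpen hZ hX) F.isOpen hx)
      simpa using this, ← h2] at jac
  simp only [riemannCurvature]
  rw [← sub_eq_zero] at jac
  rw [← jac]
  abel

end Tensoriality

end Curvature

/-! ### Components of the curvature in a frame and their symmetries. -/

section CurvatureCoefficients

set_option linter.unusedSectionVars false

variable {n : ℕ} {M : Type*} [TopologicalSpace M] [ChartedSpace (EuclideanSpace ℝ (Fin n)) M]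
  [IsManifold (𝓡 n) ∞ M] [RiemannianBundle (fun x : M ↦ TangentSpace (𝓡 n) x)]
  [IsContMDiffRiemannianBundle (𝓡 n) ∞ (EuclideanSpace ℝ (Fin n))
    (fun x : M ↦ TangentSpace (𝓡 n) x)]

/-- The components `⟨R(e_a, e_b) e_k, e_l⟩` of the curvature in a frame. -/
def curvCoeff (e : Fin n → Π x : M, TangentSpace (𝓡 n) x) (a b k l : Fin n) (x : M) : ℝ :=
  inner ℝ (riemannCurvature (I := 𝓡 n) (e a) (e b) (e k) x) (e l x)

namespace IsOrthonormalFrame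

variable {e : Fin n → Π x : M, TangentSpace (𝓡 n) x} {U : Set M} (F : IsOrthonormalFrame e U)
include F

theorem inner_sum_smul {x : M} (hx : x ∈ U) (f : Fin n → ℝ) (l : Fin n) :
    (inner ℝ (∑ c, f c • e c x) (e l x) : ℝ) = f l := by
  simp [sum_inner, inner_smul_left, F.inner_eq hx]

theorem inner_leviCivita_leviCivita {x : M} (hx : x ∈ U) (a b k l : Fin n) :
    (inner ℝ (leviCivita (I := 𝓡 n) (fun y ↦ leviCivita (I := 𝓡 n) (e k) y (e b y)) x (e a x))
      (e l x) : ℝ) = mvfderiv (𝓡 n) (connCoeff e b k l) x (e a x)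
        + ∑ m, connCoeff e b k m x * connCoeff e a m l x := by
  have hd (m : Fin n) := mdifferentiableAt_of_contMDiffOn F.isOpen (F.contMDiffOn_connCoeff b k m) hx
  rw [leviCivita_congr F.isOpen (F.smooth_leviCivita (F.smooth b) (F.smooth k))
      (fun y hy ↦ F.leviCivita_eq_sum hy b k) hx,
    leviCivita_sum _ fun m _ ↦ (SmoothFieldOn.smul (F.contMDiffOn_connCoeff b k m)
      (F.smooth m)).mdifferentiableAt F.isOpen hx]
  simp only [FunLike.coe_sum, Finset.sum_apply]
  rw [Finset.sum_congr rfl fun m _ ↦ leviCivita_smul (hd m) (F.mdifferentiableAt m hx) (e a x),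
    Finset.sum_add_distrib, inner_add_left, F.inner_sum_smul hx, add_comm]
  congr 1
  simp [sum_inner, inner_smul_left, connCoeff]

/-- This is Cartan's second structure equation $d\omega+\omega\wedge\omega$ evaluated on two frame
fields; the last sum comes from their bracket. -/
theorem curvCoeff_eq {x : M} (hx : x ∈ U) (a b k l : Fin n) :
    curvCoeff e a b k l x = mvfderiv (𝓡 n) (connCoeff e b k l) x (e a x)
      - mvfderiv (𝓡 n) (connCoeff e a k l) x (e b x)
      + ∑ m, (connCoeff e b k m x * connCoeff e a m l x
        - connCoeff e a k m x * connCoeff e b m l x)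
      - ∑ c, (connCoeff e a b c x - connCoeff e b a c x) * connCoeff e c k l x := by
  simp only [curvCoeff, riemannCurvature]
  rw [inner_sub_left, inner_sub_left, F.inner_leviCivita_leviCivita hx,
    F.inner_leviCivita_leviCivita hx, F.mlieBracket_eq_sum hx, Finset.sum_sub_distrib]
  simp only [map_sum, map_smul, sum_inner, inner_smul_left]
  simp only [connCoeff, conj_trivial]
  ring

theorem curvCoeff_swap (x : M) (a b k l : Fin n) :
    curvCoeff e b a k l x = -curvCoeff e a b k l x := by
  rw [curvCoeff, riemannCurvature_swap, inner_neg_left, curvCoeff]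

/-- Skewness is inherited term by term from the connection coefficients through the structure
equation; products of two coefficients change sign after exchanging the two summands. -/
theorem curvCoeff_skew {x : M} (hx : x ∈ U) (a b k l : Fin n) :
    curvCoeff e a b l k x = -curvCoeff e a b k l x := by
  have hd (a b : Fin n) : mvfderiv (𝓡 n) (connCoeff e b l k) x (e a x) =
      -mvfderiv (𝓡 n) (connCoeff e b k l) x (e a x) := by
    rw [mvfderiv_congr (g := fun y ↦ -connCoeff e b k l y)
      (Filter.eventually_of_mem (F.isOpen.mem_nhds hx) fun y hy ↦ F.connCoeff_skew hy b l k)]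
    exact congrArg (fun T ↦ T (e a x)) (mvfderiv_neg (I := 𝓡 n) (g := connCoeff e b k l) (x := x))
  rw [F.curvCoeff_eq hx, F.curvCoeff_eq hx, hd, hd]
  have h1 : ∑ m, (connCoeff e b l m x * connCoeff e a m k x
        - connCoeff e a l m x * connCoeff e b m k x) =
      -∑ m, (connCoeff e b k m x * connCoeff e a m l x
        - connCoeff e a k m x * connCoeff e b m l x) := by
    rw [← Finset.sum_neg_distrib]
    refine Finset.sum_congr rfl fun m _ ↦ ?_
    rw [F.connCoeff_skew hx b l m, F.connCoeff_skew hx a m k, F.connCoeff_skew hx a l m,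
      F.connCoeff_skew hx b m k]
    ring
  have h2 : ∑ c, (connCoeff e a b c x - connCoeff e b a c x) * connCoeff e c l k x =
      -∑ c, (connCoeff e a b c x - connCoeff e b a c x) * connCoeff e c k l x := by
    rw [← Finset.sum_neg_distrib]
    refine Finset.sum_congr rfl fun m _ ↦ ?_
    rw [F.connCoeff_skew hx m l k]
    ring
  rw [h1, h2]
  ring

theorem curvCoeff_bianchi {x : M} (hx : x ∈ U) (a b k l : Fin n) :
    curvCoeff e a b k l x + curvCoeff e b k a l x + curvCoeff e k a b l x = 0 := by
  simp only [curvCoeff, ← inner_add_left]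
  rw [riemannCurvature_bianchi F (F.smooth a) (F.smooth b) (F.smooth k) hx, inner_zero_left]

/-- The classical octahedron argument: a linear combination of four Bianchi identities, simplified
by the two skew symmetries. -/
theorem curvCoeff_pair_symm {x : M} (hx : x ∈ U) (a b k l : Fin n) :
    curvCoeff e k l a b x = curvCoeff e a b k l x := by
  have h1 := F.curvCoeff_bianchi hx a b k l
  have h2 := F.curvCoeff_bianchi hx b k l a
  have h3 := F.curvCoeff_bianchi hx k l a b
  have h4 := F.curvCoeff_bianchi hx l a b k
  have s := F.curvCoeff_swap x
  have t := F.curvCoeff_skew hx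
  linarith [s a b k l, s a b l k, s b k a l, s b k l a, s k l a b, s k l b a, s l a b k, s l a k b,
    s k a b l, s k a l b, s l b k a, s l b a k, t a b k l, t b k a l, t k l a b, t l a b k,
    t k a b l, t l b k a, t a k l b, t b l a k, s a k l b, s b l a k, s a k b l, s b l k a]

end IsOrthonormalFrame

/-- The scalar curvature in an orthonormal frame. -/
theorem IsOrthonormalFrame.scalarCurvature_eq
    {e : Fin n → Π x : M, TangentSpace (𝓡 n) x} {U : Set M} (F : IsOrthonormalFrame e U)
    {x : M} (hx : x ∈ U) :
    scalarCurvature (𝓡 n) x = ∑ a, ∑ b, curvCoeff e a b b a x := by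
  have : FiniteDimensional ℝ (TangentSpace (𝓡 n) x) :=
    inferInstanceAs (FiniteDimensional ℝ (EuclideanSpace ℝ (Fin n)))
  set ε := stdOrthonormalBasis ℝ (TangentSpace (𝓡 n) x) with hε
  have hV (v : TangentSpace (𝓡 n) x) : ∃ t : Set M, IsOpen t ∧ x ∈ t ∧
      SmoothFieldOn (FiberBundle.extend (EuclideanSpace ℝ (Fin n)) v) t := by
    obtain ⟨s, hs, h⟩ := exists_contMDiffOn_extend (k := ∞) (𝓡 n) (EuclideanSpace ℝ (Fin n)) v
    obtain ⟨t, hts, ht, hxt⟩ := mem_nhds_iff.1 hs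
    exact ⟨t, ht, hxt, h.mono hts⟩
  -- The extensions of `v` and `w` are smooth only near `x`, so the frame is restricted to a smaller
  -- open set before tensoriality is applied.
  have hR (v w : TangentSpace (𝓡 n) x) :
      (inner ℝ (riemannCurvature (I := 𝓡 n) (FiberBundle.extend (EuclideanSpace ℝ (Fin n)) v)
        (FiberBundle.extend (EuclideanSpace ℝ (Fin n)) w)
        (FiberBundle.extend (EuclideanSpace ℝ (Fin n)) w) x) v : ℝ) =
      ∑ a, ∑ b, ∑ c, ∑ d, (inner ℝ (e a x) v * inner ℝ (e d x) v)
        * (inner ℝ (e b x) w * inner ℝ (e c x) w) * curvCoeff e a b c d x := by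
    obtain ⟨t, ht, hxt, hv⟩ := hV v
    obtain ⟨s, hs, hxs, hw⟩ := hV w
    have hsub : U ∩ (t ∩ s) ⊆ U := Set.inter_subset_left
    have F' : IsOrthonormalFrame e (U ∩ (t ∩ s)) :=
      ⟨F.isOpen.inter (ht.inter hs), fun a ↦ (F.smooth a).mono hsub,
        fun y hy ↦ F.orthonormal y (hsub hy)⟩
    rw [riemannCurvature_eq_sum F' (hv.mono fun y hy ↦ hy.2.1) (hw.mono fun y hy ↦ hy.2.2)
      (hw.mono fun y hy ↦ hy.2.2) ⟨hx, hxt, hxs⟩]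
    simp only [extend_apply_self, sum_inner, inner_smul_left, conj_trivial]
    refine Finset.sum_congr rfl fun a _ ↦ Finset.sum_congr rfl fun b _ ↦
      Finset.sum_congr rfl fun c _ ↦ ?_
    rw [← F.sum_inner_mul_inner hx (riemannCurvature (I := 𝓡 n) (e a) (e b) (e c) x) v,
      Finset.mul_sum]
    refine Finset.sum_congr rfl fun d _ ↦ ?_
    rw [curvCoeff, real_inner_comm (riemannCurvature (I := 𝓡 n) (e a) (e b) (e c) x) (e d x)]
    ring
  -- Parseval in the basis `ε`: summing over `ε` contracts the frame indices and removes the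
  -- dependence on `ε`.
  have hε1 (a d : Fin n) : ∑ i, (inner ℝ (e a x) (ε i) : ℝ) * inner ℝ (e d x) (ε i) =
      if a = d then 1 else 0 := by
    rw [← F.inner_eq hx a d, ← ε.sum_inner_mul_inner (e a x) (e d x)]
    exact Finset.sum_congr rfl fun i _ ↦ by rw [real_inner_comm (ε i) (e d x)]
  have h0 : scalarCurvature (𝓡 n) x = ∑ i, ∑ j, (inner ℝ (riemannCurvature (I := 𝓡 n)
        (FiberBundle.extend (EuclideanSpace ℝ (Fin n)) (ε i))
        (FiberBundle.extend (EuclideanSpace ℝ (Fin n)) (ε j))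
        (FiberBundle.extend (EuclideanSpace ℝ (Fin n)) (ε j)) x) (ε i) : ℝ) := rfl
  rw [h0]
  simp only [hR]
  calc _ = ∑ a, ∑ b, ∑ c, ∑ d, (∑ i, (inner ℝ (e a x) (ε i) : ℝ) * inner ℝ (e d x) (ε i))
        * (∑ j, (inner ℝ (e b x) (ε j) : ℝ) * inner ℝ (e c x) (ε j)) * curvCoeff e a b c d x := by
        simp only [Finset.sum_mul_sum]
        simp only [Finset.sum_mul]
        simp only [Finset.sum_comm (γ := Fin n) (α := Fin (Module.finrank ℝ (TangentSpace (𝓡 n) x)))]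
    _ = _ := by
        simp [hε1]

end CurvatureCoefficients

/-! ### Clifford contractions of tensors. -/

section CliffordRelations

set_option linter.unusedSectionVars false

variable {n : ℕ} {A : Type*} [Ring A] [Algebra ℝ A]

/-- The relations `γ a * γ b + γ b * γ a = -2 δ a b`. -/
def IsCliffordFamily (γ : Fin n → A) : Prop :=
  ∀ a b, γ a * γ b + γ b * γ a = (if a = b then (-2 : ℝ) else 0) • (1 : A)

theorem sum_cyclic {B : Type*} [AddCommMonoid B] (f : Fin n → Fin n → Fin n → B) :
    ∑ a, ∑ b, ∑ c, f b c a = ∑ a, ∑ b, ∑ c, f a b c := by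
  rw [Finset.sum_comm]
  exact Finset.sum_congr rfl fun b _ ↦ Finset.sum_comm

namespace IsCliffordFamily

variable {γ : Fin n → A} (h : IsCliffordFamily γ)
include h

theorem mul_swap (a b : Fin n) :
    γ a * γ b = (if a = b then (-2 : ℝ) else 0) • (1 : A) - γ b * γ a :=
  eq_sub_of_add_eq (h a b)

theorem mul_self (a : Fin n) : γ a * γ a = -1 := by
  have h1 := h a a
  rw [if_pos rfl, ← two_smul ℝ] at h1
  have h2 := congrArg (fun z ↦ (1 / 2 : ℝ) • z) h1
  simpa [smul_smul] using h2

theorem mul_eq_neg_mul {a b : Fin n} (hab : a ≠ b) : γ a * γ b = -(γ b * γ a) := by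
  rw [h.mul_swap, if_neg hab]
  simp

/-- Two anticommutations carry `γ a` to the front and their signs cancel, so a cyclic rotation of a
cubic word costs only terms of degree one. -/
theorem mul_mul_rotate (a b c : Fin n) :
    γ b * γ c * γ a = γ a * γ b * γ c + (if a = c then (-2 : ℝ) else 0) • γ b
      - (if a = b then (-2 : ℝ) else 0) • γ c := by
  have h1 := h.mul_swap a b
  have h2 := h.mul_swap c a
  rw [mul_assoc, h2, h1, sub_mul, mul_sub, mul_assoc (γ b)]
  simp only [eq_comm (a := c) (b := a), mul_smul_comm, smul_mul_assoc, mul_one, one_mul]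
  abel

/-- Only the symmetric part of `γ a * γ b`, which is $-\delta_{ab}$, survives against symmetric
coefficients. -/
theorem sum_symm (C : Fin n → Fin n → ℝ) (hC : ∀ a b, C a b = C b a) :
    ∑ a, ∑ b, C a b • (γ a * γ b) = -(∑ a, C a a) • (1 : A) := by
  have h1 : (2 : ℝ) • ∑ a, ∑ b, C a b • (γ a * γ b) = (2 : ℝ) • (-(∑ a, C a a) • (1 : A)) := by
    calc (2 : ℝ) • ∑ a, ∑ b, C a b • (γ a * γ b)
        = ∑ a, ∑ b, C a b • (γ a * γ b) + ∑ a, ∑ b, C b a • (γ b * γ a) := by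
          rw [two_smul, Finset.sum_comm (f := fun a b ↦ C b a • (γ b * γ a))]
      _ = ∑ a, ∑ b, C a b • (γ a * γ b + γ b * γ a) := by
          simp only [← Finset.sum_add_distrib, smul_add]
          exact Finset.sum_congr rfl fun a _ ↦ Finset.sum_congr rfl fun b _ ↦ by rw [hC b a]
      _ = _ := by
          simp only [h _ _, ite_smul, zero_smul, smul_ite, smul_zero, smul_smul, Finset.sum_ite_eq,
            Finset.mem_univ, if_true, ← Finset.sum_smul, ← Finset.sum_mul]
          congr 1
          ring
  exact smul_right_injective A (two_ne_zero (α := ℝ)) h1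

/-- A skew-symmetric matrix `B` acts on vectors as the commutator with `1/4 ∑ B a b γ a γ b`. -/
theorem commutator_sum (B : Fin n → Fin n → ℝ) (hB : ∀ a b, B a b = -B b a) (d : Fin n) :
    (∑ a, ∑ b, (1 / 4 * B a b) • (γ a * γ b)) * γ d
      - γ d * (∑ a, ∑ b, (1 / 4 * B a b) • (γ a * γ b)) = ∑ c, B d c • γ c := by
  have h1 (a b : Fin n) : γ a * γ b * γ d - γ d * (γ a * γ b) =
      (if d = b then (-2 : ℝ) else 0) • γ a - (if d = a then (-2 : ℝ) else 0) • γ b := by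
    rw [h.mul_mul_rotate d a b, ← mul_assoc]
    abel
  calc _ = ∑ a, ∑ b, (1 / 4 * B a b) • (γ a * γ b * γ d - γ d * (γ a * γ b)) := by
        simp only [Finset.sum_mul, Finset.mul_sum, smul_mul_assoc, mul_smul_comm, smul_sub,
          Finset.sum_sub_distrib]
    _ = ∑ a, (1 / 4 * B a d * (-2)) • γ a - ∑ b, (1 / 4 * B d b * (-2)) • γ b := by
        simp only [h1, smul_sub, Finset.sum_sub_distrib, ite_smul, zero_smul, smul_ite, smul_zero,
          smul_smul, Finset.sum_ite_eq, Finset.mem_univ, if_true]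
        congr 1
        rw [Finset.sum_comm]
        simp only [Finset.sum_ite_eq, Finset.mem_univ, if_true]
    _ = _ := by
        rw [← Finset.sum_sub_distrib]
        refine Finset.sum_congr rfl fun c _ ↦ ?_
        rw [← sub_smul, hB c d]
        congr 1
        ring

/-- Three times the left side is the sum over the cyclic rotations of each word. Once all words are
brought to the same order, Bianchi kills the cubic part and the linear terms left by the rotations
are contractions of `R`. -/
theorem sum_bianchi (R : Fin n → Fin n → Fin n → ℝ) (hs : ∀ a b c, R b a c = -R a b c)
    (hb : ∀ a b c, R a b c + R b c a + R c a b = 0) :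
    ∑ a, ∑ b, ∑ c, R a b c • (γ a * γ b * γ c) = (2 : ℝ) • ∑ b, (∑ a, R a b a) • γ b := by
  have h2 : (3 : ℝ) • ∑ a, ∑ b, ∑ c, R a b c • (γ a * γ b * γ c) =
      (3 : ℝ) • ((2 : ℝ) • ∑ b, (∑ a, R a b a) • γ b) := by
    calc _ = ∑ a, ∑ b, ∑ c, (R a b c • (γ a * γ b * γ c) + R b c a • (γ b * γ c * γ a)
          + R c a b • (γ c * γ a * γ b)) := by
          simp only [Finset.sum_add_distrib]
          rw [sum_cyclic (fun a b c ↦ R c a b • (γ c * γ a * γ b)) |>.symm,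
            sum_cyclic (fun a b c ↦ R a b c • (γ a * γ b * γ c))]
          module
      _ = ∑ a, ∑ b, ∑ c, (((if a = c then (-2 : ℝ) else 0) * R b c a) • γ b
            - ((if a = b then (-2 : ℝ) else 0) * R b c a) • γ c
            - ((if b = c then (-2 : ℝ) else 0) * R c a b) • γ a
            + ((if a = c then (-2 : ℝ) else 0) * R c a b) • γ b) := by
          refine Finset.sum_congr rfl fun a _ ↦ Finset.sum_congr rfl fun b _ ↦
            Finset.sum_congr rfl fun c _ ↦ ?_
          -- Eliminating `R a b c` by Bianchi makes the coefficient of `γ a * γ b * γ c` vanish. Of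
          -- the four remaining contractions three contribute 2 each, and the last is zero by
          -- skewness.
          rw [h.mul_mul_rotate b c a, h.mul_mul_rotate a b c,
            show R a b c = -(R b c a) - R c a b by linarith [hb a b c]]
          simp only [eq_comm (a := b) (b := a)]
          module
      _ = _ := by
          simp only [Finset.sum_add_distrib, Finset.sum_sub_distrib, ite_mul, zero_mul, ite_smul,
            zero_smul, Finset.sum_ite_eq, Finset.mem_univ, if_true]
          have e1 : ∑ a, ∑ b, (-2 * R b a a) • γ b = (2 : ℝ) • ∑ b, (∑ a, R a b a) • γ b := by
            rw [Finset.sum_comm, Finset.smul_sum]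
            refine Finset.sum_congr rfl fun b _ ↦ ?_
            rw [smul_smul, Finset.mul_sum, Finset.sum_smul]
            exact Finset.sum_congr rfl fun a _ ↦ by rw [hs a b a]; congr 1; ring
          have e2 : ∑ a, ∑ b, ∑ c, (if a = b then (-2 * R b c a) • γ c else 0) =
              (-2 : ℝ) • ∑ b, (∑ a, R a b a) • γ b := by
            have (a : Fin n) : ∑ b, ∑ c, (if a = b then (-2 * R b c a) • γ c else 0) =
                ∑ c, (-2 * R a c a) • γ c := by
              rw [Finset.sum_comm]
              simp only [Finset.sum_ite_eq, Finset.mem_univ, if_true]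
            simp only [this]
            rw [Finset.sum_comm, Finset.smul_sum]
            refine Finset.sum_congr rfl fun b _ ↦ ?_
            rw [smul_smul, Finset.mul_sum, Finset.sum_smul]
          have e3 : ∑ a, ∑ b, (-2 * R b a b) • γ a = (-2 : ℝ) • ∑ b, (∑ a, R a b a) • γ b := by
            rw [Finset.smul_sum]
            refine Finset.sum_congr rfl fun b _ ↦ ?_
            rw [smul_smul, Finset.mul_sum, Finset.sum_smul]
          have e4 : ∑ a, ∑ b, (-2 * R a a b) • γ b = 0 := by
            refine Finset.sum_eq_zero fun a _ ↦ Finset.sum_eq_zero fun b _ ↦ ?_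
            rw [show R a a b = 0 by linarith [hs a a b]]
            simp
          rw [e1, e2, e3, e4]
          module
  exact smul_right_injective A (three_ne_zero (α := ℝ)) h2

/-- The Clifford contraction of an algebraic curvature tensor is twice its scalar curvature. -/
theorem sum_curvature (R : Fin n → Fin n → Fin n → Fin n → ℝ)
    (hs : ∀ a b c d, R b a c d = -R a b c d) (ht : ∀ a b c d, R a b d c = -R a b c d)
    (hp : ∀ a b c d, R c d a b = R a b c d)
    (hb : ∀ a b c d, R a b c d + R b c a d + R c a b d = 0) :
    ∑ a, ∑ b, ∑ c, ∑ d, R a b c d • (γ a * γ b * (γ c * γ d)) =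
      (2 * ∑ a, ∑ b, R a b b a) • (1 : A) := by
  calc _ = ∑ d, (∑ a, ∑ b, ∑ c, R a b c d • (γ a * γ b * γ c)) * γ d := by
        simp only [Finset.sum_mul, smul_mul_assoc, ← mul_assoc]
        rw [Finset.sum_comm (s := (Finset.univ : Finset (Fin n))) (t := Finset.univ)
          (f := fun d a ↦ ∑ b, ∑ c, R a b c d • (γ a * γ b * γ c * γ d))]
        refine Finset.sum_congr rfl fun a _ ↦ ?_
        rw [Finset.sum_comm (s := (Finset.univ : Finset (Fin n))) (t := Finset.univ)
          (f := fun d b ↦ ∑ c, R a b c d • (γ a * γ b * γ c * γ d))]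
        exact Finset.sum_congr rfl fun b _ ↦ Finset.sum_comm
    _ = (2 : ℝ) • ∑ b, ∑ d, (∑ a, R a b a d) • (γ b * γ d) := by
        simp only [fun d ↦ h.sum_bianchi (fun a b c ↦ R a b c d) (fun a b c ↦ hs a b c d)
          (fun a b c ↦ hb a b c d), smul_mul_assoc, Finset.sum_mul, ← Finset.smul_sum]
        rw [Finset.sum_comm]
    _ = _ := by
        -- After the cubic contraction a Ricci tensor remains; pair symmetry makes it symmetric, so
        -- only its trace survives.
        rw [h.sum_symm _ fun b d ↦ Finset.sum_congr rfl fun a _ ↦ hp a d a b, smul_smul,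
          Finset.sum_comm]
        simp only [← Finset.sum_neg_distrib, ← ht]

end IsCliffordFamily
end CliffordRelations

/-! ### Even elements that commute with all vectors. -/

section EvenCenter

variable {n : ℕ} {A : Type*} [Ring A] [Algebra ℝ A]

/-- The span of the products of an even number of generators `γ b` with `b ∉ s`. -/
def evenWordSpan (γ : Fin n → A) (s : Finset (Fin n)) : Submodule ℝ A :=
  Submodule.span ℝ {x | ∃ l : List (Fin n), Even l.length ∧ (∀ b ∈ l, b ∉ s) ∧
    x = (l.map γ).prod}

theorem mul_mem_evenWordSpan {γ : Fin n → A} {s : Finset (Fin n)} {a b : Fin n} (ha : a ∉ s)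
    (hb : b ∉ s) {x : A} (hx : x ∈ evenWordSpan γ s) : γ a * γ b * x ∈ evenWordSpan γ s := by
  induction hx using Submodule.span_induction with
  | mem x h =>
    obtain ⟨l, hl, hls, rfl⟩ := h
    refine Submodule.subset_span ⟨a :: b :: l, by simpa [Nat.even_add_one] using hl, ?_, ?_⟩
    · intro c hc
      simp only [List.mem_cons] at hc
      rcases hc with rfl | rfl | hc
      exacts [ha, hb, hls c hc]
    · simp [mul_assoc]
  | zero => simp
  | add x y _ _ hx hy => rw [mul_add]; exact add_mem hx hy
  | smul r x _ hx => rw [mul_smul_comm]; exact Submodule.smul_mem _ r hx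

namespace IsCliffordFamily

variable {γ : Fin n → A} (h : IsCliffordFamily γ)
include h

theorem mul_word (a : Fin n) (l : List (Fin n)) (hl : a ∉ l) :
    γ a * (l.map γ).prod = (-1 : ℝ) ^ l.length • ((l.map γ).prod * γ a) := by
  induction l with
  | nil => simp
  | cons b l ih =>
    simp only [List.mem_cons, not_or] at hl
    simp only [List.map_cons, List.prod_cons, List.length_cons, pow_succ]
    rw [← mul_assoc, h.mul_eq_neg_mul hl.1, neg_mul, mul_assoc, ih hl.2]
    simp [mul_assoc]

/-- Occurrences of `γ a` are pulled to the front at the cost of signs collected in `r`. The length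
count keeps track of the parity of the remaining word. -/
theorem exists_word_eq (a : Fin n) (l : List (Fin n)) : ∃ r : ℝ, ∃ k : ℕ, ∃ l' : List (Fin n),
    (l.map γ).prod = r • (γ a ^ k * (l'.map γ).prod) ∧ l.length = k + l'.length ∧ a ∉ l' ∧
      ∀ b ∈ l', b ∈ l := by
  induction l with
  | nil => exact ⟨1, 0, [], by simp⟩
  | cons b l ih =>
    obtain ⟨r, k, l', h1, h2, h3, h4⟩ := ih
    by_cases hb : b = a
    · subst hb
      refine ⟨r, k + 1, l', ?_, ?_, h3, fun c hc ↦ List.mem_cons_of_mem _ (h4 c hc)⟩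
      · rw [List.map_cons, List.prod_cons, h1, mul_smul_comm, ← mul_assoc, ← pow_succ']
      · simp only [List.length_cons]
        omega
    · refine ⟨r * (-1) ^ k, k, b :: l', ?_, ?_, ?_, ?_⟩
      · have hc : γ b * γ a ^ k = (-1 : ℝ) ^ k • (γ a ^ k * γ b) := by
          clear h1 h2
          induction k with
          | zero => simp
          | succ k ih =>
            rw [pow_succ, ← mul_assoc, ih, smul_mul_assoc, mul_assoc, h.mul_eq_neg_mul hb,
              pow_succ (-1 : ℝ)]
            simp [mul_assoc]
        rw [List.map_cons, List.prod_cons, h1, mul_smul_comm, ← mul_assoc, hc, List.map_cons,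
          List.prod_cons, smul_mul_assoc, smul_smul, mul_assoc]
      · simp only [List.length_cons]
        omega
      · simp only [List.mem_cons, not_or]
        exact ⟨Ne.symm hb, h3⟩
      · intro c hc
        simp only [List.mem_cons] at hc ⊢
        exact hc.imp_right (h4 c)

theorem pow_two_mul (a : Fin n) (k : ℕ) : γ a ^ (2 * k) = (-1 : ℝ) ^ k • (1 : A) := by
  rw [pow_mul, pow_two, h.mul_self]
  rcases Nat.even_or_odd k with hk | hk <;> simp [hk.neg_one_pow]

/-- On even words $x\mapsto x-\gamma_ax\gamma_a$ is twice the projection away from `a`. If `γ a`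
occurs an even number of times, the rest has even length and commutes with `γ a`, and
$\gamma_a^2=-1$ doubles the word; if it occurs an odd number of times, the rest anticommutes and the
word is killed. -/
theorem sub_conj_mem_evenWordSpan (a : Fin n) (s : Finset (Fin n)) {x : A}
    (hx : x ∈ evenWordSpan γ s) : x - γ a * x * γ a ∈ evenWordSpan γ (insert a s) := by
  induction hx using Submodule.span_induction with
  | mem x hx =>
    obtain ⟨l, hl, hls, rfl⟩ := hx
    obtain ⟨r, k, l', h1, h2, h3, h4⟩ := h.exists_word_eq a l
    have hw := h.mul_word a l' h3
    rw [h1]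
    rcases Nat.even_or_odd' k with ⟨m, rfl | rfl⟩
    · have hl' : Even l'.length := by
        rw [h2] at hl
        exact (Nat.even_add.1 hl).1 (even_two_mul m)
      rw [hl'.neg_one_pow, one_smul] at hw
      have e1 : r • (γ a ^ (2 * m) * (l'.map γ).prod)
          - γ a * r • (γ a ^ (2 * m) * (l'.map γ).prod) * γ a =
          (2 * r * (-1) ^ m) • (l'.map γ).prod := by
        rw [h.pow_two_mul]
        simp only [smul_mul_assoc, one_mul, mul_smul_comm]
        rw [hw, mul_assoc, h.mul_self, mul_neg, mul_one]
        module
      rw [e1]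
      refine Submodule.smul_mem _ _ (Submodule.subset_span ⟨l', hl', fun b hb ↦ ?_, rfl⟩)
      rw [Finset.mem_insert, not_or]
      exact ⟨fun hba ↦ h3 (hba ▸ hb), hls b (h4 b hb)⟩
    · have hl' : Odd l'.length := by
        rw [h2] at hl
        exact (Nat.even_add'.1 hl).1 (odd_two_mul_add_one m)
      rw [hl'.neg_one_pow, neg_smul, one_smul] at hw
      have e1 : r • (γ a ^ (2 * m + 1) * (l'.map γ).prod)
          - γ a * r • (γ a ^ (2 * m + 1) * (l'.map γ).prod) * γ a = 0 := by
        rw [pow_succ, h.pow_two_mul]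
        simp only [smul_mul_assoc, one_mul, mul_smul_comm]
        rw [← mul_assoc, h.mul_self, hw, neg_one_mul, neg_mul, neg_inj.2 rfl]
        simp
      rw [e1]
      exact zero_mem _
  | zero => simp
  | add x y _ _ hx hy =>
    rw [show x + y - γ a * (x + y) * γ a = (x - γ a * x * γ a) + (y - γ a * y * γ a) by noncomm_ring]
    exact add_mem hx hy
  | smul r x _ hx =>
    rw [show r • x - γ a * r • x * γ a = r • (x - γ a * x * γ a) by
      simp only [smul_sub, mul_smul_comm, smul_mul_assoc]]
    exact Submodule.smul_mem _ r hx

/-- An even element which commutes with all vectors is a real number. -/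
theorem exists_eq_smul_one_of_commute {x : A} (hx : x ∈ evenWordSpan γ ∅)
    (hc : ∀ a, x * γ a = γ a * x) : ∃ r : ℝ, x = r • (1 : A) := by
  -- The generators are eliminated one at a time: since `x` commutes with `γ a`,
  -- $x-\gamma_ax\gamma_a=2x$, so `x` itself avoids `a`. In the end only the empty word is left.
  have key (s : Finset (Fin n)) : x ∈ evenWordSpan γ s := by
    induction s using Finset.induction_on with
    | empty => exact hx
    | insert a s _ ih =>
      have h1 := h.sub_conj_mem_evenWordSpan a s ih
      rw [← hc a, mul_assoc, h.mul_self, mul_neg, mul_one, sub_neg_eq_add, ← two_smul ℝ] at h1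
      have := Submodule.smul_mem _ (1 / 2 : ℝ) h1
      simpa [smul_smul] using this
  have h1 := key Finset.univ
  have h2 : evenWordSpan γ Finset.univ ≤ Submodule.span ℝ {(1 : A)} := by
    refine Submodule.span_mono ?_
    rintro y ⟨l, -, hl, rfl⟩
    have : l = [] := List.eq_nil_iff_forall_not_mem.2 fun b hb ↦ hl b hb (Finset.mem_univ b)
    simp [this]
  obtain ⟨r, hr⟩ := Submodule.mem_span_singleton.1 (h2 h1)
  exact ⟨r, hr.symm⟩

end IsCliffordFamily
end EvenCenter

/-! ### The spin representation by continuous operators. -/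

section Operators

variable {n : ℕ} {Δ : Type*} [NormedAddCommGroup Δ] [InnerProductSpace ℂ Δ]
  [FiniteDimensional ℂ Δ] (S : SpinorModule n Δ)

namespace SpinorModule

/-- The representation of the Clifford algebra by continuous operators. -/
def op : CliffordAlgebra (cliffordForm n) →ₐ[ℝ] (Δ →L[ℂ] Δ) :=
  AlgHom.ofLinearMap
    { toFun := fun x ↦ LinearMap.toContinuousLinearMap (S.rep x)
      map_add' := fun x y ↦ by ext; simp
      map_smul' := fun r x ↦ by ext; simp }
    (by ext; simp) (fun x y ↦ by ext; simp)

@[simp]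
theorem op_apply (x : CliffordAlgebra (cliffordForm n)) (ψ : Δ) : S.op x ψ = S.rep x ψ := rfl

/-- Clifford multiplication by a standard basis vector, as a continuous operator. -/
def gam (a : Fin n) : Δ →L[ℂ] Δ := S.op (cliffordGen a)

theorem gamma_apply (a : Fin n) (ψ : Δ) : S.gamma a ψ = S.gam a ψ := rfl

theorem op_ι (v : Fin n → ℝ) :
    S.op (CliffordAlgebra.ι (cliffordForm n) v) = ∑ a, v a • S.gam a := by
  have hv : v = ∑ a, v a • (Pi.single a (1 : ℝ) : Fin n → ℝ) := by
    ext b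
    simp [Finset.sum_apply, Pi.single_apply]
  conv_lhs => rw [hv]
  simp [gam, cliffordGen]

theorem isCliffordFamily_gam : IsCliffordFamily S.gam := by
  intro a b
  rw [gam, gam, ← map_mul, ← map_mul, ← map_add, cliffordGen, cliffordGen,
    CliffordAlgebra.ι_mul_ι_add_swap, AlgHom.commutes, Algebra.algebraMap_eq_smul_one]
  congr 1
  simp only [QuadraticMap.polar, QuadraticMap.weightedSumSquares_apply, smul_eq_mul, Pi.add_apply,
    Pi.single_apply]
  simp only [← Finset.sum_sub_distrib]
  by_cases hab : a = b
  · subst hab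
    rw [Finset.sum_eq_single a (by intro c _ hc; simp [hc]) (by simp)]
    norm_num
  · rw [if_neg hab]
    refine Finset.sum_eq_zero fun c _ ↦ ?_
    by_cases hca : c = a
    · subst hca; simp [hab]
    · simp [hca]

/-- `star` reverses products and negates vectors, as taking adjoints does for a representation with
skew-Hermitian vectors; the two therefore agree on the whole algebra. -/
theorem inner_op_star (x : CliffordAlgebra (cliffordForm n)) (φ ψ : Δ) :
    inner ℂ (S.op (star x) φ) ψ = inner ℂ φ (S.op x ψ) := by
  induction x using CliffordAlgebra.induction generalizing φ ψ with
  | algebraMap r =>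
    rw [CliffordAlgebra.star_algebraMap, AlgHom.commutes, Algebra.algebraMap_eq_smul_one]
    simp only [smul_apply]
    rw [← Complex.coe_smul, ← Complex.coe_smul, inner_smul_left, inner_smul_right]
    simp
  | ι v =>
    rw [CliffordAlgebra.star_ι, map_neg]
    have := S.skew v φ ψ
    simp only [neg_apply, inner_neg_left, op_apply]
    rw [this, neg_neg]
  | mul x y hx hy =>
    rw [star_mul, map_mul, map_mul]
    simp only [mul_apply_eq_comp]
    rw [hy, hx]
  | add x y hx hy =>
    simp only [star_add, map_add, add_apply, inner_add_left, inner_add_right, hx, hy]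

/-- Applied to elements of the spin group, which lie in the even subalgebra, this supplies the
evenness needed for the parallel transition functions. -/
theorem op_mem_evenWordSpan {x : CliffordAlgebra (cliffordForm n)}
    (hx : x ∈ CliffordAlgebra.evenOdd (cliffordForm n) 0) : S.op x ∈ evenWordSpan S.gam ∅ := by
  induction x, hx using CliffordAlgebra.even_induction with
  | algebraMap r =>
    rw [AlgHom.commutes, Algebra.algebraMap_eq_smul_one]
    exact Submodule.smul_mem _ _ (Submodule.subset_span ⟨[], by simp⟩)
  | add x y hx hy ihx ihy => rw [map_add]; exact add_mem ihx ihy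
  | ι_mul_ι_mul v w x hx ih =>
    rw [map_mul, map_mul, op_ι, op_ι, Finset.sum_mul_sum, Finset.sum_mul]
    refine sum_mem fun a _ ↦ ?_
    rw [Finset.sum_mul]
    refine sum_mem fun b _ ↦ ?_
    rw [smul_mul_assoc, mul_smul_comm, smul_smul, smul_mul_assoc]
    exact Submodule.smul_mem _ _ (mul_mem_evenWordSpan (by simp) (by simp) ih)

theorem op_star_mul_op {g : CliffordAlgebra (cliffordForm n)}
    (hg : g ∈ spinGroup (cliffordForm n)) : S.op (star g) * S.op g = 1 := by
  rw [← map_mul, spinGroup.star_mul_self_of_mem hg, map_one]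

theorem op_mul_op_star {g : CliffordAlgebra (cliffordForm n)}
    (hg : g ∈ spinGroup (cliffordForm n)) : S.op g * S.op (star g) = 1 := by
  rw [← map_mul, spinGroup.mul_star_self_of_mem hg, map_one]

theorem inner_op_op {g : CliffordAlgebra (cliffordForm n)}
    (hg : g ∈ spinGroup (cliffordForm n)) (φ ψ : Δ) :
    inner ℂ (S.op g φ) (S.op g ψ) = inner ℂ φ ψ := by
  rw [← S.inner_op_star, ← mul_apply_eq_comp, S.op_star_mul_op hg]
  rfl

end SpinorModule
end Operators

/-! ### The spin representation of the orthogonal Lie algebra. -/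

section CliffordCommutator

variable {n : ℕ} {A : Type*} [Ring A] [Algebra ℝ A] {γ : Fin n → A}

/-- The infinitesimal spin representation respects brackets; it provides the $\omega\wedge\omega$
part of the spinor curvature. -/
theorem IsCliffordFamily.commutator_sum_sum (h : IsCliffordFamily γ) (B C : Fin n → Fin n → ℝ)
    (hB : ∀ a b, B a b = -B b a) :
    (∑ a, ∑ b, (1 / 4 * B a b) • (γ a * γ b)) * (∑ a, ∑ b, (1 / 4 * C a b) • (γ a * γ b))
      - (∑ a, ∑ b, (1 / 4 * C a b) • (γ a * γ b)) * (∑ a, ∑ b, (1 / 4 * B a b) • (γ a * γ b)) =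
    ∑ k, ∑ l, (1 / 4 * ∑ m, (C k m * B m l - B k m * C m l)) • (γ k * γ l) := by
  set T := ∑ a, ∑ b, (1 / 4 * B a b) • (γ a * γ b) with hT
  -- The commutator with `T` is a derivation, so it acts on each factor of `γ k * γ l` by the
  -- rotation `B`.
  have h1 (k l : Fin n) : T * (γ k * γ l) - γ k * γ l * T =
      ∑ m, B k m • (γ m * γ l) + ∑ m, B l m • (γ k * γ m) := by
    calc T * (γ k * γ l) - γ k * γ l * T = (T * γ k - γ k * T) * γ l
          + γ k * (T * γ l - γ l * T) := by noncomm_ring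
      _ = _ := by
        rw [h.commutator_sum B hB, h.commutator_sum B hB]
        simp only [Finset.sum_mul, Finset.mul_sum, smul_mul_assoc, mul_smul_comm]
  calc _ = ∑ k, ∑ l, (1 / 4 * C k l) • (T * (γ k * γ l) - γ k * γ l * T) := by
        simp only [Finset.mul_sum, Finset.sum_mul, mul_smul_comm, smul_mul_assoc, smul_sub,
          Finset.sum_sub_distrib]
    _ = ∑ k, ∑ l, ∑ m, (1 / 4 * C k l * B k m) • (γ m * γ l)
        + ∑ k, ∑ l, ∑ m, (1 / 4 * C k l * B l m) • (γ k * γ m) := by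
        simp only [h1, smul_add, Finset.sum_add_distrib, Finset.smul_sum, smul_smul]
    _ = ∑ k, ∑ l, ∑ m, (1 / 4 * C m l * B m k) • (γ k * γ l)
        + ∑ k, ∑ l, ∑ m, (1 / 4 * C k m * B m l) • (γ k * γ l) := by
        congr 1
        · rw [← sum_cyclic (fun k l m ↦ (1 / 4 * C m l * B m k) • (γ k * γ l))]
          exact Finset.sum_congr rfl fun k _ ↦ Finset.sum_comm
        · exact Finset.sum_congr rfl fun k _ ↦ Finset.sum_comm
    _ = _ := by
        simp only [← Finset.sum_add_distrib]
        refine Finset.sum_congr rfl fun k _ ↦ Finset.sum_congr rfl fun l _ ↦ ?_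
        rw [Finset.mul_sum, Finset.sum_smul]
        refine Finset.sum_congr rfl fun m _ ↦ ?_
        rw [← add_smul, hB m k]
        congr 1
        ring

end CliffordCommutator

/-! ### The spinor connection in a frame, its curvature, and the local Lichnerowicz formula. -/

section FrameNabla

set_option linter.unusedSectionVars false

variable {n : ℕ} {M : Type*} [TopologicalSpace M] [ChartedSpace (EuclideanSpace ℝ (Fin n)) M]
  [IsManifold (𝓡 n) ∞ M] [RiemannianBundle (fun x : M ↦ TangentSpace (𝓡 n) x)]
  [IsContMDiffRiemannianBundle (𝓡 n) ∞ (EuclideanSpace ℝ (Fin n))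
    (fun x : M ↦ TangentSpace (𝓡 n) x)]

variable {Δ : Type*} [NormedAddCommGroup Δ] [InnerProductSpace ℂ Δ] [FiniteDimensional ℂ Δ]
  (S : SpinorModule n Δ)

variable (Δ) in
/-- Evaluation of operators, as a real bilinear map. -/
def evalOp : (Δ →L[ℂ] Δ) →L[ℝ] Δ →L[ℝ] Δ := ContinuousLinearMap.restrictScalarsL ℂ Δ Δ ℝ ℝ

@[simp]
theorem evalOp_apply (T : Δ →L[ℂ] Δ) (ψ : Δ) : evalOp Δ T ψ = T ψ := rfl

theorem op_smul_real (T : Δ →L[ℂ] Δ) (r : ℝ) (ψ : Δ) : T (r • ψ) = r • T ψ :=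
  (evalOp Δ T).map_smul r ψ

theorem mvfderiv_op (T : Δ →L[ℂ] Δ) {f : M → Δ} {x : M}
    (hf : MDifferentiableAt (𝓡 n) 𝓘(ℝ, Δ) f x) (v : TangentSpace (𝓡 n) x) :
    mvfderiv (𝓡 n) (fun y ↦ T (f y)) x v = T (mvfderiv (𝓡 n) f x v) :=
  mvfderiv_clm_comp (evalOp Δ T) hf v

theorem contMDiffOn_op (T : Δ →L[ℂ] Δ) {f : M → Δ} {U : Set M}
    (hf : ContMDiffOn (𝓡 n) 𝓘(ℝ, Δ) ∞ f U) :
    ContMDiffOn (𝓡 n) 𝓘(ℝ, Δ) ∞ (fun y ↦ T (f y)) U :=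
  contMDiffOn_clm_comp (evalOp Δ T) hf

/-- The connection form `1/4 ∑ a b, ⟨∇_v e_a, e_b⟩ e_a · e_b` of the spinor bundle in a frame. -/
def frameConn (e : Fin n → Π x : M, TangentSpace (𝓡 n) x) (x : M) (v : TangentSpace (𝓡 n) x) :
    Δ →L[ℂ] Δ :=
  ∑ a, ∑ b, (1 / 4 * (inner ℝ (leviCivita (I := 𝓡 n) (e a) x v) (e b x) : ℝ)) •
    (S.gam a * S.gam b)

/-- The covariant derivative of spinors in a frame. -/
def frameNabla (e : Fin n → Π x : M, TangentSpace (𝓡 n) x) (f : M → Δ) (x : M)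
    (v : TangentSpace (𝓡 n) x) : Δ :=
  mvfderiv (𝓡 n) f x v + frameConn S e x v (f x)

theorem SpinStructure.localNabla_apply (P : SpinStructure n M) (i : P.Index) (f : M → Δ) (x : M)
    (v : TangentSpace (𝓡 n) x) : P.localNabla S i f x v = frameNabla S (P.e i) f x v := by
  simp only [SpinStructure.localNabla, frameNabla, frameConn, add_apply, FunLike.coe_sum,
    Finset.sum_apply, ContinuousLinearMap.smulRight_apply, smul_apply,
    ContinuousLinearMap.comp_apply, innerSL_apply_apply, smul_eq_mul, real_inner_comm]
  rfl

theorem SpinStructure.isOrthonormalFrame (P : SpinStructure n M) (i : P.Index) :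
    IsOrthonormalFrame (P.e i) (P.U i) :=
  ⟨P.isOpen_U i, P.contMDiffOn_e i, P.orthonormal_e i⟩

variable {e : Fin n → Π x : M, TangentSpace (𝓡 n) x}

theorem frameConn_add (x : M) (v w : TangentSpace (𝓡 n) x) :
    frameConn S e x (v + w) = frameConn S e x v + frameConn S e x w := by
  simp only [frameConn, map_add, inner_add_left, mul_add, add_smul, Finset.sum_add_distrib]

theorem frameConn_smul (x : M) (r : ℝ) (v : TangentSpace (𝓡 n) x) :
    frameConn S e x (r • v) = r • frameConn S e x v := by
  simp only [frameConn, map_smul, inner_smul_left, conj_trivial, Finset.smul_sum, smul_smul]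
  simp only [mul_left_comm]

/-- The covariant derivative of spinors at a point, as a linear map. -/
def frameNablaHom (e : Fin n → Π x : M, TangentSpace (𝓡 n) x) (f : M → Δ) (x : M) :
    TangentSpace (𝓡 n) x →ₗ[ℝ] Δ where
  toFun := frameNabla S e f x
  map_add' v w := by
    simp only [frameNabla, map_add, frameConn_add, add_apply]
    abel
  map_smul' r v := by
    simp only [frameNabla, map_smul, frameConn_smul, smul_apply, smul_add, RingHom.id_apply]

theorem frameNabla_sum_smul (f : M → Δ) (x : M) (r : Fin n → ℝ)
    (v : Fin n → TangentSpace (𝓡 n) x) :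
    frameNabla S e f x (∑ a, r a • v a) = ∑ a, r a • frameNabla S e f x (v a) := by
  have := map_sum (frameNablaHom S e f x) (fun a ↦ r a • v a) Finset.univ
  simp only [map_smul] at this
  exact this

theorem frameNabla_sum {ι : Type*} (s : Finset ι) {f : ι → M → Δ} {x : M}
    (hf : ∀ i ∈ s, MDifferentiableAt (𝓡 n) 𝓘(ℝ, Δ) (f i) x) (v : TangentSpace (𝓡 n) x) :
    frameNabla S e (fun y ↦ ∑ i ∈ s, f i y) x v = ∑ i ∈ s, frameNabla S e (f i) x v := by
  simp only [frameNabla, map_sum, Finset.sum_add_distrib]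
  rw [mvfderiv_sum s hf]
  simp

theorem frameNabla_smul {r : M → ℝ} {f : M → Δ} {x : M}
    (hr : MDifferentiableAt (𝓡 n) 𝓘(ℝ) r x) (hf : MDifferentiableAt (𝓡 n) 𝓘(ℝ, Δ) f x)
    (v : TangentSpace (𝓡 n) x) :
    frameNabla S e (fun y ↦ r y • f y) x v =
      mvfderiv (𝓡 n) r x v • f x + r x • frameNabla S e f x v := by
  simp only [frameNabla]
  rw [mvfderiv_smul_apply hr hf, smul_add, op_smul_real]
  abel

theorem frameNabla_congr {f g : M → Δ} {U : Set M} (hU : IsOpen U) (h : ∀ y ∈ U, f y = g y)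
    {x : M} (hx : x ∈ U) (v : TangentSpace (𝓡 n) x) :
    frameNabla S e f x v = frameNabla S e g x v := by
  rw [frameNabla, frameNabla, h x hx,
    mvfderiv_congr (Filter.eventually_of_mem (hU.mem_nhds hx) h)]

variable {U : Set M} (F : IsOrthonormalFrame e U)
include F

theorem frameConn_commutator {x : M} (hx : x ∈ U) (v : TangentSpace (𝓡 n) x) (d : Fin n) :
    frameConn S e x v * S.gam d - S.gam d * frameConn S e x v =
      ∑ c, (inner ℝ (leviCivita (I := 𝓡 n) (e d) x v) (e c x) : ℝ) • S.gam c :=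
  S.isCliffordFamily_gam.commutator_sum _ (fun a b ↦ F.inner_leviCivita_skew hx v a b) d

/-- Clifford multiplication is parallel: commuting the connection form past a vector $e_d$ produces
exactly $\nabla_ve_d$. -/
theorem frameNabla_gam {f : M → Δ} {x : M} (hx : x ∈ U)
    (hf : MDifferentiableAt (𝓡 n) 𝓘(ℝ, Δ) f x) (v : TangentSpace (𝓡 n) x) (d : Fin n) :
    frameNabla S e (fun y ↦ S.gam d (f y)) x v = S.gam d (frameNabla S e f x v)
      + ∑ c, (inner ℝ (leviCivita (I := 𝓡 n) (e d) x v) (e c x) : ℝ) • S.gam c (f x) := by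
  have h := congrArg (fun T : Δ →L[ℂ] Δ ↦ T (f x)) (frameConn_commutator S F hx v d)
  simp only [sub_apply, mul_apply_eq_comp, FunLike.coe_sum, Finset.sum_apply, smul_apply] at h
  rw [frameNabla, mvfderiv_op _ hf, ← h, frameNabla, map_add]
  abel

theorem contMDiffOn_frameConn {X : Π x : M, TangentSpace (𝓡 n) x} (hX : SmoothFieldOn X U) :
    ContMDiffOn (𝓡 n) 𝓘(ℝ, Δ →L[ℂ] Δ) ∞ (fun x ↦ frameConn S e x (X x)) U := by
  refine contMDiffOn_sum _ fun a _ ↦ contMDiffOn_sum _ fun b _ ↦ ?_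
  have h := SmoothFieldOn.inner (F.smooth_leviCivita hX (F.smooth a)) (F.smooth b)
  exact (contMDiffOn_const.mul h).smul contMDiffOn_const

theorem contMDiffOn_frameNabla {f : M → Δ} (hf : ContMDiffOn (𝓡 n) 𝓘(ℝ, Δ) ∞ f U)
    {X : Π x : M, TangentSpace (𝓡 n) x} (hX : SmoothFieldOn X U) :
    ContMDiffOn (𝓡 n) 𝓘(ℝ, Δ) ∞ (fun x ↦ frameNabla S e f x (X x)) U :=
  (contMDiffOn_mvfderiv_apply F.isOpen hf hX).add
    (contMDiffOn_bilin (evalOp Δ) (contMDiffOn_frameConn S F hX) hf)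

/-- The adjoint of $e_ae_b$ is $e_be_a$ and the real coefficients are skew in $a,b$. Hence the
connection is compatible with the Hermitian product. -/
theorem inner_frameConn_left {x : M} (hx : x ∈ U) (v : TangentSpace (𝓡 n) x) (φ ψ : Δ) :
    inner ℂ (frameConn S e x v φ) ψ = -inner ℂ φ (frameConn S e x v ψ) := by
  have hg (a : Fin n) (φ ψ : Δ) : inner ℂ (S.gam a φ) ψ = -inner ℂ φ (S.gam a ψ) :=
    S.skew (Pi.single a 1) φ ψ
  simp only [frameConn, FunLike.coe_sum, Finset.sum_apply, smul_apply, sum_inner, inner_sum,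
    mul_apply_eq_comp, ← Finset.sum_neg_distrib]
  rw [Finset.sum_comm]
  refine Finset.sum_congr rfl fun a _ ↦ Finset.sum_congr rfl fun b _ ↦ ?_
  rw [← Complex.coe_smul, ← Complex.coe_smul, inner_smul_left, Complex.conj_ofReal, inner_smul_right,
    hg, hg, F.inner_leviCivita_skew hx v b a]
  push_cast
  ring

/-- The curvature of the spinor bundle is the image of the Riemann curvature under the spin
representation of $\mathfrak{so}(n)$. The last sum is $\nabla_{[e_a,e_b]}\psi$. -/
theorem frameNabla_commutator {ψ : M → Δ} (hψ : ContMDiffOn (𝓡 n) 𝓘(ℝ, Δ) ∞ ψ U) {x : M}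
    (hx : x ∈ U) (a b : Fin n) :
    frameNabla S e (fun y ↦ frameNabla S e ψ y (e b y)) x (e a x)
      - frameNabla S e (fun y ↦ frameNabla S e ψ y (e a y)) x (e b x) =
    (∑ k, ∑ l, (1 / 4 * curvCoeff e a b k l x) • (S.gam k * S.gam l)) (ψ x)
      + ∑ c, (connCoeff e a b c x - connCoeff e b a c x) • frameNabla S e ψ x (e c x) := by
  have hdc (a k l : Fin n) :=
    mdifferentiableAt_of_contMDiffOn F.isOpen (F.contMDiffOn_connCoeff a k l) hx
  have hdψ := mdifferentiableAt_of_contMDiffOn F.isOpen hψ hx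
  have hconn (b : Fin n) (v : TangentSpace (𝓡 n) x) :
      mvfderiv (𝓡 n) (fun y ↦ frameConn S e y (e b y)) x v =
        ∑ k, ∑ l, (1 / 4 * mvfderiv (𝓡 n) (connCoeff e b k l) x v) • (S.gam k * S.gam l) := by
    have hd1 (k l : Fin n) : MDifferentiableAt (𝓡 n) 𝓘(ℝ) (fun y ↦ 1 / 4 * connCoeff e b k l y) x :=
      mdifferentiableAt_const.mul (hdc b k l)
    have hd (k l : Fin n) : MDifferentiableAt (𝓡 n) 𝓘(ℝ, Δ →L[ℂ] Δ)
        (fun y ↦ (1 / 4 * connCoeff e b k l y) • (S.gam k * S.gam l)) x :=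
      (hd1 k l).smul mdifferentiableAt_const
    rw [show (fun y ↦ frameConn S e y (e b y)) =
      fun y ↦ ∑ k, ∑ l, (1 / 4 * connCoeff e b k l y) • (S.gam k * S.gam l) from rfl,
      mvfderiv_sum _ fun k _ ↦ mdifferentiableAt_sum _ fun l _ ↦ hd k l]
    simp only [FunLike.coe_sum, Finset.sum_apply]
    refine Finset.sum_congr rfl fun k _ ↦ ?_
    rw [mvfderiv_sum _ fun l _ ↦ hd k l]
    simp only [FunLike.coe_sum, Finset.sum_apply]
    refine Finset.sum_congr rfl fun l _ ↦ ?_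
    rw [mvfderiv_smul_apply (hd1 k l) mdifferentiableAt_const, mvfderiv_const,
      show mvfderiv (𝓡 n) (fun y ↦ 1 / 4 * connCoeff e b k l y) x v = _ from
        mvfderiv_clm_comp (ContinuousLinearMap.mul ℝ ℝ (1 / 4)) (hdc b k l) v]
    simp
  have hN (a b : Fin n) : frameNabla S e (fun y ↦ frameNabla S e ψ y (e b y)) x (e a x) =
      mvfderiv (𝓡 n) (fun y ↦ mvfderiv (𝓡 n) ψ y (e b y)) x (e a x)
      + (∑ k, ∑ l, (1 / 4 * mvfderiv (𝓡 n) (connCoeff e b k l) x (e a x)) •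
          (S.gam k * S.gam l)) (ψ x)
      + frameConn S e x (e b x) (mvfderiv (𝓡 n) ψ x (e a x))
      + frameConn S e x (e a x) (mvfderiv (𝓡 n) ψ x (e b x))
      + (frameConn S e x (e a x) * frameConn S e x (e b x)) (ψ x) := by
    have h1 := mdifferentiableAt_of_contMDiffOn F.isOpen
      (contMDiffOn_mvfderiv_apply F.isOpen hψ (F.smooth b)) hx
    have h2 := mdifferentiableAt_of_contMDiffOn F.isOpen (contMDiffOn_frameConn S F (F.smooth b)) hx
    have h3 := mdifferentiableAt_bilin (evalOp Δ) h2 hdψ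
    have h4 := congrArg (fun T ↦ T (e a x)) (mvfderiv_add h1 h3)
    rw [frameNabla, show mvfderiv (𝓡 n) (fun y ↦ frameNabla S e ψ y (e b y)) x (e a x) = _ from h4,
      add_apply, mvfderiv_bilin (evalOp Δ) h2 hdψ, hconn, frameNabla, map_add]
    simp only [evalOp_apply, mul_apply_eq_comp]
    abel
  have hbr := mvfderiv_mlieBracket F.isOpen hψ (F.smooth a) (F.smooth b) hx
  rw [F.mlieBracket_eq_sum hx] at hbr
  simp only [map_sum, map_smul] at hbr
  -- Only the first connection form has to be skew; its commutator with the second supplies the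
  -- quadratic terms of the structure equation.
  have hcomm : frameConn S e x (e a x) * frameConn S e x (e b x)
      - frameConn S e x (e b x) * frameConn S e x (e a x) = _ :=
    S.isCliffordFamily_gam.commutator_sum_sum _ _
      (fun k l ↦ F.inner_leviCivita_skew hx (e a x) k l)
  -- The spin representation applied to the structure equation `curvCoeff_eq`, summand by summand.
  have hR : ∑ k, ∑ l, (1 / 4 * curvCoeff e a b k l x) • (S.gam k * S.gam l) =
      ∑ k, ∑ l, (1 / 4 * mvfderiv (𝓡 n) (connCoeff e b k l) x (e a x)) • (S.gam k * S.gam l)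
      - ∑ k, ∑ l, (1 / 4 * mvfderiv (𝓡 n) (connCoeff e a k l) x (e b x)) • (S.gam k * S.gam l)
      + (frameConn S e x (e a x) * frameConn S e x (e b x)
        - frameConn S e x (e b x) * frameConn S e x (e a x))
      - ∑ c, (connCoeff e a b c x - connCoeff e b a c x) • frameConn S e x (e c x) := by
    have h5 : ∑ c, (connCoeff e a b c x - connCoeff e b a c x) • frameConn S e x (e c x) =
        ∑ k, ∑ l, (1 / 4 * ∑ c, (connCoeff e a b c x - connCoeff e b a c x)
          * connCoeff e c k l x) • (S.gam k * S.gam l) := by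
      simp only [frameConn, Finset.smul_sum, Finset.mul_sum, Finset.sum_smul, smul_smul]
      rw [Finset.sum_comm]
      refine Finset.sum_congr rfl fun k _ ↦ ?_
      rw [Finset.sum_comm]
      refine Finset.sum_congr rfl fun l _ ↦ Finset.sum_congr rfl fun c _ ↦ ?_
      rw [mul_left_comm]
      rfl
    rw [hcomm, h5]
    simp only [← Finset.sum_sub_distrib, ← Finset.sum_add_distrib, ← sub_smul, ← add_smul]
    refine Finset.sum_congr rfl fun k _ ↦ Finset.sum_congr rfl fun l _ ↦ ?_
    rw [F.curvCoeff_eq hx]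
    congr 1
    simp only [Finset.sum_sub_distrib, connCoeff]
    ring
  rw [hN a b, hN b a, hR]
  simp only [frameNabla, smul_add, Finset.sum_add_distrib, sub_apply, add_apply,
    FunLike.coe_sum, Finset.sum_apply, smul_apply] at hbr ⊢
  rw [hbr]
  abel

omit F in
-- Swap the names of the indices, anticommute, and average with the original sum: the diagonal
-- becomes the Laplace term and the rest sees only the antisymmetric part of `N`.
theorem sum_gam_gam (N : Fin n → Fin n → Δ) :
    ∑ a, ∑ b, S.gam a (S.gam b (N a b)) =
      -∑ a, N a a + (1 / 2 : ℝ) • ∑ a, ∑ b, S.gam a (S.gam b (N a b - N b a)) := by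
  have h1 : ∑ a, ∑ b, S.gam a (S.gam b (N a b)) =
      -(2 : ℝ) • ∑ a, N a a - ∑ a, ∑ b, S.gam a (S.gam b (N b a)) := by
    have h2 (a b : Fin n) : S.gam b (S.gam a (N b a)) =
        (if a = b then (-2 : ℝ) • N b a else 0) - S.gam a (S.gam b (N b a)) := by
      have h := congrArg (fun T : Δ →L[ℂ] Δ ↦ T (N b a)) (S.isCliffordFamily_gam.mul_swap b a)
      simp only [mul_apply_eq_comp, sub_apply, ite_smul, zero_smul, eq_comm (a := b)] at h
      rw [h]
      split_ifs
      · rfl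
      · rfl
    rw [Finset.sum_comm]
    simp only [h2, Finset.sum_sub_distrib, Finset.sum_ite_eq, Finset.mem_univ, if_true,
      ← Finset.smul_sum]
  simp only [map_sub, Finset.sum_sub_distrib]
  have h3 : (2 : ℝ) • ∑ a, ∑ b, S.gam a (S.gam b (N a b)) = -(2 : ℝ) • ∑ a, N a a
      + (∑ a, ∑ b, S.gam a (S.gam b (N a b)) - ∑ a, ∑ b, S.gam a (S.gam b (N b a))) := by
    rw [two_smul]
    nth_rw 1 [h1]
    abel
  have h4 := congrArg (fun z ↦ (1 / 2 : ℝ) • z) h3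
  simp only [smul_add, smul_smul] at h4
  norm_num at h4 ⊢
  exact h4

/-- The Lichnerowicz formula in a frame. -/
theorem frame_lichnerowicz {ψ : M → Δ} (hψ : ContMDiffOn (𝓡 n) 𝓘(ℝ, Δ) ∞ ψ U) {x : M}
    (hx : x ∈ U) :
    ∑ a, S.gam a (frameNabla S e (fun y ↦ ∑ b, S.gam b (frameNabla S e ψ y (e b y))) x (e a x)) =
      -∑ a, (frameNabla S e (fun y ↦ frameNabla S e ψ y (e a y)) x (e a x)
        - frameNabla S e ψ x (leviCivita (I := 𝓡 n) (e a) x (e a x)))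
      + (scalarCurvature (𝓡 n) x / 4) • ψ x := by
  have hd (b : Fin n) := mdifferentiableAt_of_contMDiffOn F.isOpen
    (contMDiffOn_frameNabla S F hψ (F.smooth b)) hx
  have hdg (b : Fin n) := mdifferentiableAt_of_contMDiffOn F.isOpen
    (contMDiffOn_op (S.gam b) (contMDiffOn_frameNabla S F hψ (F.smooth b))) hx
  set φ : Fin n → Δ := fun c ↦ frameNabla S e ψ x (e c x) with hφ
  -- `N a b` is the second covariant derivative of `ψ`. Its correction term replaces the choice of a
  -- frame that is parallel at `x`.
  set N : Fin n → Fin n → Δ := fun a b ↦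
    frameNabla S e (fun y ↦ frameNabla S e ψ y (e b y)) x (e a x)
      - ∑ c, connCoeff e a b c x • φ c with hN
  have hskew (a b c : Fin n) := F.connCoeff_skew hx a b c
  -- Differentiating Clifford multiplication by $e_b$ gives terms with $\nabla e_b$; relabelled
  -- through the skewness of the coefficients, they are the correction terms of `N`.
  have h1 : ∑ a, S.gam a (frameNabla S e (fun y ↦ ∑ b, S.gam b (frameNabla S e ψ y (e b y)))
      x (e a x)) = ∑ a, ∑ b, S.gam a (S.gam b (N a b)) := by
    refine Finset.sum_congr rfl fun a _ ↦ ?_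
    rw [frameNabla_sum S _ fun b _ ↦ hdg b, map_sum,
      Finset.sum_congr rfl fun b _ ↦ by rw [frameNabla_gam S F hx (hd b)]]
    simp only [hN, map_sub, map_add, Finset.sum_add_distrib, Finset.sum_sub_distrib]
    rw [sub_eq_add_neg]
    congr 1
    simp only [← map_sum, ← map_neg]
    congr 1
    rw [Finset.sum_comm, ← Finset.sum_neg_distrib]
    refine Finset.sum_congr rfl fun b _ ↦ ?_
    rw [map_sum, ← Finset.sum_neg_distrib]
    refine Finset.sum_congr rfl fun c _ ↦ ?_
    rw [hskew a b c, op_smul_real, neg_smul, neg_neg]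
    rfl
  have h2 (a : Fin n) : N a a = frameNabla S e (fun y ↦ frameNabla S e ψ y (e a y)) x (e a x)
        - frameNabla S e ψ x (leviCivita (I := 𝓡 n) (e a) x (e a x)) := by
    rw [F.leviCivita_eq_sum hx, frameNabla_sum_smul]
  have h3 (a b : Fin n) : N a b - N b a =
      (∑ k, ∑ l, (1 / 4 * curvCoeff e a b k l x) • (S.gam k * S.gam l)) (ψ x) := by
    have h := frameNabla_commutator S F hψ hx a b
    simp only [sub_smul, Finset.sum_sub_distrib] at h
    simp only [hN, hφ]
    rw [sub_sub_sub_comm, h]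
    abel
  have h4 := S.isCliffordFamily_gam.sum_curvature (fun a b k l ↦ curvCoeff e a b k l x)
    (fun a b c d ↦ F.curvCoeff_swap x a b c d) (fun a b c d ↦ F.curvCoeff_skew hx a b c d)
    (fun a b c d ↦ F.curvCoeff_pair_symm hx a b c d)
    (fun a b c d ↦ F.curvCoeff_bianchi hx a b c d)
  rw [← F.scalarCurvature_eq hx] at h4
  have h5 : ∑ a, ∑ b, S.gam a (S.gam b (N a b - N b a)) =
      (1 / 4 : ℝ) • ((2 * scalarCurvature (𝓡 n) x) • ψ x) := by
    have h6 := congrArg (fun T : Δ →L[ℂ] Δ ↦ (1 / 4 : ℝ) • T (ψ x)) h4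
    simp only [smul_apply, one_apply_eq_self] at h6
    rw [← h6, Finset.sum_congr rfl fun a _ ↦ Finset.sum_congr rfl fun b _ ↦ by rw [h3 a b]]
    simp only [FunLike.coe_sum, Finset.sum_apply, Finset.smul_sum, smul_apply, map_sum,
      mul_apply_eq_comp, smul_smul]
    refine Finset.sum_congr rfl fun a _ ↦ Finset.sum_congr rfl fun b _ ↦
      Finset.sum_congr rfl fun k _ ↦ Finset.sum_congr rfl fun l _ ↦ ?_
    rw [op_smul_real, op_smul_real]
  -- The constant is one half from antisymmetrization, one quarter from the spin connection, and 2
  -- from the contraction.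
  rw [h1, sum_gam_gam, h5, Finset.sum_congr rfl fun a _ ↦ h2 a, smul_smul, smul_smul]
  congr 2
  ring

end FrameNabla

/-! ### Comparison of two connection forms related by a change of frame. -/

section ConjugateFrames

variable {n : ℕ} {A : Type*} [Ring A] [Algebra ℝ A] {γ : Fin n → A}

theorem mul_mem_evenWordSpan_of_mem {s : Finset (Fin n)} {x y : A} (hx : x ∈ evenWordSpan γ s)
    (hy : y ∈ evenWordSpan γ s) : x * y ∈ evenWordSpan γ s := by
  induction hx using Submodule.span_induction with
  | mem x h =>
    obtain ⟨l, hl, hls, rfl⟩ := h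
    induction hy using Submodule.span_induction with
    | mem y h =>
      obtain ⟨m, hm, hms, rfl⟩ := h
      refine Submodule.subset_span ⟨l ++ m, ?_, ?_, ?_⟩
      · rw [List.length_append]; exact hl.add hm
      · intro b hb
        rcases List.mem_append.1 hb with hb | hb
        exacts [hls b hb, hms b hb]
      · simp
    | zero => simp
    | add y z _ _ hy hz => rw [mul_add]; exact add_mem hy hz
    | smul r y _ hy => rw [mul_smul_comm]; exact Submodule.smul_mem _ r hy
  | zero => simp
  | add x z _ _ hx hz => rw [add_mul]; exact add_mem hx hz
  | smul r x _ hx => rw [smul_mul_assoc]; exact Submodule.smul_mem _ r hx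

/-- The difference of two connections that induce the same covariant derivative of vectors
commutes with all vectors. -/
theorem commute_of_conjugate {G G' Gd Ω Ω' : A} {R Rd B B' : Fin n → Fin n → ℝ} (h1 : G * G' = 1)
    (h2 : G' * G = 1) (hR : ∀ a, G * γ a = ∑ b, R b a • (γ b * G))
    (hd : ∀ a, Gd * γ a = ∑ b, (Rd b a • (γ b * G) + R b a • (γ b * Gd)))
    (hΩ : ∀ d, Ω * γ d - γ d * Ω = ∑ c, B d c • γ c)
    (hΩ' : ∀ d, Ω' * γ d - γ d * Ω' = ∑ c, B' d c • γ c)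
    (hB : ∀ a c, Rd c a + ∑ b, R b a * B b c - ∑ d, B' a d * R c d = 0)
    (hRR : ∀ b c, ∑ a, R c a * R b a = if c = b then 1 else 0) (c : Fin n) :
    (Gd * G' + Ω - G * Ω' * G') * γ c = γ c * (Gd * G' + Ω - G * Ω' * G') := by
  have hR' (a : Fin n) : G * γ a * G' = ∑ b, R b a • γ b := by
    rw [hR, Finset.sum_mul]
    simp only [smul_mul_assoc, mul_assoc, h1, mul_one]
  -- `e1`, `e2`, `e3` compute the commutators of the three summands with the rotated vectors
  -- $G\gamma_aG^{-1}$. By `hB` their combination is zero.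
  have e1 (a : Fin n) : Gd * G' * (G * γ a * G') - G * γ a * G' * (Gd * G') =
      ∑ b, Rd b a • γ b := by
    have : Gd * G' * (G * γ a * G') = Gd * γ a * G' := by
      rw [show Gd * G' * (G * γ a * G') = Gd * (G' * G) * γ a * G' by noncomm_ring, h2, mul_one]
    rw [this, hd, hR', Finset.sum_mul, Finset.sum_mul, ← Finset.sum_sub_distrib]
    refine Finset.sum_congr rfl fun b _ ↦ ?_
    rw [add_mul]
    simp only [smul_mul_assoc, mul_assoc, h1, mul_one]
    abel
  have e2 (a : Fin n) : Ω * (G * γ a * G') - G * γ a * G' * Ω =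
      ∑ c, (∑ b, R b a * B b c) • γ c := by
    rw [hR', Finset.mul_sum, Finset.sum_mul, ← Finset.sum_sub_distrib]
    simp only [Finset.sum_smul]
    rw [Finset.sum_comm]
    refine Finset.sum_congr rfl fun b _ ↦ ?_
    rw [mul_smul_comm, smul_mul_assoc, ← smul_sub, hΩ, Finset.smul_sum]
    simp only [smul_smul]
  have e3 (a : Fin n) : G * Ω' * G' * (G * γ a * G') - G * γ a * G' * (G * Ω' * G') =
      ∑ c, (∑ d, B' a d * R c d) • γ c := by
    have : G * Ω' * G' * (G * γ a * G') - G * γ a * G' * (G * Ω' * G') =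
        G * (Ω' * γ a - γ a * Ω') * G' := by
      rw [show G * Ω' * G' * (G * γ a * G') - G * γ a * G' * (G * Ω' * G') =
        G * Ω' * (G' * G) * γ a * G' - G * γ a * (G' * G) * Ω' * G' by noncomm_ring, h2]
      noncomm_ring
    rw [this, hΩ', Finset.mul_sum, Finset.sum_mul]
    simp only [Finset.sum_smul]
    rw [Finset.sum_comm]
    refine Finset.sum_congr rfl fun d _ ↦ ?_
    rw [mul_smul_comm, smul_mul_assoc, hR', Finset.smul_sum]
    simp only [smul_smul]
  have e4 (a : Fin n) : (Gd * G' + Ω - G * Ω' * G') * (G * γ a * G') =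
      (G * γ a * G') * (Gd * G' + Ω - G * Ω' * G') := by
    rw [← sub_eq_zero]
    calc _ = (Gd * G' * (G * γ a * G') - G * γ a * G' * (Gd * G'))
          + (Ω * (G * γ a * G') - G * γ a * G' * Ω)
          - (G * Ω' * G' * (G * γ a * G') - G * γ a * G' * (G * Ω' * G')) := by noncomm_ring
      _ = ∑ c, (Rd c a + ∑ b, R b a * B b c - ∑ d, B' a d * R c d) • γ c := by
        rw [e1, e2, e3]
        simp only [sub_smul, add_smul, Finset.sum_sub_distrib, Finset.sum_add_distrib]
      _ = 0 := by simp only [hB, zero_smul, Finset.sum_const_zero]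
  -- Orthogonality `hRR` recovers each `γ c` from the rotated vectors, so commuting with the latter
  -- suffices.
  have e5 : γ c = ∑ a, R c a • (G * γ a * G') := by
    simp only [hR', Finset.smul_sum, smul_smul]
    rw [Finset.sum_comm]
    simp only [← Finset.sum_smul, hRR, ite_smul, one_smul, zero_smul, Finset.sum_ite_eq,
      Finset.mem_univ, if_true]
  rw [e5, Finset.mul_sum, Finset.sum_mul]
  exact Finset.sum_congr rfl fun a _ ↦ by rw [mul_smul_comm, e4, smul_mul_assoc]

end ConjugateFrames

/-! ### Transition functions and the globally defined operators. -/

section Transition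

set_option linter.unusedSectionVars false

variable {n : ℕ} {M : Type*} [TopologicalSpace M] [ChartedSpace (EuclideanSpace ℝ (Fin n)) M]
  [IsManifold (𝓡 n) ∞ M] [RiemannianBundle (fun x : M ↦ TangentSpace (𝓡 n) x)]
  [IsContMDiffRiemannianBundle (𝓡 n) ∞ (EuclideanSpace ℝ (Fin n))
    (fun x : M ↦ TangentSpace (𝓡 n) x)]

/-- A functional that vanishes on `W` also annihilates the derivative. With `W` the even span, the
derivative of a spin-valued function stays even. -/
theorem mvfderiv_mem_submodule {V : Type*} [NormedAddCommGroup V] [NormedSpace ℝ V]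
    [FiniteDimensional ℝ V] (W : Submodule ℝ V) {f : M → V} {U : Set M} (hU : IsOpen U)
    (hf : ∀ y ∈ U, f y ∈ W) {x : M} (hx : x ∈ U) (hd : MDifferentiableAt (𝓡 n) 𝓘(ℝ, V) f x)
    (v : TangentSpace (𝓡 n) x) : mvfderiv (𝓡 n) f x v ∈ W := by
  by_contra h
  obtain ⟨l, hl, hW⟩ := Submodule.exists_le_ker_of_notMem h
  refine hl ?_
  have h1 := mvfderiv_clm_comp (LinearMap.toContinuousLinearMap l) hd v
  rw [LinearMap.coe_toContinuousLinearMap'] at h1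
  rw [← h1, mvfderiv_congr (g := fun _ ↦ (0 : ℝ))
    (Filter.eventually_of_mem (hU.mem_nhds hx) fun y hy ↦ hW (hf y hy)), mvfderiv_const]
  rfl

theorem contMDiffOn_of_forall_dual {V : Type*} [NormedAddCommGroup V] [NormedSpace ℝ V]
    [FiniteDimensional ℝ V] {f : M → V} {U : Set M}
    (hf : ∀ l : V →ₗ[ℝ] ℝ, ContMDiffOn (𝓡 n) 𝓘(ℝ) ∞ (fun x ↦ l (f x)) U) :
    ContMDiffOn (𝓡 n) 𝓘(ℝ, V) ∞ f U := by
  let b := Module.finBasis ℝ V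
  have h : ContMDiffOn (𝓡 n) 𝓘(ℝ, V) ∞ (fun x ↦ ∑ k, b.coord k (f x) • b k) U :=
    contMDiffOn_sum _ fun k _ ↦ (hf (b.coord k)).smul contMDiffOn_const
  refine h.congr fun x _ ↦ ?_
  exact (b.sum_repr (f x)).symm

variable {Δ : Type*} [NormedAddCommGroup Δ] [InnerProductSpace ℂ Δ] [FiniteDimensional ℂ Δ]
  (S : SpinorModule n Δ)

variable (Δ) in
/-- The Hermitian product, as a real bilinear map. -/
def innerBilin : Δ →L[ℝ] Δ →L[ℝ] ℂ :=
  LinearMap.mkContinuous₂ (LinearMap.mk₂ ℝ (fun φ ψ : Δ ↦ (inner ℂ φ ψ : ℂ))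
    inner_add_left (fun r φ ψ ↦ by
      rw [← Complex.coe_smul, inner_smul_left, Complex.conj_ofReal, Complex.real_smul])
    inner_add_right (fun r φ ψ ↦ by
      rw [← Complex.coe_smul, inner_smul_right, Complex.real_smul])) 1
    (fun φ ψ ↦ by simpa using norm_inner_le_norm φ ψ)

@[simp]
theorem innerBilin_apply (φ ψ : Δ) : innerBilin Δ φ ψ = inner ℂ φ ψ := rfl

theorem frameConn_mem_evenWordSpan (e : Fin n → Π x : M, TangentSpace (𝓡 n) x) (x : M)
    (v : TangentSpace (𝓡 n) x) : frameConn S e x v ∈ evenWordSpan S.gam ∅ := by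
  refine sum_mem fun a _ ↦ sum_mem fun b _ ↦ Submodule.smul_mem _ _ ?_
  exact Submodule.subset_span ⟨[a, b], by simp⟩

namespace SpinStructure

variable (P : SpinStructure n M)

scoped instance finiteDimensional_operators : FiniteDimensional ℝ (Δ →L[ℂ] Δ) :=
  FiniteDimensional.complexToReal _

theorem isOpen_inter (i j : P.Index) : IsOpen (P.U i ∩ P.U j) :=
  (P.isOpen_U i).inter (P.isOpen_U j)

/-- The transition functions `⟨e i b, e j a⟩` of the frames. -/
def rot (i j : P.Index) (b a : Fin n) (x : M) : ℝ := inner ℝ (P.e i b x) (P.e j a x)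

theorem contMDiffOn_rot (i j : P.Index) (b a : Fin n) :
    ContMDiffOn (𝓡 n) 𝓘(ℝ) ∞ (P.rot i j b a) (P.U i ∩ P.U j) :=
  SmoothFieldOn.inner (ContMDiffOn.mono (P.contMDiffOn_e i b) Set.inter_subset_left)
    (ContMDiffOn.mono (P.contMDiffOn_e j a) Set.inter_subset_right)

theorem rot_swap (i j : P.Index) (b a : Fin n) (x : M) : P.rot i j b a x = P.rot j i a b x :=
  real_inner_comm _ _

theorem frame_eq_sum_rot (i j : P.Index) {x : M} (hx : x ∈ P.U i ∩ P.U j) (a : Fin n) :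
    P.e i a x = ∑ b, P.rot i j a b x • P.e j b x := by
  conv_lhs => rw [← (P.isOrthonormalFrame j).sum_inner_smul hx.2 (P.e i a x)]
  exact Finset.sum_congr rfl fun b _ ↦ by rw [rot_swap]; rfl

theorem sum_rot_mul_rot (i j : P.Index) {x : M} (hx : x ∈ P.U i ∩ P.U j) (b c : Fin n) :
    ∑ a, P.rot i j c a x * P.rot i j b a x = if c = b then 1 else 0 := by
  rw [← (P.isOrthonormalFrame i).inner_eq hx.1,
    ← (P.isOrthonormalFrame j).sum_inner_mul_inner hx.2]
  simp only [rot, real_inner_comm]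

theorem contMDiffOn_op_g (i j : P.Index) :
    ContMDiffOn (𝓡 n) 𝓘(ℝ, Δ →L[ℂ] Δ) ∞ (fun x ↦ S.op (P.g i j x)) (P.U i ∩ P.U j) :=
  contMDiffOn_of_forall_dual fun l ↦ P.contMDiffOn_g i j (l.comp S.op.toLinearMap)

/-- The lifting condition with $g^{-1}$ moved to the other side, a form that can be differentiated
without differentiating an inverse. -/
theorem op_g_mul_gam (i j : P.Index) {x : M} (hx : x ∈ P.U i ∩ P.U j) (a : Fin n) :
    S.op (P.g i j x) * S.gam a = ∑ b, P.rot i j b a x • (S.gam b * S.op (P.g i j x)) := by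
  have h := congrArg (fun z ↦ S.op z * S.op (P.g i j x)) (P.lift i j x hx a)
  simp only [map_mul, S.op_ι] at h
  rw [mul_assoc, S.op_star_mul_op (P.g_mem i j x hx), mul_one, Finset.sum_mul] at h
  simp only [smul_mul_assoc] at h
  exact h

/-- The transition functions of the spinor bundle are parallel. -/
theorem mvfderiv_op_g (i j : P.Index) {x : M} (hx : x ∈ P.U i ∩ P.U j)
    (v : TangentSpace (𝓡 n) x) :
    mvfderiv (𝓡 n) (fun y ↦ S.op (P.g i j y)) x v + frameConn S (P.e i) x v * S.op (P.g i j x) =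
      S.op (P.g i j x) * frameConn S (P.e j) x v := by
  have hO := P.isOpen_inter i j
  have hdG := mdifferentiableAt_of_contMDiffOn hO (P.contMDiffOn_op_g S i j) hx
  have hdR (b a : Fin n) := mdifferentiableAt_of_contMDiffOn hO (P.contMDiffOn_rot i j b a) hx
  have hmem := P.g_mem i j x hx
  set G := S.op (P.g i j x) with hG
  set G' := S.op (star (P.g i j x)) with hG'
  set Gd : Δ →L[ℂ] Δ := mvfderiv (𝓡 n) (fun y ↦ S.op (P.g i j y)) x v with hGd
  have h1 : G * G' = 1 := S.op_mul_op_star hmem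
  have h2 : G' * G = 1 := S.op_star_mul_op hmem
  have Fi := P.isOrthonormalFrame i
  have Fj := P.isOrthonormalFrame j
  have hd (a : Fin n) : Gd * S.gam a = ∑ b, (mvfderiv (𝓡 n) (P.rot i j b a) x v • (S.gam b * G)
      + P.rot i j b a x • (S.gam b * Gd)) := by
    have e1 := mvfderiv_clm_comp ((ContinuousLinearMap.mul ℝ (Δ →L[ℂ] Δ)).flip (S.gam a)) hdG v
    have hdm (b : Fin n) : MDifferentiableAt (𝓡 n) 𝓘(ℝ, Δ →L[ℂ] Δ)
        (fun y ↦ S.gam b * S.op (P.g i j y)) x :=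
      mdifferentiableAt_bilin (ContinuousLinearMap.mul ℝ (Δ →L[ℂ] Δ)) mdifferentiableAt_const hdG
    have e2 (b : Fin n) : mvfderiv (𝓡 n) (fun y ↦ S.gam b * S.op (P.g i j y)) x v =
        S.gam b * Gd := mvfderiv_clm_comp (ContinuousLinearMap.mul ℝ (Δ →L[ℂ] Δ) (S.gam b)) hdG v
    have hds (b : Fin n) : MDifferentiableAt (𝓡 n) 𝓘(ℝ, Δ →L[ℂ] Δ)
        (fun y ↦ P.rot i j b a y • (S.gam b * S.op (P.g i j y))) x := (hdR b a).smul (hdm b)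
    refine e1.symm.trans ?_
    change mvfderiv (𝓡 n) (fun y ↦ S.op (P.g i j y) * S.gam a) x v = _
    rw [mvfderiv_congr (Filter.eventually_of_mem (hO.mem_nhds hx)
      fun y hy ↦ P.op_g_mul_gam S i j hy a), mvfderiv_sum _ fun b _ ↦ hds b]
    simp only [FunLike.coe_sum, Finset.sum_apply]
    refine Finset.sum_congr rfl fun b _ ↦ ?_
    rw [mvfderiv_smul_apply (hdR b a) (hdm b), e2]
  have hv := mdifferentiableAt_extend (𝓡 n) (EuclideanSpace ℝ (Fin n)) v
  -- The Levi-Civita connection is metric, so the derivative of $\langle e^i_c,e^j_a\rangle$ is the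
  -- sum of the two connection terms, each expanded in its own frame.
  have hB (a c : Fin n) : mvfderiv (𝓡 n) (P.rot i j c a) x v
      + ∑ b, P.rot i j b a x * inner ℝ (leviCivita (I := 𝓡 n) (P.e i b) x v) (P.e i c x)
      - ∑ d, inner ℝ (leviCivita (I := 𝓡 n) (P.e j a) x v) (P.e j d x) * P.rot i j c d x = 0 := by
    have e1 := leviCivita_metric hv (Fi.mdifferentiableAt c hx.1) (Fj.mdifferentiableAt a hx.2)
    rw [extend_apply_self] at e1
    have e2 : ∑ b, P.rot i j b a x * inner ℝ (leviCivita (I := 𝓡 n) (P.e i b) x v) (P.e i c x) =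
        -inner ℝ (leviCivita (I := 𝓡 n) (P.e i c) x v) (P.e j a x) := by
      rw [← Fi.sum_inner_mul_inner hx.1, ← Finset.sum_neg_distrib]
      refine Finset.sum_congr rfl fun b _ ↦ ?_
      rw [Fi.inner_leviCivita_skew hx.1, rot, real_inner_comm (P.e i b x)
        (leviCivita (I := 𝓡 n) (P.e i c) x v)]
      ring
    have e3 : ∑ d, inner ℝ (leviCivita (I := 𝓡 n) (P.e j a) x v) (P.e j d x) * P.rot i j c d x =
        inner ℝ (P.e i c x) (leviCivita (I := 𝓡 n) (P.e j a) x v) := by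
      rw [← Fj.sum_inner_mul_inner hx.2]
      refine Finset.sum_congr rfl fun d _ ↦ ?_
      rw [rot, real_inner_comm (P.e j d x) (leviCivita (I := 𝓡 n) (P.e j a) x v),
        real_inner_comm (P.e j d x) (P.e i c x)]
      ring
    rw [e2, e3, show mvfderiv (𝓡 n) (P.rot i j c a) x v = _ from e1]
    ring
  have hcomm := commute_of_conjugate h1 h2 (fun a ↦ P.op_g_mul_gam S i j hx a) hd
    (fun d ↦ frameConn_commutator S Fi hx.1 v d) (fun d ↦ frameConn_commutator S Fj hx.2 v d)
    hB (fun b c ↦ P.sum_rot_mul_rot i j hx b c)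
  have hGe {y : M} (hy : y ∈ P.U i ∩ P.U j) : S.op (P.g i j y) ∈ evenWordSpan S.gam ∅ :=
    S.op_mem_evenWordSpan (spinGroup.mem_even (P.g_mem i j y hy))
  have hGe' : G' ∈ evenWordSpan S.gam ∅ :=
    S.op_mem_evenWordSpan (spinGroup.mem_even (spinGroup.star_mem hmem))
  -- Evenness is essential: in the full Clifford algebra the elements commuting with all vectors can
  -- include the volume element, besides scalars.
  have heven : Gd * G' + frameConn S (P.e i) x v - G * frameConn S (P.e j) x v * G' ∈
      evenWordSpan S.gam ∅ := by
    refine sub_mem (add_mem (mul_mem_evenWordSpan_of_mem ?_ hGe') ?_)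
      (mul_mem_evenWordSpan_of_mem (mul_mem_evenWordSpan_of_mem (hGe hx) ?_) hGe')
    · exact mvfderiv_mem_submodule _ hO (fun y hy ↦ hGe hy) hx hdG v
    · exact frameConn_mem_evenWordSpan S _ x v
    · exact frameConn_mem_evenWordSpan S _ x v
  obtain ⟨r, hr⟩ := S.isCliffordFamily_gam.exists_eq_smul_one_of_commute heven hcomm
  have hadj (φ ψ : Δ) : inner ℂ (G φ) ψ = inner ℂ φ (G' ψ) := by
    rw [← S.inner_op_star, star_star]
  have hadj' (φ ψ : Δ) : inner ℂ (G' φ) ψ = inner ℂ φ (G ψ) := S.inner_op_star _ _ _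
  have hGG' (φ : Δ) : G (G' φ) = φ := congrArg (fun T : Δ →L[ℂ] Δ ↦ T φ) h1
  -- Obtained by differentiating the unitarity relation $\langle
  -- g\varphi,g\psi\rangle=\langle\varphi,\psi\rangle$.
  have hskewG (φ ψ : Δ) : inner ℂ (Gd φ) (G ψ) = -inner ℂ (G φ) (Gd ψ) := by
    have hdφ (φ : Δ) : MDifferentiableAt (𝓡 n) 𝓘(ℝ, Δ) (fun y ↦ S.op (P.g i j y) φ) x :=
      mdifferentiableAt_bilin (evalOp Δ) hdG mdifferentiableAt_const
    have e2 (φ : Δ) : mvfderiv (𝓡 n) (fun y ↦ S.op (P.g i j y) φ) x v = Gd φ :=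
      mvfderiv_clm_comp ((evalOp Δ).flip φ) hdG v
    have e1 := mvfderiv_bilin
      (innerBilin Δ) (hdφ φ) (hdφ ψ) v
    simp only [innerBilin_apply] at e1
    rw [mvfderiv_congr (g := fun _ ↦ inner ℂ φ ψ) (Filter.eventually_of_mem (hO.mem_nhds hx)
      fun y hy ↦ S.inner_op_op (P.g_mem i j y hy) φ ψ), mvfderiv_const, e2, e2] at e1
    exact eq_neg_of_add_eq_zero_left e1.symm
  -- All three summands are skew-Hermitian, so $\langle
  -- r\varphi,\varphi\rangle+\langle\varphi,r\varphi\rangle=0$. For real `r` and nonzero `φ` this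
  -- forces `r = 0`.
  have hr0 : r = 0 := by
    have := S.nontrivial
    obtain ⟨φ, hφ⟩ := exists_ne (0 : Δ)
    have e1 : Gd (G' φ) + frameConn S (P.e i) x v φ - G (frameConn S (P.e j) x v (G' φ)) = r • φ :=
      congrArg (fun T : Δ →L[ℂ] Δ ↦ T φ) hr
    have e2 := congrArg (fun z ↦ inner ℂ z φ) e1
    have e3 := congrArg (fun z ↦ inner ℂ φ z) e1
    simp only [inner_sub_left, inner_sub_right, inner_add_left, inner_add_right] at e2 e3
    have e4 := hskewG (G' φ) (G' φ)
    rw [hGG'] at e4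
    rw [e4, inner_frameConn_left S Fi hx.1, hadj, inner_frameConn_left S Fj hx.2, hadj'] at e2
    rw [← Complex.coe_smul, inner_smul_left, Complex.conj_ofReal] at e2
    rw [← Complex.coe_smul, inner_smul_right] at e3
    have e5 : (r : ℂ) * inner ℂ φ φ = 0 := by linear_combination (-1 / 2 : ℂ) * (e2 + e3)
    rcases mul_eq_zero.1 e5 with h | h
    · exact_mod_cast h
    · exact absurd (inner_self_eq_zero.1 h) hφ
  rw [hr0, zero_smul, sub_eq_zero] at hr
  have := congrArg (fun T ↦ T * G) hr
  simp only [add_mul, mul_assoc, h2, mul_one] at this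
  exact this

/-- The covariant derivative of spinors does not depend on the frame. -/
theorem frameNabla_transition (i j : P.Index) {f : M → Δ} {x : M} (hx : x ∈ P.U i ∩ P.U j)
    (hf : MDifferentiableAt (𝓡 n) 𝓘(ℝ, Δ) f x) (v : TangentSpace (𝓡 n) x) :
    frameNabla S (P.e i) (fun y ↦ S.op (P.g i j y) (f y)) x v =
      S.op (P.g i j x) (frameNabla S (P.e j) f x v) := by
  have hdG := mdifferentiableAt_of_contMDiffOn (P.isOpen_inter i j) (P.contMDiffOn_op_g S i j) hx
  have h := congrArg (fun T : Δ →L[ℂ] Δ ↦ T (f x)) (P.mvfderiv_op_g S i j hx v)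
  simp only [add_apply, mul_apply_eq_comp] at h
  have h2 := mvfderiv_bilin (evalOp Δ) hdG hf v
  simp only [evalOp_apply] at h2
  rw [frameNabla, h2, frameNabla, map_add, ← h]
  abel

variable {P} {S}

theorem IsSpinor.mdifferentiableAt {ψ : P.Index → M → Δ} (hψ : P.IsSpinor S ψ) (i : P.Index)
    {x : M} (hx : x ∈ P.U i) : MDifferentiableAt (𝓡 n) 𝓘(ℝ, Δ) (ψ i) x :=
  mdifferentiableAt_of_contMDiffOn (P.isOpen_U i) (hψ.contMDiffOn i) hx

theorem IsSpinor.isSpinorForm_nabla {ψ : P.Index → M → Δ} (hψ : P.IsSpinor S ψ) :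
    P.IsSpinorForm S (P.nabla S ψ) where
  contMDiffOn i a := by
    simp only [nabla, localNabla_apply]
    exact contMDiffOn_frameNabla S (P.isOrthonormalFrame i) (hψ.contMDiffOn i)
      (P.contMDiffOn_e i a)
  transition i j x hx v := by
    simp only [nabla, localNabla_apply]
    rw [frameNabla_congr S (P.isOpen_inter i j) (hψ.transition i j) hx]
    exact P.frameNabla_transition S i j hx (hψ.mdifferentiableAt j hx.2) v

theorem op_g_gam_apply (i j : P.Index) {x : M} (hx : x ∈ P.U i ∩ P.U j) (a : Fin n) (φ : Δ) :
    S.op (P.g i j x) (S.gam a φ) =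
      ∑ b, P.rot i j b a x • S.gam b (S.op (P.g i j x) φ) := by
  have h := congrArg (fun T : Δ →L[ℂ] Δ ↦ T φ) (P.op_g_mul_gam S i j hx a)
  simp only [mul_apply_eq_comp, FunLike.coe_sum, Finset.sum_apply, smul_apply] at h
  exact h

theorem dirac_apply (ψ : P.Index → M → Δ) (i : P.Index) (x : M) :
    P.dirac S ψ i x = ∑ a, S.gam a (frameNabla S (P.e i) (ψ i) x (P.e i a x)) := by
  simp only [dirac, nabla, localNabla_apply, SpinorModule.gamma_apply]

/-- The rotation acting on the Clifford vector and the one acting on the direction of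
differentiation are contracted with each other, so the Dirac sum does not depend on the frame. -/
theorem IsSpinor.isSpinor_dirac {ψ : P.Index → M → Δ} (hψ : P.IsSpinor S ψ) :
    P.IsSpinor S (P.dirac S ψ) where
  contMDiffOn i := by
    rw [show P.dirac S ψ i = _ from funext fun x ↦ dirac_apply ψ i x]
    exact contMDiffOn_sum _ fun a _ ↦ contMDiffOn_op _ (contMDiffOn_frameNabla S
      (P.isOrthonormalFrame i) (hψ.contMDiffOn i) (P.contMDiffOn_e i a))
  transition i j x hx := by
    have h (v : TangentSpace (𝓡 n) x) : frameNabla S (P.e i) (ψ i) x v =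
        S.op (P.g i j x) (frameNabla S (P.e j) (ψ j) x v) := by
      rw [← localNabla_apply, ← localNabla_apply]
      exact hψ.isSpinorForm_nabla.transition i j x hx v
    rw [← S.op_apply, dirac_apply, dirac_apply, map_sum]
    simp only [h, op_g_gam_apply i j hx]
    rw [Finset.sum_comm]
    refine Finset.sum_congr rfl fun a _ ↦ ?_
    rw [P.frame_eq_sum_rot i j hx a, frameNabla_sum_smul, map_sum, map_sum]
    exact Finset.sum_congr rfl fun b _ ↦ by rw [op_smul_real, op_smul_real]

theorem nablaStar_apply (η : P.Index → Π x : M, TangentSpace (𝓡 n) x →L[ℝ] Δ) (i : P.Index)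
    (x : M) : P.nablaStar S η i x =
      -∑ a, (frameNabla S (P.e i) (fun y ↦ η i y (P.e i a y)) x (P.e i a x)
        - η i x (leviCivita (I := 𝓡 n) (P.e i a) x (P.e i a x))) := by
  simp only [nablaStar, localNabla_apply]

/-- Both $\nabla_{e_a}(\eta(e_a))$ and $\eta(\nabla_{e_a}e_a)$ pick up the same derivative of the
rotation under a change of frame. It cancels in their difference, and the remaining rotations
contract by orthogonality. -/
theorem IsSpinorForm.isSpinor_nablaStar
    {η : P.Index → Π x : M, TangentSpace (𝓡 n) x →L[ℝ] Δ} (hη : P.IsSpinorForm S η) :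
    P.IsSpinor S (P.nablaStar S η) where
  contMDiffOn i := by
    have F := P.isOrthonormalFrame i
    rw [show P.nablaStar S η i = _ from funext fun x ↦ nablaStar_apply η i x]
    refine (contMDiffOn_sum _ fun a _ ↦ (contMDiffOn_frameNabla S F (hη.contMDiffOn i a)
      (P.contMDiffOn_e i a)).sub ?_).neg
    have h : ContMDiffOn (𝓡 n) 𝓘(ℝ, Δ) ∞
        (fun x ↦ ∑ c, connCoeff (P.e i) a a c x • η i x (P.e i c x)) (P.U i) :=
      contMDiffOn_sum _ fun c _ ↦ (F.contMDiffOn_connCoeff a a c).smul (hη.contMDiffOn i c)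
    refine h.congr fun x hx ↦ ?_
    rw [F.leviCivita_eq_sum hx, map_sum]
    simp only [map_smul]
  transition i j x hx := by
    have Fi := P.isOrthonormalFrame i
    have Fj := P.isOrthonormalFrame j
    have hO := P.isOpen_inter i j
    have hdη (b : Fin n) := mdifferentiableAt_of_contMDiffOn Fj.isOpen (hη.contMDiffOn j b) hx.2
    have hdR (b a : Fin n) := mdifferentiableAt_of_contMDiffOn hO (P.contMDiffOn_rot i j b a) hx
    have h1 (a : Fin n) : frameNabla S (P.e i) (fun y ↦ η i y (P.e i a y)) x (P.e i a x) =
        S.op (P.g i j x) (∑ b, (mvfderiv (𝓡 n) (P.rot i j a b) x (P.e i a x) • η j x (P.e j b x)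
          + P.rot i j a b x • frameNabla S (P.e j) (fun y ↦ η j y (P.e j b y)) x (P.e i a x))) := by
      have e1 : ∀ y ∈ P.U i ∩ P.U j, η i y (P.e i a y) =
          S.op (P.g i j y) (∑ b, P.rot i j a b y • η j y (P.e j b y)) := by
        intro y hy
        rw [hη.transition i j y hy, P.frame_eq_sum_rot i j hy a, map_sum, S.op_apply]
        simp only [map_smul]
      have hd (b : Fin n) : MDifferentiableAt (𝓡 n) 𝓘(ℝ, Δ)
        (fun y ↦ P.rot i j a b y • η j y (P.e j b y)) x := (hdR a b).smul (hdη b)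
      rw [frameNabla_congr S hO e1 hx, P.frameNabla_transition S i j hx
        (mdifferentiableAt_sum _ fun b _ ↦ hd b), frameNabla_sum S _ fun b _ ↦ hd b]
      congr 1
      exact Finset.sum_congr rfl fun b _ ↦ frameNabla_smul S (hdR a b) (hdη b) _
    have h2 (a : Fin n) : η i x (leviCivita (I := 𝓡 n) (P.e i a) x (P.e i a x)) =
        S.op (P.g i j x) (∑ b, (mvfderiv (𝓡 n) (P.rot i j a b) x (P.e i a x) • η j x (P.e j b x)
          + P.rot i j a b x • η j x (leviCivita (I := 𝓡 n) (P.e j b) x (P.e i a x)))) := by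
      have hs (b : Fin n) : SmoothFieldOn (fun y ↦ P.rot i j a b y • P.e j b y) (P.U i ∩ P.U j) :=
        SmoothFieldOn.smul (P.contMDiffOn_rot i j a b)
          (ContMDiffOn.mono (P.contMDiffOn_e j b) Set.inter_subset_right)
      rw [hη.transition i j x hx, leviCivita_congr hO
        (ContMDiffOn.mono (P.contMDiffOn_e i a) Set.inter_subset_left)
        (fun y hy ↦ P.frame_eq_sum_rot i j hy a) hx,
        leviCivita_sum _ fun b _ ↦ (hs b).mdifferentiableAt hO hx, S.op_apply]
      congr 1
      simp only [FunLike.coe_sum, Finset.sum_apply, map_sum]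
      refine Finset.sum_congr rfl fun b _ ↦ ?_
      rw [leviCivita_smul (hdR a b) (Fj.mdifferentiableAt b hx.2), map_add, map_smul, map_smul,
        add_comm]
    have h3 (b : Fin n) : P.e j b x = ∑ a, P.rot i j a b x • P.e i a x := by
      rw [P.frame_eq_sum_rot j i hx.symm b]
      simp only [P.rot_swap j i]
    rw [← S.op_apply, nablaStar_apply, nablaStar_apply, map_neg]
    simp only [h1, h2, ← map_sub, ← map_sum, ← Finset.sum_sub_distrib, add_sub_add_left_eq_sub]
    congr 2
    rw [Finset.sum_comm]
    refine Finset.sum_congr rfl fun b _ ↦ ?_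
    conv_rhs => rw [show frameNabla S (P.e j) (fun y ↦ η j y (P.e j b y)) x (P.e j b x) =
      ∑ a, P.rot i j a b x • frameNabla S (P.e j) (fun y ↦ η j y (P.e j b y)) x (P.e i a x) by
        rw [← frameNabla_sum_smul, ← h3], show leviCivita (I := 𝓡 n) (P.e j b) x (P.e j b x) =
      ∑ a, P.rot i j a b x • leviCivita (I := 𝓡 n) (P.e j b) x (P.e i a x) by
        conv_lhs => rw [h3 b, map_sum]
        simp only [map_smul]]
    rw [map_sum, ← Finset.sum_sub_distrib]
    simp only [map_smul]

theorem IsSpinor.lichnerowicz {ψ : P.Index → M → Δ} (hψ : P.IsSpinor S ψ) (i : P.Index) {x : M}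
    (hx : x ∈ P.U i) : P.dirac S (P.dirac S ψ) i x =
      P.nablaStar S (P.nabla S ψ) i x + (scalarCurvature (𝓡 n) x / 4) • ψ i x := by
  rw [dirac_apply, nablaStar_apply, show P.dirac S ψ i = _ from funext fun x ↦ dirac_apply ψ i x]
  simp only [nabla, localNabla_apply]
  exact frame_lichnerowicz S (P.isOrthonormalFrame i) (hψ.contMDiffOn i) hx

end SpinStructure
end Transition

/-! ### The Riemannian density and its behaviour under reparametrisation. -/

section GramDensity

set_option linter.unusedSectionVars false

variable {n : ℕ} {M : Type*} [TopologicalSpace M] [ChartedSpace (EuclideanSpace ℝ (Fin n)) M]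
  [IsManifold (𝓡 n) ∞ M] [RiemannianBundle (fun x : M ↦ TangentSpace (𝓡 n) x)]

/-- The Gram determinant of a family of tangent vectors. -/
def gramDet (x : M) (w : Fin n → TangentSpace (𝓡 n) x) : ℝ :=
  Matrix.det (Matrix.of fun a b : Fin n ↦ (inner ℝ (w a) (w b) : ℝ))

/-- If $A$ is the coordinate matrix of `v`, the Gram matrix becomes $A^{T}GA$. -/
theorem gramDet_map {x : M} (J : EuclideanSpace ℝ (Fin n) →L[ℝ] TangentSpace (𝓡 n) x)
    (v : Fin n → EuclideanSpace ℝ (Fin n)) :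
    gramDet x (fun a ↦ J (v a)) = (EuclideanSpace.basisFun (Fin n) ℝ).toBasis.det v ^ 2 *
      gramDet x (fun a ↦ J (EuclideanSpace.single a 1)) := by
  set b := (EuclideanSpace.basisFun (Fin n) ℝ).toBasis with hb
  have hv (a : Fin n) : v a = ∑ c, b.toMatrix v c a • EuclideanSpace.single c (1 : ℝ) := by
    have := (b.sum_repr (v a)).symm
    simpa [hb, Module.Basis.toMatrix_apply] using this
  have hM : (Matrix.of fun a c : Fin n ↦ (inner ℝ (J (v a)) (J (v c)) : ℝ)) =
      (b.toMatrix v).transpose * (Matrix.of fun a c : Fin n ↦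
        (inner ℝ (J (EuclideanSpace.single a 1)) (J (EuclideanSpace.single c 1)) : ℝ)) *
        b.toMatrix v := by
    ext a c
    simp only [Matrix.of_apply, Matrix.mul_apply, Matrix.transpose_apply]
    rw [hv a, hv c]
    simp only [map_sum, map_smul, sum_inner, inner_sum, inner_smul_left, inner_smul_right,
      conj_trivial, Finset.sum_mul, Finset.mul_sum]
    refine Finset.sum_congr rfl fun k _ ↦ Finset.sum_congr rfl fun l _ ↦ ?_
    ring
  rw [gramDet, hM, Matrix.det_mul, Matrix.det_mul, Matrix.det_transpose, gramDet,
    Module.Basis.det_apply]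
  ring

/-- The density of the Riemannian volume in the parametrisation `f`. -/
def mapDensity (f : EuclideanSpace ℝ (Fin n) → M) (y : EuclideanSpace ℝ (Fin n)) : ℝ :=
  √(gramDet (f y) fun a ↦ mfderiv (𝓡 n) (𝓡 n) f y (EuclideanSpace.single a (1 : ℝ)))

theorem volumeDensity_eq (p : M) :
    volumeDensity n p = mapDensity (extChartAt (𝓡 n) p).symm := rfl

theorem mapDensity_congr {f g : EuclideanSpace ℝ (Fin n) → M} {y : EuclideanSpace ℝ (Fin n)}
    (h : f =ᶠ[𝓝 y] g) : mapDensity f y = mapDensity g y := by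
  -- The Gram determinants live over the base points `f y` and `g y`; the vectors are taken in the
  -- common model space so that equality of the points can be substituted.
  have key (x x' : M) (hx : x = x') (w : Fin n → EuclideanSpace ℝ (Fin n)) :
      gramDet (n := n) x w = gramDet (n := n) x' w := by
    subst hx
    rfl
  have h1 := h.mfderiv_eq (I := 𝓡 n) (I' := 𝓡 n)
  rw [mapDensity, mapDensity]
  refine congrArg Real.sqrt ((key _ _ h.eq_of_nhds _).trans ?_)
  refine congrArg (gramDet (g y)) (funext fun a ↦ ?_)
  exact congrArg (fun T : EuclideanSpace ℝ (Fin n) →L[ℝ] EuclideanSpace ℝ (Fin n) ↦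
    T (EuclideanSpace.single a 1)) h1

theorem mapDensity_comp {f : EuclideanSpace ℝ (Fin n) → M}
    {τ : EuclideanSpace ℝ (Fin n) → EuclideanSpace ℝ (Fin n)} {y : EuclideanSpace ℝ (Fin n)}
    (hf : MDifferentiableAt (𝓡 n) (𝓡 n) f (τ y)) (hτ : DifferentiableAt ℝ τ y) :
    mapDensity (f ∘ τ) y = |(fderiv ℝ τ y).det| * mapDensity f (τ y) := by
  have h1 : gramDet (f (τ y)) (fun a ↦ mfderiv (𝓡 n) (𝓡 n) (f ∘ τ) y
      (EuclideanSpace.single a (1 : ℝ))) = gramDet (f (τ y)) (fun a ↦ mfderiv (𝓡 n) (𝓡 n) f (τ y)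
        (fderiv ℝ τ y (EuclideanSpace.single a (1 : ℝ)))) := by
    rw [mfderiv_comp y hf hτ.mdifferentiableAt, mfderiv_eq_fderiv]
    rfl
  have h2 : (EuclideanSpace.basisFun (Fin n) ℝ).toBasis.det
      (fun a ↦ fderiv ℝ τ y (EuclideanSpace.single a (1 : ℝ))) = (fderiv ℝ τ y).det := by
    have := (EuclideanSpace.basisFun (Fin n) ℝ).toBasis.det_comp (fderiv ℝ τ y).toLinearMap
      (EuclideanSpace.basisFun (Fin n) ℝ).toBasis
    rw [Module.Basis.det_self, mul_one] at this
    rw [ContinuousLinearMap.det, ← this]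
    congr 1
    ext a
    simp
  rw [mapDensity, mapDensity]
  refine (congrArg Real.sqrt (h1.trans (gramDet_map _ _))).trans ?_
  rw [Real.sqrt_mul (sq_nonneg _), Real.sqrt_sq_eq_abs, h2]
  rfl

end GramDensity

/-! ### Gluing of the chart measures. -/

section ChartVolume

set_option linter.unusedSectionVars false

variable {n : ℕ} {M : Type*} [TopologicalSpace M] [ChartedSpace (EuclideanSpace ℝ (Fin n)) M]
  [IsManifold (𝓡 n) ∞ M] [MeasurableSpace M] [BorelSpace M]
  [RiemannianBundle (fun x : M ↦ TangentSpace (𝓡 n) x)]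

theorem aemeasurable_extChartAt_symm (p : M) : AEMeasurable (extChartAt (𝓡 n) p).symm
    ((volume.restrict (extChartAt (𝓡 n) p).target).withDensity
      fun y ↦ ENNReal.ofReal (volumeDensity n p y)) :=
  ((continuousOn_extChartAt_symm p).aemeasurable
    (isOpen_extChartAt_target p).measurableSet).mono_ac (withDensity_absolutelyContinuous _ _)

theorem chartVolume_apply (p : M) {A : Set M} (hA : MeasurableSet A) :
    chartVolume n p A = ∫⁻ y in (extChartAt (𝓡 n) p).symm ⁻¹' A ∩ (extChartAt (𝓡 n) p).target,
      ENNReal.ofReal (volumeDensity n p y) := by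
  rw [chartVolume, Measure.map_apply_of_aemeasurable (aemeasurable_extChartAt_symm p) hA,
    withDensity_apply', Measure.restrict_restrict' (isOpen_extChartAt_target p).measurableSet]

theorem measurableSet_chart_preimage (p : M) {A : Set M} (hA : MeasurableSet A) :
    MeasurableSet ((extChartAt (𝓡 n) p).symm ⁻¹' A ∩ (extChartAt (𝓡 n) p).target) := by
  have h := (continuousOn_iff_continuous_domRestrict.1 (continuousOn_extChartAt_symm
    (I := 𝓡 n) p)).measurable hA
  have h2 := (isOpen_extChartAt_target (I := 𝓡 n) p).measurableSet.subtype_image h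
  convert h2 using 1
  ext y
  simp [and_comm]

/-- Change of variables along the transition map: its Jacobian is exactly the factor by which the
two densities differ. -/
theorem chartVolume_inter (p q : M) {A : Set M} (hA : MeasurableSet A) :
    chartVolume n q (A ∩ (extChartAt (𝓡 n) p).source) =
      chartVolume n p (A ∩ (extChartAt (𝓡 n) q).source) := by
  have hsp := (isOpen_extChartAt_source (I := 𝓡 n) p).measurableSet
  have hsq := (isOpen_extChartAt_source (I := 𝓡 n) q).measurableSet
  set φ := extChartAt (𝓡 n) p
  set χ := extChartAt (𝓡 n) q
  set τ := χ ∘ φ.symm with hτ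
  set s := φ.symm ⁻¹' (A ∩ χ.source) ∩ φ.target with hs
  have hsm : MeasurableSet s := measurableSet_chart_preimage p (hA.inter hsq)
  have hmd {y} (hy : y ∈ s) : MDifferentiableAt (𝓡 n) (𝓡 n) φ.symm y :=
    ((contMDiffOn_extChartAt_symm (n := ∞) p).contMDiffAt
      ((isOpen_extChartAt_target p).mem_nhds hy.2)).mdifferentiableAt (by simp)
  have hd {y} (hy : y ∈ s) : DifferentiableAt ℝ τ y := by
    have h1 : MDifferentiableAt (𝓡 n) (𝓡 n) χ (φ.symm y) :=
      (contMDiffAt_extChartAt' (n := ∞) (by simpa [χ] using hy.1.2)).mdifferentiableAt (by simp)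
    exact (h1.comp y (hmd hy)).differentiableAt
  have himage : χ.symm ⁻¹' (A ∩ φ.source) ∩ χ.target = τ '' s := by
    ext z
    constructor
    · rintro ⟨⟨hz1, hz2⟩, hz3⟩
      refine ⟨φ (χ.symm z), ⟨⟨?_, ?_⟩, φ.map_source hz2⟩, ?_⟩
      · rw [φ.left_inv hz2]; exact hz1
      · rw [φ.left_inv hz2]; exact χ.map_target hz3
      · simp [τ, φ.left_inv hz2, χ.right_inv hz3]
    · rintro ⟨y, ⟨⟨hy1, hy2⟩, hy3⟩, rfl⟩
      refine ⟨⟨?_, ?_⟩, χ.map_source hy2⟩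
      · simp only [τ, Function.comp_apply, χ.left_inv hy2]; exact hy1
      · simp only [τ, Function.comp_apply, χ.left_inv hy2]; exact φ.map_target hy3
  have hinj : Set.InjOn τ s := by
    intro y hy z hz h
    have h1 : φ.symm y = φ.symm z := χ.injOn hy.1.2 hz.1.2 h
    rw [← φ.right_inv hy.2, h1, φ.right_inv hz.2]
  rw [chartVolume_apply q (hA.inter hsp), chartVolume_apply p (hA.inter hsq), himage,
    lintegral_image_eq_lintegral_abs_det_fderiv_mul volume hsm
      (fun y hy ↦ (hd hy).hasFDerivAt.hasFDerivWithinAt) hinj]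
  refine setLIntegral_congr_fun hsm fun y hy ↦ ?_
  have h1 : φ.symm =ᶠ[𝓝 y] χ.symm ∘ τ := by
    have hc : ContinuousAt φ.symm y := (hmd hy).continuousAt
    filter_upwards [hc.preimage_mem_nhds
      ((isOpen_extChartAt_source (I := 𝓡 n) q).mem_nhds hy.1.2)] with z hz
    exact (χ.left_inv hz).symm
  have h2 : MDifferentiableAt (𝓡 n) (𝓡 n) χ.symm (τ y) :=
    ((contMDiffOn_extChartAt_symm (n := ∞) q).contMDiffAt
      ((isOpen_extChartAt_target q).mem_nhds (χ.map_source hy.1.2))).mdifferentiableAt (by simp)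
  simp only [volumeDensity_eq]
  rw [← ENNReal.ofReal_mul (abs_nonneg _), mapDensity_congr h1, mapDensity_comp h2 (hd hy)]

/-- The supremum adds no mass on a chart domain, because there every other chart measure is
dominated by the measure of this chart. -/
theorem riemannianVolume_restrict_source (p : M) :
    (riemannianVolume n).restrict (extChartAt (𝓡 n) p).source = chartVolume n p := by
  have hsp := (isOpen_extChartAt_source (I := 𝓡 n) p).measurableSet
  have hle (q : M) : (chartVolume n q).restrict (extChartAt (𝓡 n) p).source ≤ chartVolume n p := by
    refine Measure.le_iff.2 fun A hA ↦ ?_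
    rw [Measure.restrict_apply hA, chartVolume_inter p q hA]
    exact measure_mono Set.inter_subset_left
  have hself : (chartVolume n p).restrict (extChartAt (𝓡 n) p).source = chartVolume n p := by
    refine Measure.ext fun A hA ↦ ?_
    rw [Measure.restrict_apply hA, chartVolume_apply p (hA.inter hsp), chartVolume_apply p hA]
    congr 2
    ext y
    simp only [Set.mem_inter_iff, Set.mem_preimage, and_congr_left_iff, and_iff_left_iff_imp]
    exact fun hy _ ↦ (extChartAt (𝓡 n) p).map_target hy
  refine le_antisymm ?_ ?_
  -- An upper bound for all chart measures at once: the measure of the chart at `p` inside its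
  -- domain, the full volume outside.
  · have h1 : riemannianVolume n ≤ chartVolume n p
        + (riemannianVolume n).restrict (extChartAt (𝓡 n) p).sourceᶜ := by
      refine iSup_le fun q ↦ ?_
      rw [← Measure.restrict_add_restrict_compl (μ := chartVolume n q) hsp]
      exact add_le_add (hle q) (Measure.restrict_mono le_rfl (le_iSup (chartVolume n) q))
    refine (Measure.restrict_mono le_rfl h1).trans ?_
    rw [Measure.restrict_add, Measure.restrict_restrict hsp, Set.inter_compl_self, hself]
    simp
  · rw [← hself]
    exact Measure.restrict_mono le_rfl (le_iSup (chartVolume n) p)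

end ChartVolume

/-! ### Divergence of frame fields with respect to the reciprocal of their determinant. -/

section FrameDivergence

variable {n : ℕ}

/-- The determinant of a family of vectors, as a continuous multilinear map. -/
def detCMM (n : ℕ) :
    ContinuousMultilinearMap ℝ (fun _ : Fin n ↦ EuclideanSpace ℝ (Fin n)) ℝ where
  toMultilinearMap := (EuclideanSpace.basisFun (Fin n) ℝ).toBasis.det.toMultilinearMap
  cont := by
    have h : (fun v : Fin n → EuclideanSpace ℝ (Fin n) ↦
        (EuclideanSpace.basisFun (Fin n) ℝ).toBasis.det v) =
        fun v ↦ Matrix.det (Matrix.of fun i j ↦ v j i) := by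
      ext v
      rw [Module.Basis.det_apply]
      congr 1
    change Continuous fun v : Fin n → EuclideanSpace ℝ (Fin n) ↦
        (EuclideanSpace.basisFun (Fin n) ℝ).toBasis.det v
    rw [h]
    refine Continuous.matrix_det ?_
    fun_prop

theorem fderiv_detCMM {X : Fin n → EuclideanSpace ℝ (Fin n) → EuclideanSpace ℝ (Fin n)}
    {y : EuclideanSpace ℝ (Fin n)} (hX : ∀ b, DifferentiableAt ℝ (X b) y)
    (w : EuclideanSpace ℝ (Fin n)) :
    HasFDerivAt (fun z ↦ detCMM n fun b ↦ X b z) (fderiv ℝ (fun z ↦ detCMM n fun b ↦ X b z) y) y ∧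
    fderiv ℝ (fun z ↦ detCMM n fun b ↦ X b z) y w =
      ∑ b, detCMM n (Function.update (fun b ↦ X b y) b (fderiv ℝ (X b) y w)) := by
  have h1 : HasFDerivAt (fun z ↦ fun b ↦ X b z)
      (ContinuousLinearMap.pi fun b ↦ fderiv ℝ (X b) y) y :=
    hasFDerivAt_pi.2 fun b ↦ (hX b).hasFDerivAt
  have h2 := ((detCMM n).hasFDerivAt (x := fun b ↦ X b y)).comp y h1
  refine ⟨h2.differentiableAt.hasFDerivAt, ?_⟩
  rw [show fderiv ℝ (fun z ↦ detCMM n fun b ↦ X b z) y = _ from h2.fderiv]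
  simp [ContinuousMultilinearMap.linearDeriv_apply]

/-- With $D=\det(X_1,\dots,X_n)$, the derivative of $|D|^{-1}$ along $X_a$ contributes $-|D|^{-1}$
times the sum of the $X_b$-components of $dX_b(X_a)$, while the trace of $dX_a$ contributes the
components of $dX_a(X_b)$. The difference consists of the diagonal components of the brackets
$[X_b,X_a]$. -/
theorem trace_fderiv_smul_frame {X : Fin n → EuclideanSpace ℝ (Fin n) → EuclideanSpace ℝ (Fin n)}
    {y : EuclideanSpace ℝ (Fin n)} (hX : ∀ b, DifferentiableAt ℝ (X b) y)
    (hD : detCMM n (fun b ↦ X b y) ≠ 0) (a : Fin n) (C : Fin n → Fin n → ℝ)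
    (hC : ∀ b, lieBracket ℝ (X b) (X a) y = ∑ c, C b c • X c y) :
    DifferentiableAt ℝ (fun z ↦ |detCMM n fun b ↦ X b z|⁻¹ • X a z) y ∧
    LinearMap.trace ℝ _ (fderiv ℝ (fun z ↦ |detCMM n fun b ↦ X b z|⁻¹ • X a z) y).toLinearMap =
      |detCMM n fun b ↦ X b y|⁻¹ * ∑ b, C b b := by
  set D : EuclideanSpace ℝ (Fin n) → ℝ := fun z ↦ detCMM n fun b ↦ X b z with hDdef
  set e := (EuclideanSpace.basisFun (Fin n) ℝ).toBasis
  have hu : IsUnit (e.det fun b ↦ X b y) := isUnit_iff_ne_zero.2 hD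
  obtain ⟨hli, hsp⟩ := (Module.Basis.is_basis_iff_det e).2 hu
  set B := Module.Basis.mk hli hsp.ge with hB
  have hBX (b : Fin n) : B b = X b y := by rw [hB, Module.Basis.mk_apply]
  -- Cramer's rule: replacing the `b`-th vector by `w` multiplies the determinant by the `b`-th
  -- coordinate of `w`.
  have hdet (b : Fin n) (w : EuclideanSpace ℝ (Fin n)) :
      detCMM n (Function.update (fun b ↦ X b y) b w) = D y * B.coord b w := by
    have h := congrArg (fun T ↦ T w) (e.det_smul_mk_coord_eq_det_update hli hsp.ge b)
    exact h.symm
  have hdD : fderiv ℝ D y (X a y) = D y * ∑ b, B.coord b (fderiv ℝ (X b) y (X a y)) := by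
    rw [(fderiv_detCMM hX (X a y)).2, Finset.mul_sum]
    exact Finset.sum_congr rfl fun b _ ↦ hdet b _
  have hDd : HasFDerivAt D (fderiv ℝ D y) y := (fderiv_detCMM hX 0).1
  have hDy : D y ≠ 0 := hD
  have habs : HasFDerivAt (fun z ↦ |D z|) ((SignType.sign (D y) : ℝ) • fderiv ℝ D y) y :=
    (hasDerivAt_abs hDy).comp_hasFDerivAt y hDd
  have hinv : HasFDerivAt (fun z ↦ |D z|⁻¹)
      ((-(|D y| ^ 2)⁻¹) • ((SignType.sign (D y) : ℝ) • fderiv ℝ D y)) y :=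
    (hasDerivAt_inv (abs_ne_zero.2 hDy)).comp_hasFDerivAt y habs
  have hsm := hinv.smul (hX a).hasFDerivAt
  refine ⟨hsm.differentiableAt, ?_⟩
  rw [show fderiv ℝ (fun z ↦ |D z|⁻¹ • X a z) y = _ from hsm.fderiv]
  have htr : LinearMap.trace ℝ _ (fderiv ℝ (X a) y).toLinearMap =
      ∑ b, B.coord b (fderiv ℝ (X a) y (X b y)) := by
    rw [LinearMap.trace_eq_matrix_trace ℝ B, Matrix.trace]
    refine Finset.sum_congr rfl fun b _ ↦ ?_
    rw [Matrix.diag_apply, LinearMap.toMatrix_apply, hBX]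
    rfl
  have hC' (b : Fin n) : B.coord b (fderiv ℝ (X a) y (X b y))
      = C b b + B.coord b (fderiv ℝ (X b) y (X a y)) := by
    have h := congrArg (B.coord b) (hC b)
    rw [lieBracket, map_sub, map_sum] at h
    simp only [map_smul, ← hBX, smul_eq_mul] at h
    rw [Finset.sum_eq_single b (fun c _ hc ↦ by simp [hc]) (by simp)] at h
    simp only [hBX] at h
    simp only [← hBX, Module.Basis.coord_apply, Module.Basis.repr_self, Finsupp.single_eq_same,
      mul_one] at h ⊢
    linarith
  have hrank : LinearMap.trace ℝ _ (((-(|D y| ^ 2)⁻¹) •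
      ((SignType.sign (D y) : ℝ) • fderiv ℝ D y)).smulRight (X a y)).toLinearMap =
      (-(|D y| ^ 2)⁻¹) * ((SignType.sign (D y) : ℝ) * fderiv ℝ D y (X a y)) := by
    have := LinearMap.trace_smulRight (R := ℝ) (((-(|D y| ^ 2)⁻¹) •
      ((SignType.sign (D y) : ℝ) • fderiv ℝ D y))).toLinearMap (X a y)
    exact this
  rw [ContinuousLinearMap.toLinearMap_add, map_add, hrank, hdD, ContinuousLinearMap.toLinearMap_smul,
    map_smul, htr, smul_eq_mul]
  simp only [hC', Finset.sum_add_distrib]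
  have hs : (SignType.sign (D y) : ℝ) * D y = |D y| := sign_mul_self _
  have ha : |D y| ≠ 0 := abs_ne_zero.2 hDy
  rw [← mul_assoc (SignType.sign (D y) : ℝ), hs]
  field_simp
  ring

end FrameDivergence

/-! ### The divergence theorem for compact support in Euclidean space. -/

section Divergence

variable {n : ℕ}

/-- The integrand is $\sum_k\partial_k(Y_ku)$, and each summand is the partial derivative of a
compactly supported function. -/
theorem integral_trace_fderiv_add_eq_zero {Y : EuclideanSpace ℝ (Fin n) → EuclideanSpace ℝ (Fin n)}
    {u : EuclideanSpace ℝ (Fin n) → ℂ} {W : Set (EuclideanSpace ℝ (Fin n))} (hW : IsOpen W)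
    (hY : ContDiffOn ℝ 1 Y W) (hu : ContDiffOn ℝ 1 u W) (hc : HasCompactSupport u)
    (hs : tsupport u ⊆ W) :
    ∫ y in W, (LinearMap.trace ℝ _ (fderiv ℝ Y y).toLinearMap • u y + fderiv ℝ u y (Y y)) = 0 := by
  set h : Fin n → EuclideanSpace ℝ (Fin n) → ℂ := fun k y ↦ Y y k • u y with hh
  have hYk (k : Fin n) : ContDiffOn ℝ 1 (fun y ↦ Y y k) W :=
    ((EuclideanSpace.proj k : EuclideanSpace ℝ (Fin n) →L[ℝ] ℝ).contDiff.comp_contDiffOn hY)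
  have hts (k : Fin n) : tsupport (h k) ⊆ tsupport u := tsupport_smul_subset_right _ _
  have hck (k : Fin n) : HasCompactSupport (h k) := 
    hc.mono (Function.support_smul_subset_right (fun y ↦ Y y k) u)
  -- `Y` is regular only on `W`, but off the support of `h k` this product is locally zero, so it is
  -- $C^1$ everywhere.
  have hd (k : Fin n) : ContDiff ℝ 1 (h k) := contDiff_iff_contDiffAt.2 fun y ↦ by
    by_cases hy : y ∈ tsupport (h k)
    · exact ((hYk k).smul hu).contDiffAt (hW.mem_nhds (hs (hts k hy)))
    · exact (contDiffAt_const (c := (0 : ℂ))).congr_of_eventuallyEq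
        (notMem_tsupport_iff_eventuallyEq.1 hy)
  have hcf (k : Fin n) (v : EuclideanSpace ℝ (Fin n)) : Continuous fun y ↦ fderiv ℝ (h k) y v :=
    ((hd k).continuous_fderiv one_ne_zero).clm_apply continuous_const
  have hint (k : Fin n) (v : EuclideanSpace ℝ (Fin n)) :
      Integrable (fun y ↦ fderiv ℝ (h k) y v) :=
    (hcf k v).integrable_of_hasCompactSupport ((hck k).fderiv_apply ℝ v)
  have hzero (k : Fin n) (v : EuclideanSpace ℝ (Fin n)) : ∫ y, fderiv ℝ (h k) y v = 0 := by
    -- Integration by parts against the constant function 1.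
    have := integral_smul_fderiv_eq_neg_fderiv_smul_of_integrable (𝕜 := ℝ) (μ := volume)
      (f := fun _ : EuclideanSpace ℝ (Fin n) ↦ (1 : ℝ)) (g := h k) (v := v)
      (by simp) (by simpa using hint k v)
      (by simpa using (hd k).continuous.integrable_of_hasCompactSupport (hck k))
      (fun _ _ ↦ differentiableAt_const _)
      (fun y _ ↦ (hd k).differentiable one_ne_zero y)
    simpa using this
  have heq : ∀ y ∈ W, LinearMap.trace ℝ _ (fderiv ℝ Y y).toLinearMap • u y + fderiv ℝ u y (Y y) =
      ∑ k, fderiv ℝ (h k) y (EuclideanSpace.single k 1) := by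
    intro y hy
    have hYd : DifferentiableAt ℝ Y y :=
      (hY.contDiffAt (hW.mem_nhds hy)).differentiableAt one_ne_zero
    have hud : DifferentiableAt ℝ u y :=
      (hu.contDiffAt (hW.mem_nhds hy)).differentiableAt one_ne_zero
    have e1 (k : Fin n) : fderiv ℝ (h k) y (EuclideanSpace.single k 1) =
        Y y k • fderiv ℝ u y (EuclideanSpace.single k 1)
          + (fderiv ℝ Y y (EuclideanSpace.single k 1)) k • u y := by
      have e2 : HasFDerivAt (fun y ↦ Y y k)
          ((EuclideanSpace.proj k : EuclideanSpace ℝ (Fin n) →L[ℝ] ℝ).comp (fderiv ℝ Y y)) y :=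
        (EuclideanSpace.proj k : EuclideanSpace ℝ (Fin n) →L[ℝ] ℝ).hasFDerivAt.comp y
          hYd.hasFDerivAt
      rw [show fderiv ℝ (h k) y = _ from (e2.smul hud.hasFDerivAt).fderiv]
      simp
    have e3 : LinearMap.trace ℝ _ (fderiv ℝ Y y).toLinearMap =
        ∑ k, (fderiv ℝ Y y (EuclideanSpace.single k 1)) k := by
      rw [LinearMap.trace_eq_matrix_trace ℝ (EuclideanSpace.basisFun (Fin n) ℝ).toBasis,
        Matrix.trace]
      refine Finset.sum_congr rfl fun k _ ↦ ?_
      simp [LinearMap.toMatrix_apply]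
    have e4 : Y y = ∑ k, Y y k • EuclideanSpace.single k (1 : ℝ) := by
      simpa using ((EuclideanSpace.basisFun (Fin n) ℝ).toBasis.sum_repr (Y y)).symm
    simp only [e1, Finset.sum_add_distrib]
    rw [e3, Finset.sum_smul, add_comm]
    congr 1
    conv_lhs => rw [e4, map_sum]
    simp only [map_smul]
  rw [setIntegral_congr_fun hW.measurableSet heq, setIntegral_eq_integral_of_forall_compl_eq_zero,
    integral_finsetSum _ fun k _ ↦ hint k _]
  · simp only [hzero, Finset.sum_const_zero]
  · intro y hy
    refine Finset.sum_eq_zero fun k _ ↦ ?_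
    have : fderiv ℝ (h k) y = 0 := by
      refine image_eq_zero_of_notMem_tsupport fun hy' ↦ hy (hs (hts k ?_))
      exact tsupport_fderiv_subset ℝ hy'
    rw [this]
    rfl

end Divergence

/-! ### A frame seen in a chart. -/

section ChartFrame

set_option linter.unusedSectionVars false

variable {n : ℕ} {M : Type*} [TopologicalSpace M] [ChartedSpace (EuclideanSpace ℝ (Fin n)) M]
  [IsManifold (𝓡 n) ∞ M] [RiemannianBundle (fun x : M ↦ TangentSpace (𝓡 n) x)]
  [IsContMDiffRiemannianBundle (𝓡 n) ∞ (EuclideanSpace ℝ (Fin n))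
    (fun x : M ↦ TangentSpace (𝓡 n) x)]

/-- The image of a set under the preferred chart at `p`. -/
def chartDomain (p : M) (U : Set M) : Set (EuclideanSpace ℝ (Fin n)) :=
  (extChartAt (𝓡 n) p).target ∩ (extChartAt (𝓡 n) p).symm ⁻¹' U

theorem isOpen_chartDomain (p : M) {U : Set M} (hU : IsOpen U) :
    IsOpen (chartDomain (n := n) p U) :=
  (continuousOn_extChartAt_symm p).isOpen_inter_preimage (isOpen_extChartAt_target p) hU

theorem contMDiffAt_chart_symm (p : M) {y : EuclideanSpace ℝ (Fin n)}
    (hy : y ∈ (extChartAt (𝓡 n) p).target) :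
    ContMDiffAt (𝓡 n) (𝓡 n) ∞ (extChartAt (𝓡 n) p).symm y :=
  (contMDiffOn_extChartAt_symm (n := ∞) p).contMDiffAt ((isOpen_extChartAt_target p).mem_nhds hy)

theorem isInvertible_mfderiv_chart_symm (p : M) {y : EuclideanSpace ℝ (Fin n)}
    (hy : y ∈ (extChartAt (𝓡 n) p).target) :
    (mfderiv (𝓡 n) (𝓡 n) (extChartAt (𝓡 n) p).symm y).IsInvertible := by
  have h := isInvertible_mfderivWithin_extChartAt_symm (I := 𝓡 n) hy
  simpa using! h

/-- The representation of a vector field in the preferred chart at `p`. -/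
def chartField (p : M) (X : Π x : M, TangentSpace (𝓡 n) x) (y : EuclideanSpace ℝ (Fin n)) :
    EuclideanSpace ℝ (Fin n) :=
  mpullback (𝓡 n) (𝓡 n) (extChartAt (𝓡 n) p).symm X y

theorem mfderiv_chartField (p : M) (X : Π x : M, TangentSpace (𝓡 n) x)
    {y : EuclideanSpace ℝ (Fin n)} (hy : y ∈ (extChartAt (𝓡 n) p).target) :
    mfderiv (𝓡 n) (𝓡 n) (extChartAt (𝓡 n) p).symm y (chartField p X y) =
      X ((extChartAt (𝓡 n) p).symm y) :=
  (isInvertible_mfderiv_chart_symm p hy).self_apply_inverse _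

theorem contDiffOn_chartField (p : M) {X : Π x : M, TangentSpace (𝓡 n) x} {U : Set M}
    (hU : IsOpen U) (hX : SmoothFieldOn X U) : ContDiffOn ℝ 1 (chartField p X)
      (chartDomain p U) := by
  intro y hy
  have h1 := ((hX.contMDiffAt (hU.mem_nhds hy.2)).of_le (m := 1) (by simp)
    ).mpullback_vectorField_preimage ((contMDiffAt_chart_symm p hy.1).of_le (m := 2)
      ENat.LEInfty.out) (isInvertible_mfderiv_chart_symm p hy.1) (by norm_num)
  exact ((contMDiffAt_vectorSpace_iff_contDiffAt (V := chartField p X)).1 h1).contDiffWithinAt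

variable {e : Fin n → Π x : M, TangentSpace (𝓡 n) x} {U : Set M} (F : IsOrthonormalFrame e U)
include F

/-- The Gram determinant of the orthonormal frame is 1 and equals the squared coordinate determinant
times the Gram determinant of the coordinate vectors. -/
theorem abs_detCMM_mul_volumeDensity (p : M) {y : EuclideanSpace ℝ (Fin n)}
    (hy : y ∈ chartDomain p U) :
    |detCMM n fun a ↦ chartField p (e a) y| * volumeDensity n p y = 1 := by
  have h1 := gramDet_map (mfderiv (𝓡 n) (𝓡 n) (extChartAt (𝓡 n) p).symm y)
    (fun a ↦ chartField p (e a) y)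
  have h2 : gramDet ((extChartAt (𝓡 n) p).symm y) (fun a ↦
      mfderiv (𝓡 n) (𝓡 n) (extChartAt (𝓡 n) p).symm y (chartField p (e a) y)) = 1 := by
    simp only [mfderiv_chartField p _ hy.1]
    rw [gramDet, ← Matrix.det_one (n := Fin n)]
    congr 1
    ext a b
    rw [Matrix.of_apply, F.inner_eq hy.2, Matrix.one_apply]
  replace h1 := h2.symm.trans h1
  rw [volumeDensity_eq, mapDensity, ← Real.sqrt_sq_eq_abs, ← Real.sqrt_mul (sq_nonneg _)]
  exact (congrArg Real.sqrt h1.symm).trans Real.sqrt_one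

theorem detCMM_chartField_ne_zero (p : M) {y : EuclideanSpace ℝ (Fin n)}
    (hy : y ∈ chartDomain p U) : detCMM n (fun a ↦ chartField p (e a) y) ≠ 0 := by
  intro h
  have := abs_detCMM_mul_volumeDensity F p hy
  rw [h] at this
  simp at this

theorem volumeDensity_eq_inv (p : M) {y : EuclideanSpace ℝ (Fin n)}
    (hy : y ∈ chartDomain p U) :
    volumeDensity n p y = |detCMM n fun a ↦ chartField p (e a) y|⁻¹ :=
  (inv_eq_of_mul_eq_one_right (abs_detCMM_mul_volumeDensity F p hy)).symm

theorem contDiffOn_inv_abs_detCMM (p : M) :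
    ContDiffOn ℝ 1 (fun y ↦ |detCMM n fun a ↦ chartField p (e a) y|⁻¹) (chartDomain p U) := by
  intro y hy
  have h1 : ContDiffWithinAt ℝ 1 (fun y ↦ detCMM n fun a ↦ chartField p (e a) y)
      (chartDomain p U) y :=
    (detCMM n).contDiff.contDiffAt.comp_contDiffWithinAt y
      (contDiffWithinAt_pi.2 fun a ↦ contDiffOn_chartField p F.isOpen (F.smooth a) y hy)
  have h0 := detCMM_chartField_ne_zero F p hy
  have h2 : ContDiffWithinAt ℝ 1 (fun y ↦ |detCMM n fun a ↦ chartField p (e a) y|)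
      (chartDomain p U) y := ContDiffAt.comp_contDiffWithinAt (g := fun t : ℝ ↦ |t|) y
        (contDiffAt_abs h0) h1
  exact h2.inv (abs_ne_zero.2 h0)

theorem contDiffOn_volumeDensity (p : M) :
    ContDiffOn ℝ 1 (volumeDensity n p) (chartDomain p U) :=
  (contDiffOn_inv_abs_detCMM F p).congr fun _ hy ↦ volumeDensity_eq_inv F p hy

/-- Brackets commute with pullback, so the torsion-free expression of the frame brackets carries
over to the chart. -/
theorem lieBracket_chartField (p : M) {y : EuclideanSpace ℝ (Fin n)} (hy : y ∈ chartDomain p U)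
    (a b : Fin n) : lieBracket ℝ (chartField p (e b)) (chartField p (e a)) y =
      ∑ c, (connCoeff e b a c ((extChartAt (𝓡 n) p).symm y)
        - connCoeff e a b c ((extChartAt (𝓡 n) p).symm y)) • chartField p (e c) y := by
  have : IsManifold (𝓡 n) (minSmoothness ℝ 2) M := by
    rw [minSmoothness_of_isRCLikeNormedField]; infer_instance
  have h1 := mpullback_mlieBracket (n := ∞) (F.mdifferentiableAt b hy.2)
    (F.mdifferentiableAt a hy.2) (contMDiffAt_chart_symm p hy.1)
    (by rw [minSmoothness_of_isRCLikeNormedField]; exact ENat.LEInfty.out)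
  rw [mpullback_apply, F.mlieBracket_eq_sum hy.2, map_sum] at h1
  simp only [map_smul] at h1
  refine Eq.trans ?_ h1.symm
  have h2 := congrFun (mlieBracketWithin_eq_lieBracketWithin (𝕜 := ℝ)
    (V := chartField p (e b)) (W := chartField p (e a)) (s := Set.univ)) y
  have h3 := congrFun (mlieBracketWithin_univ (I := 𝓡 n) (V := chartField p (e b))
    (W := chartField p (e a))) y
  have h4 := congrFun (lieBracketWithin_univ (𝕜 := ℝ) (V := chartField p (e b))
    (W := chartField p (e a))) y
  exact (h4.symm.trans h2.symm).trans h3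

/-- The divergence of the vector fields of an orthonormal frame. -/
theorem trace_fderiv_volumeDensity_smul (p : M) {y : EuclideanSpace ℝ (Fin n)}
    (hy : y ∈ chartDomain p U) (a : Fin n) :
    LinearMap.trace ℝ _ (fderiv ℝ (fun z ↦ volumeDensity n p z • chartField p (e a) z)
      y).toLinearMap = volumeDensity n p y *
        ∑ b, connCoeff e b a b ((extChartAt (𝓡 n) p).symm y) := by
  have hd (b : Fin n) : DifferentiableAt ℝ (chartField p (e b)) y :=
    ((contDiffOn_chartField p F.isOpen (F.smooth b)).contDiffAt
      ((isOpen_chartDomain p F.isOpen).mem_nhds hy)).differentiableAt one_ne_zero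
  have h := (trace_fderiv_smul_frame hd (detCMM_chartField_ne_zero F p hy) a _
    (fun b ↦ lieBracket_chartField F p hy a b)).2
  have hev : (fun z ↦ volumeDensity n p z • chartField p (e a) z) =ᶠ[𝓝 y]
      fun z ↦ |detCMM n fun b ↦ chartField p (e b) z|⁻¹ • chartField p (e a) z :=
    Filter.eventually_of_mem ((isOpen_chartDomain p F.isOpen).mem_nhds hy) fun z hz ↦ by
      simp only [volumeDensity_eq_inv F p hz]
  rw [hev.fderiv_eq, h, volumeDensity_eq_inv F p hy]
  congr 1
  refine Finset.sum_congr rfl fun b _ ↦ ?_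
  -- The diagonal coefficient $\langle\nabla_{e_a}e_b,e_b\rangle$ vanishes by skewness, so only one
  -- of the two bracket terms remains.
  have := F.connCoeff_skew hy.2 a b b
  linarith

end ChartFrame

theorem continuous_of_continuousOn_of_eq_zero {X Y : Type*} [TopologicalSpace X]
    [TopologicalSpace Y] [Zero Y] {g : X → Y} {V K : Set X} (hV : IsOpen V) (hK : IsClosed K)
    (hKV : K ⊆ V) (hg : ContinuousOn g V) (h0 : ∀ x, x ∉ K → g x = 0) : Continuous g := by
  refine continuous_iff_continuousAt.2 fun x ↦ ?_
  by_cases hx : x ∈ K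
  · exact hg.continuousAt (hV.mem_nhds (hKV hx))
  · exact (continuousAt_const (y := (0 : Y))).congr
      (Filter.eventually_of_mem (hK.isOpen_compl.mem_nhds hx) fun y hy ↦ (h0 y hy).symm)

/-! ### Integration against the Riemannian volume. -/

section Integration

set_option linter.unusedSectionVars false

variable {n : ℕ} {M : Type*} [TopologicalSpace M] [ChartedSpace (EuclideanSpace ℝ (Fin n)) M]
  [IsManifold (𝓡 n) ∞ M] [MeasurableSpace M] [BorelSpace M]
  [RiemannianBundle (fun x : M ↦ TangentSpace (𝓡 n) x)]
  [IsContMDiffRiemannianBundle (𝓡 n) ∞ (EuclideanSpace ℝ (Fin n))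
    (fun x : M ↦ TangentSpace (𝓡 n) x)]

variable {e : Fin n → Π x : M, TangentSpace (𝓡 n) x} {U : Set M} (F : IsOrthonormalFrame e U)
include F

theorem integral_riemannianVolume_eq (p : M) {g : M → ℂ} (hg : Continuous g)
    (h0 : ∀ x, x ∉ (extChartAt (𝓡 n) p).source ∩ U → g x = 0) :
    ∫ x, g x ∂(riemannianVolume n) =
      ∫ y in chartDomain p U, volumeDensity n p y • g ((extChartAt (𝓡 n) p).symm y) := by
  have hW := (isOpen_chartDomain (n := n) p F.isOpen).measurableSet
  have hT := (isOpen_extChartAt_target (I := 𝓡 n) p).measurableSet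
  have hsub : (extChartAt (𝓡 n) p).target ∩ chartDomain p U = chartDomain p U :=
    Set.inter_eq_right.2 Set.inter_subset_left
  -- Regularity of the density is known only where a frame exists, so the integral is cut down to
  -- `chartDomain p U` before the density is pulled out.
  have hm : AEMeasurable (fun y ↦ ENNReal.ofReal (volumeDensity n p y))
      (volume.restrict (chartDomain p U)) :=
    ((contDiffOn_volumeDensity F p).continuousOn.aemeasurable hW).ennreal_ofReal
  rw [← setIntegral_eq_integral_of_forall_compl_eq_zero (s := (extChartAt (𝓡 n) p).source)
    fun x hx ↦ h0 x fun h ↦ hx h.1, riemannianVolume_restrict_source, chartVolume,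
    integral_map (aemeasurable_extChartAt_symm p) hg.aestronglyMeasurable,
    ← setIntegral_eq_integral_of_ae_compl_eq_zero (s := chartDomain p U),
    restrict_withDensity hW, Measure.restrict_restrict hW, Set.inter_comm, hsub,
    integral_withDensity_eq_integral_toReal_smul₀ hm (by simp)]
  · refine setIntegral_congr_fun hW fun y _ ↦ ?_
    simp only [ENNReal.toReal_ofReal (show 0 ≤ volumeDensity n p y from Real.sqrt_nonneg _)]
  · refine (withDensity_absolutelyContinuous _ _).ae_le ?_
    filter_upwards [ae_restrict_mem hT] with y hy hy'
    exact h0 _ fun h ↦ hy' ⟨hy, h.2⟩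

/-- Near `x` the volume is given by a density that is continuous on a compact coordinate ball. -/
theorem exists_mem_nhds_riemannianVolume_lt_top {x : M} (hx : x ∈ U) :
    ∃ N ∈ 𝓝 x, riemannianVolume n N < ⊤ := by
  set φ := extChartAt (𝓡 n) x with hφ
  have hy : φ x ∈ chartDomain x U :=
    ⟨mem_extChartAt_target x, by simpa [φ] using hx⟩
  obtain ⟨r, hr, hball⟩ := Metric.nhds_basis_closedBall.mem_iff.1
    ((isOpen_chartDomain x F.isOpen).mem_nhds hy)
  refine ⟨φ.source ∩ φ ⁻¹' Metric.ball (φ x) r, ?_, ?_⟩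
  · exact Filter.inter_mem (extChartAt_source_mem_nhds x)
      ((continuousAt_extChartAt x).preimage_mem_nhds (Metric.ball_mem_nhds _ hr))
  · have hN : IsOpen (φ.source ∩ φ ⁻¹' Metric.ball (φ x) r) :=
      (continuousOn_extChartAt x).isOpen_inter_preimage (isOpen_extChartAt_source x)
        Metric.isOpen_ball
    have h1 : riemannianVolume n (φ.source ∩ φ ⁻¹' Metric.ball (φ x) r) =
        chartVolume n x (φ.source ∩ φ ⁻¹' Metric.ball (φ x) r) := by
      rw [← riemannianVolume_restrict_source, Measure.restrict_apply hN.measurableSet]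
      congr 1
      exact (Set.inter_eq_left.2 Set.inter_subset_left).symm
    rw [h1, chartVolume_apply x hN.measurableSet]
    have h2 : φ.symm ⁻¹' (φ.source ∩ φ ⁻¹' Metric.ball (φ x) r) ∩ φ.target ⊆
        Metric.closedBall (φ x) r := by
      rintro y ⟨⟨-, hy⟩, hy'⟩
      rw [Set.mem_preimage, φ.right_inv hy'] at hy
      exact Metric.ball_subset_closedBall hy
    refine (lintegral_mono_set h2).trans_lt ?_
    have h3 := ((contDiffOn_volumeDensity F x).continuousOn.mono hball).integrableOn_compact
      (μ := volume) (isCompact_closedBall (φ x) r)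
    exact h3.lintegral_lt_top

/-- In the chart, density times integrand is the Euclidean divergence of $u$ times the
density-weighted frame field, where $u$ represents `α`. Continuity is recorded for later
integrability. -/
theorem integral_frame_divergence [T2Space M] (p : M) {α : M → ℂ}
    (hα : ContMDiffOn (𝓡 n) 𝓘(ℝ, ℂ) ∞ α U) {K : Set M} (hK : IsCompact K)
    (hKU : K ⊆ (extChartAt (𝓡 n) p).source ∩ U) (h0 : ∀ x, x ∉ K → α x = 0) (a : Fin n) :
    Continuous (fun x ↦ mvfderiv (𝓡 n) α x (e a x) + (∑ b, connCoeff e b a b x) • α x) ∧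
    ∫ x, (mvfderiv (𝓡 n) α x (e a x) + (∑ b, connCoeff e b a b x) • α x)
      ∂(riemannianVolume n) = 0 := by
  set φ := extChartAt (𝓡 n) p with hφ
  set g : M → ℂ := fun x ↦ mvfderiv (𝓡 n) α x (e a x) + (∑ b, connCoeff e b a b x) • α x with hg
  have hg0 : ∀ x, x ∉ K → g x = 0 := by
    intro x hx
    have h1 : mvfderiv (𝓡 n) α x = 0 := by
      rw [mvfderiv_congr (g := fun _ ↦ (0 : ℂ)) (Filter.eventually_of_mem
        (hK.isClosed.isOpen_compl.mem_nhds hx) fun y hy ↦ h0 y hy), mvfderiv_const]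
    simp [hg, h1, h0 x hx]
  have hgc : Continuous g := by
    have h1 : ContMDiffOn (𝓡 n) 𝓘(ℝ, ℂ) ∞ g U :=
      (contMDiffOn_mvfderiv_apply F.isOpen hα (F.smooth a)).add
        ((contMDiffOn_sum _ fun b _ ↦ F.contMDiffOn_connCoeff b a b).smul hα)
    exact continuous_of_continuousOn_of_eq_zero F.isOpen hK.isClosed
      (hKU.trans Set.inter_subset_right) h1.continuousOn hg0
  refine ⟨hgc, ?_⟩
  rw [integral_riemannianVolume_eq F p hgc fun x hx ↦ hg0 x fun h ↦ hx (hKU h)]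
  have hW := isOpen_chartDomain (n := n) p F.isOpen
  classical
  -- Outside its target the inverse chart has meaningless values, hence the extension by zero.
  set u : EuclideanSpace ℝ (Fin n) → ℂ := φ.target.indicator fun y ↦ α (φ.symm y) with hu
  have hK' : IsCompact (φ '' K) := hK.image_of_continuousOn
    ((continuousOn_extChartAt p).mono (hKU.trans Set.inter_subset_left))
  have hK'W : φ '' K ⊆ chartDomain p U := by
    rintro _ ⟨x, hx, rfl⟩
    refine ⟨φ.map_source (hKU hx).1, ?_⟩
    rw [Set.mem_preimage, φ.left_inv (hKU hx).1]
    exact (hKU hx).2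
  have hsupp : Function.support u ⊆ φ '' K := by
    intro y hy
    rw [Function.mem_support, hu, Set.indicator_apply_ne_zero] at hy
    refine ⟨φ.symm y, ?_, φ.right_inv hy.1⟩
    by_contra h
    exact hy.2 (h0 _ h)
  have hts : tsupport u ⊆ φ '' K := closure_minimal hsupp hK'.isClosed
  have hev {y} (hy : y ∈ φ.target) : u =ᶠ[𝓝 y] α ∘ φ.symm :=
    Filter.eventually_of_mem ((isOpen_extChartAt_target p).mem_nhds hy) fun z hz ↦
      Set.indicator_of_mem hz _
  have hus : ContDiffOn ℝ 1 u (chartDomain p U) := by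
    intro y hy
    have h1 : ContMDiffAt (𝓡 n) 𝓘(ℝ, ℂ) ∞ (α ∘ φ.symm) y :=
      (hα.contMDiffAt (F.isOpen.mem_nhds hy.2)).comp y (contMDiffAt_chart_symm p hy.1)
    exact ((h1.contDiffAt.of_le (by simp)).congr_of_eventuallyEq (hev hy.1)).contDiffWithinAt
  have hY : ContDiffOn ℝ 1 (fun z ↦ volumeDensity n p z • chartField p (e a) z)
      (chartDomain p U) :=
    (contDiffOn_volumeDensity F p).smul (contDiffOn_chartField p F.isOpen (F.smooth a))
  have key := integral_trace_fderiv_add_eq_zero hW hY hus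
    (HasCompactSupport.of_support_subset_isCompact hK' hsupp) (hts.trans hK'W)
  rw [← key]
  refine setIntegral_congr_fun hW.measurableSet fun y hy ↦ ?_
  have h1 : fderiv ℝ u y (chartField p (e a) y) =
      mvfderiv (𝓡 n) α (φ.symm y) (e a (φ.symm y)) := by
    have hαd := (hα.contMDiffAt (F.isOpen.mem_nhds hy.2)).mdifferentiableAt (by simp)
    have h2 := mfderiv_comp y hαd ((contMDiffAt_chart_symm p hy.1).mdifferentiableAt (by simp))
    rw [(hev hy.1).fderiv_eq, ← mfderiv_eq_fderiv, h2, ← mfderiv_chartField p (e a) hy.1]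
    rfl
  have h2 : u y = α (φ.symm y) := (hev hy.1).eq_of_nhds
  simp only [trace_fderiv_volumeDensity_smul F p hy, map_smul, h1, h2, hg, smul_add, mul_smul]
  rw [add_comm]

end Integration

/-! ### Pointwise pairings and the formal adjoint. -/

section Adjoint

set_option linter.unusedSectionVars false

variable {n : ℕ} {M : Type*} [TopologicalSpace M] [ChartedSpace (EuclideanSpace ℝ (Fin n)) M]
  [IsManifold (𝓡 n) ∞ M] [RiemannianBundle (fun x : M ↦ TangentSpace (𝓡 n) x)]
  [IsContMDiffRiemannianBundle (𝓡 n) ∞ (EuclideanSpace ℝ (Fin n))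
    (fun x : M ↦ TangentSpace (𝓡 n) x)]
  {Δ : Type*} [NormedAddCommGroup Δ] [InnerProductSpace ℂ Δ] [FiniteDimensional ℂ Δ]

theorem inner_real_smul_left (r : ℝ) (φ ψ : Δ) : inner ℂ (r • φ) ψ = r • inner ℂ φ ψ :=
  congrArg (fun T : Δ →L[ℝ] ℂ ↦ T ψ) ((innerBilin Δ).map_smul r φ)

theorem inner_real_smul_right (r : ℝ) (φ ψ : Δ) : inner ℂ φ (r • ψ) = r • inner ℂ φ ψ :=
  (innerBilin Δ φ).map_smul r ψ

namespace SpinStructure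

variable {P : SpinStructure n M} {S : SpinorModule n Δ} {φ ψ : P.Index → M → Δ}
  {η θ : P.Index → Π x : M, TangentSpace (𝓡 n) x →L[ℝ] Δ}

theorem mem_index (P : SpinStructure n M) (x : M) : x ∈ P.U (P.index x) := (P.cover x).choose_spec

theorem pairing_eq (hφ : P.IsSpinor S φ) (hψ : P.IsSpinor S ψ) {i : P.Index} {x : M}
    (hx : x ∈ P.U i) : P.pairing φ ψ x = inner ℂ (φ i x) (ψ i x) := by
  have hxi : x ∈ P.U (P.index x) ∩ P.U i := ⟨P.mem_index x, hx⟩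
  rw [pairing, hφ.transition _ i x hxi, hψ.transition _ i x hxi, ← S.op_apply, ← S.op_apply,
    S.inner_op_op (P.g_mem _ _ x hxi)]

/-- The spin transition is unitary and the rotation of the frame is orthogonal, so neither changes
the sum. -/
theorem formPairing_eq (hη : P.IsSpinorForm S η) (hθ : P.IsSpinorForm S θ) {i : P.Index} {x : M}
    (hx : x ∈ P.U i) :
    P.formPairing η θ x = ∑ a, inner ℂ (η i x (P.e i a x)) (θ i x (P.e i a x)) := by
  have hxi : x ∈ P.U (P.index x) ∩ P.U i := ⟨P.mem_index x, hx⟩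
  have h1 (a : Fin n) : inner ℂ (η (P.index x) x (P.e (P.index x) a x))
      (θ (P.index x) x (P.e (P.index x) a x)) =
      ∑ b, ∑ c, (P.rot i (P.index x) b a x * P.rot i (P.index x) c a x) •
        inner ℂ (η i x (P.e i b x)) (θ i x (P.e i c x)) := by
    rw [hη.transition _ i x hxi, hθ.transition _ i x hxi, ← S.op_apply, ← S.op_apply,
      S.inner_op_op (P.g_mem _ _ x hxi), P.frame_eq_sum_rot _ i hxi a]
    simp only [map_sum, map_smul, sum_inner, inner_sum, inner_real_smul_left,
      inner_real_smul_right, smul_smul, P.rot_swap i (P.index x)]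
    rw [Finset.sum_comm]
    simp only [mul_comm]
  rw [formPairing]
  simp only [h1]
  rw [Finset.sum_comm]
  refine Finset.sum_congr rfl fun b _ ↦ ?_
  rw [Finset.sum_comm]
  simp only [← Finset.sum_smul, P.sum_rot_mul_rot i _ hxi.symm, ite_smul, one_smul, zero_smul,
    Finset.sum_ite_eq, Finset.mem_univ, if_true]

theorem frameNabla_eq_zero {e : Fin n → Π x : M, TangentSpace (𝓡 n) x} {f : M → Δ} {U : Set M}
    (hU : IsOpen U) (h : ∀ y ∈ U, f y = 0) {x : M} (hx : x ∈ U) (v : TangentSpace (𝓡 n) x) :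
    frameNabla S e f x v = 0 := by
  rw [frameNabla_congr S (g := fun _ ↦ (0 : Δ)) hU h hx, frameNabla, mvfderiv_const]
  simp

theorem nabla_eq_zero {K : Set M} (hK : IsClosed K) (h : ∀ i, ∀ x ∈ P.U i, x ∉ K → φ i x = 0)
    {i : P.Index} {x : M} (hx : x ∈ P.U i) (hxK : x ∉ K) : P.nabla S φ i x = 0 := by
  ext v
  rw [nabla, localNabla_apply, frameNabla_eq_zero ((P.isOpen_U i).inter hK.isOpen_compl)
    (fun y hy ↦ h i y hy.1 hy.2) ⟨hx, hxK⟩]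
  rfl

theorem formPairing_nabla_eq_zero {K : Set M} (hK : IsClosed K)
    (h : ∀ i, ∀ x ∈ P.U i, x ∉ K → φ i x = 0) {x : M} (hxK : x ∉ K) :
    P.formPairing (P.nabla S φ) η x = 0 := by
  simp [formPairing, nabla_eq_zero hK h (P.mem_index x) hxK]

theorem pairing_eq_zero {K : Set M} (h : ∀ i, ∀ x ∈ P.U i, x ∉ K → φ i x = 0) {x : M}
    (hxK : x ∉ K) : P.pairing φ ψ x = 0 := by
  simp [pairing, h _ x (P.mem_index x) hxK]

theorem contMDiffOn_inner {f g : M → Δ} {U : Set M} (hf : ContMDiffOn (𝓡 n) 𝓘(ℝ, Δ) ∞ f U)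
    (hg : ContMDiffOn (𝓡 n) 𝓘(ℝ, Δ) ∞ g U) :
    ContMDiffOn (𝓡 n) 𝓘(ℝ, ℂ) ∞ (fun x ↦ (inner ℂ (f x) (g x) : ℂ)) U :=
  contMDiffOn_bilin (innerBilin Δ) hf hg

theorem continuous_pairing (hφ : P.IsSpinor S φ) (hψ : P.IsSpinor S ψ) :
    Continuous (P.pairing φ ψ) := by
  refine continuous_iff_continuousAt.2 fun x ↦ ?_
  have hU := (P.isOpen_U _).mem_nhds (P.mem_index x)
  exact ((contMDiffOn_inner (hφ.contMDiffOn _) (hψ.contMDiffOn _)).continuousOn.continuousAt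
    hU).congr (Filter.eventually_of_mem hU fun y hy ↦ (pairing_eq hφ hψ hy).symm)

theorem continuous_formPairing (hη : P.IsSpinorForm S η) (hθ : P.IsSpinorForm S θ) :
    Continuous (P.formPairing η θ) := by
  refine continuous_iff_continuousAt.2 fun x ↦ ?_
  have hU := (P.isOpen_U _).mem_nhds (P.mem_index x)
  exact ((contMDiffOn_sum Finset.univ fun a _ ↦ contMDiffOn_inner (hη.contMDiffOn _ a)
    (hθ.contMDiffOn _ a)).continuousOn.continuousAt hU).congr
      (Filter.eventually_of_mem hU fun y hy ↦ (formPairing_eq hη hθ hy).symm)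

/-- The difference of the two pairings is a divergence. -/
theorem formPairing_sub_pairing (hφ : P.IsSpinor S φ) (hη : P.IsSpinorForm S η) {i : P.Index}
    {x : M} (hx : x ∈ P.U i) :
    P.formPairing (P.nabla S φ) η x - P.pairing φ (P.nablaStar S η) x =
      ∑ a, (mvfderiv (𝓡 n) (fun y ↦ (inner ℂ (φ i y) (η i y (P.e i a y)) : ℂ)) x (P.e i a x)
        + (∑ b, connCoeff (P.e i) b a b x) • inner ℂ (φ i x) (η i x (P.e i a x))) := by
  have F := P.isOrthonormalFrame i
  have hdφ := hφ.mdifferentiableAt i hx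
  have hdη (a : Fin n) := mdifferentiableAt_of_contMDiffOn F.isOpen (hη.contMDiffOn i a) hx
  have h1 (a : Fin n) : mvfderiv (𝓡 n) (fun y ↦ (inner ℂ (φ i y) (η i y (P.e i a y)) : ℂ)) x
      (P.e i a x) = inner ℂ (frameNabla S (P.e i) (φ i) x (P.e i a x)) (η i x (P.e i a x))
        + inner ℂ (φ i x)
          (frameNabla S (P.e i) (fun y ↦ η i y (P.e i a y)) x (P.e i a x)) := by
    have h := mvfderiv_bilin (innerBilin Δ) hdφ (hdη a) (P.e i a x)
    simp only [innerBilin_apply] at h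
    rw [h, frameNabla, frameNabla, inner_add_left, inner_add_right,
      inner_frameConn_left S F hx]
    ring
  -- By skewness $\sum_a\nabla_{e_a}e_a=-\sum_a(\operatorname{div}e_a)\,e_a$, so the correction in
  -- `nablaStar` is precisely the divergence term.
  have h2 : ∑ a, inner ℂ (φ i x) (η i x (leviCivita (I := 𝓡 n) (P.e i a) x (P.e i a x))) =
      -∑ a, (∑ b, connCoeff (P.e i) b a b x) • inner ℂ (φ i x) (η i x (P.e i a x)) := by
    simp only [F.leviCivita_eq_sum hx, map_sum, map_smul, inner_sum, inner_real_smul_right,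
      Finset.sum_smul, ← Finset.sum_neg_distrib]
    rw [Finset.sum_comm]
    refine Finset.sum_congr rfl fun a _ ↦ Finset.sum_congr rfl fun b _ ↦ ?_
    rw [F.connCoeff_skew hx b b a, neg_smul]
  rw [formPairing_eq hφ.isSpinorForm_nabla hη hx, pairing_eq hφ hη.isSpinor_nablaStar hx,
    nablaStar_apply, inner_neg_right, inner_sum, sub_neg_eq_add]
  simp only [nabla, localNabla_apply, inner_sub_right, Finset.sum_sub_distrib, h1,
    Finset.sum_add_distrib, h2]
  ring

section Integral

variable [MeasurableSpace M] [BorelSpace M]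

theorem isLocallyFiniteMeasure_riemannianVolume (P : SpinStructure n M) :
    IsLocallyFiniteMeasure (riemannianVolume n : Measure M) :=
  ⟨fun x ↦ exists_mem_nhds_riemannianVolume_lt_top (P.isOrthonormalFrame _) (P.mem_index x)⟩

variable [T2Space M]

theorem integrable_formPairing (hφ : P.IsSpinor S φ) (hc : P.HasCompactSpinorSupport φ)
    (hη : P.IsSpinorForm S η) :
    Integrable (P.formPairing (P.nabla S φ) η) (riemannianVolume n) := by
  have := P.isLocallyFiniteMeasure_riemannianVolume
  obtain ⟨K, hK, h⟩ := hc
  exact (continuous_formPairing hφ.isSpinorForm_nabla hη).integrable_of_hasCompactSupport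
    (HasCompactSupport.intro hK fun x hx ↦ formPairing_nabla_eq_zero hK.isClosed h hx)

theorem integrable_pairing (hφ : P.IsSpinor S φ) (hc : P.HasCompactSpinorSupport φ)
    (hψ : P.IsSpinor S ψ) : Integrable (P.pairing φ ψ) (riemannianVolume n) := by
  have := P.isLocallyFiniteMeasure_riemannianVolume
  obtain ⟨K, hK, h⟩ := hc
  exact (continuous_pairing hφ hψ).integrable_of_hasCompactSupport
    (HasCompactSupport.intro hK fun x hx ↦ pairing_eq_zero h hx)

/-- With support in one chart and one frame domain, the difference of the integrands is a sum of
frame divergences, each with integral zero. -/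
theorem integral_formPairing_of_subset (hφ : P.IsSpinor S φ) (hη : P.IsSpinorForm S η) (p : M)
    (i : P.Index) {K : Set M} (hK : IsCompact K) (hKU : K ⊆ (extChartAt (𝓡 n) p).source ∩ P.U i)
    (h : ∀ i, ∀ x ∈ P.U i, x ∉ K → φ i x = 0) :
    ∫ x, P.formPairing (P.nabla S φ) η x ∂(riemannianVolume n) =
      ∫ x, P.pairing φ (P.nablaStar S η) x ∂(riemannianVolume n) := by
  classical
  have := P.isLocallyFiniteMeasure_riemannianVolume
  have F := P.isOrthonormalFrame i
  set α : Fin n → M → ℂ := fun a ↦ (P.U i).indicator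
    fun y ↦ inner ℂ (φ i y) (η i y (P.e i a y)) with hα
  have hαU (a : Fin n) : ∀ y ∈ P.U i, α a y = inner ℂ (φ i y) (η i y (P.e i a y)) :=
    fun y hy ↦ Set.indicator_of_mem hy _
  have hα0 (a : Fin n) : ∀ y, y ∉ K → α a y = 0 := by
    intro y hy
    by_cases hyU : y ∈ P.U i
    · rw [hαU a y hyU, h i y hyU hy, inner_zero_left]
    · exact Set.indicator_of_notMem hyU _
  have hαs (a : Fin n) : ContMDiffOn (𝓡 n) 𝓘(ℝ, ℂ) ∞ (α a) (P.U i) :=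
    (contMDiffOn_inner (hφ.contMDiffOn i) (hη.contMDiffOn i a)).congr (hαU a)
  have hdα (a : Fin n) : ∀ x, x ∉ K → mvfderiv (𝓡 n) (α a) x = 0 := by
    intro x hx
    rw [mvfderiv_congr (g := fun _ ↦ (0 : ℂ)) (Filter.eventually_of_mem
      (hK.isClosed.isOpen_compl.mem_nhds hx) fun y hy ↦ hα0 a y hy), mvfderiv_const]
  have hdiv (a : Fin n) := integral_frame_divergence F p (hαs a) hK hKU (hα0 a) a
  have heq (x : M) : P.formPairing (P.nabla S φ) η x - P.pairing φ (P.nablaStar S η) x =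
      ∑ a, (mvfderiv (𝓡 n) (α a) x (P.e i a x)
        + (∑ b, connCoeff (P.e i) b a b x) • α a x) := by
    by_cases hx : x ∈ P.U i
    · rw [formPairing_sub_pairing hφ hη hx]
      refine Finset.sum_congr rfl fun a _ ↦ ?_
      rw [hαU a x hx, mvfderiv_congr (Filter.eventually_of_mem (F.isOpen.mem_nhds hx) (hαU a))]
    · have hxK : x ∉ K := fun hxK ↦ hx (hKU hxK).2
      rw [formPairing_nabla_eq_zero hK.isClosed h hxK, pairing_eq_zero h hxK, sub_zero]
      exact (Finset.sum_eq_zero fun a _ ↦ by simp [hdα a x hxK, hα0 a x hxK]).symm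
  have hc : P.HasCompactSpinorSupport φ := ⟨K, hK, h⟩
  rw [← sub_eq_zero, ← integral_sub (integrable_formPairing hφ hc hη)
    (integrable_pairing hφ hc hη.isSpinor_nablaStar)]
  simp only [heq]
  rw [integral_finsetSum _ fun a _ ↦ (hdiv a).1.integrable_of_hasCompactSupport
    (HasCompactSupport.intro hK fun x hx ↦ by simp [hdα a x hx, hα0 a x hx])]
  exact Finset.sum_eq_zero fun a _ ↦ (hdiv a).2

omit [MeasurableSpace M] [BorelSpace M] [T2Space M] in
theorem IsSpinor.smul (hφ : P.IsSpinor S φ) {f : M → ℝ} (hf : ContMDiff (𝓡 n) 𝓘(ℝ) ∞ f) :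
    P.IsSpinor S (fun i x ↦ f x • φ i x) where
  contMDiffOn i := hf.contMDiffOn.smul (hφ.contMDiffOn i)
  transition i j x hx := by
    rw [hφ.transition i j x hx, ← S.op_apply, ← S.op_apply, op_smul_real]

/-- A partition of unity subordinate to the sets `chart source ∩ frame domain` splits `φ`; only
finitely many of its members meet the compact support, and both integrals are additive in `φ`. -/
theorem integral_formPairing [SigmaCompactSpace M] (hφ : P.IsSpinor S φ)
    (hc : P.HasCompactSpinorSupport φ) (hη : P.IsSpinorForm S η) :
    ∫ x, P.formPairing (P.nabla S φ) η x ∂(riemannianVolume n) =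
      ∫ x, P.pairing φ (P.nablaStar S η) x ∂(riemannianVolume n) := by
  obtain ⟨K, hK, h⟩ := hc
  obtain ⟨f, hf⟩ := SmoothPartitionOfUnity.exists_isSubordinate (𝓡 n) hK.isClosed
    (fun p : M ↦ (extChartAt (𝓡 n) p).source ∩ P.U (P.index p))
    (fun p ↦ (isOpen_extChartAt_source p).inter (P.isOpen_U _))
    (fun x _ ↦ Set.mem_iUnion.2 ⟨x, mem_extChartAt_source x, P.mem_index x⟩)
  have hfin := f.locallyFinite.finite_nonempty_inter_compact hK
  set T := hfin.toFinset with hT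
  set χ : M → P.Index → M → Δ := fun p i x ↦ f p x • φ i x with hχ
  have hχs (p : M) : P.IsSpinor S (χ p) := hφ.smul (f p).contMDiff
  have hχK (p : M) : IsCompact (K ∩ tsupport (f p)) := hK.inter_right (isClosed_tsupport _)
  have hχ0 (p : M) : ∀ i, ∀ x ∈ P.U i, x ∉ K ∩ tsupport (f p) → χ p i x = 0 := by
    intro i x hx hxK
    by_cases hxK' : x ∈ K
    · rw [hχ]
      simp only
      rw [image_eq_zero_of_notMem_tsupport fun h' ↦ hxK ⟨hxK', h'⟩, zero_smul]
    · rw [hχ]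
      simp only
      rw [h i x hx hxK', smul_zero]
  have hsum (i : P.Index) : ∀ x ∈ P.U i, φ i x = ∑ p ∈ T, χ p i x := by
    intro x hx
    rw [hχ]
    simp only
    by_cases hxK : x ∈ K
    · rw [← Finset.sum_smul]
      have h1 := f.sum_eq_one hxK
      rw [finsum_eq_sum_of_support_subset (s := T)] at h1
      · rw [h1, one_smul]
      · intro p hp
        rw [hT, Set.Finite.coe_toFinset]
        exact ⟨x, hp, hxK⟩
    · rw [h i x hx hxK]
      simp
  have hform (x : M) : P.formPairing (P.nabla S φ) η x =
      ∑ p ∈ T, P.formPairing (P.nabla S (χ p)) η x := by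
    have hN (v : TangentSpace (𝓡 n) x) : P.nabla S φ (P.index x) x v =
        ∑ p ∈ T, P.nabla S (χ p) (P.index x) x v := by
      simp only [nabla, localNabla_apply]
      rw [frameNabla_congr S (P.isOpen_U _) (hsum _) (P.mem_index x), frameNabla_sum S _
        fun p _ ↦ (hχs p).mdifferentiableAt _ (P.mem_index x)]
    simp only [formPairing, hN, sum_inner]
    exact Finset.sum_comm
  have hpair (x : M) : P.pairing φ (P.nablaStar S η) x =
      ∑ p ∈ T, P.pairing (χ p) (P.nablaStar S η) x := by
    simp only [pairing, hsum _ x (P.mem_index x), sum_inner]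
  have hχc (p : M) : P.HasCompactSpinorSupport (χ p) := ⟨_, hχK p, hχ0 p⟩
  simp only [hform, hpair]
  rw [integral_finsetSum _ fun p _ ↦ integrable_formPairing (hχs p) (hχc p) hη,
    integral_finsetSum _ fun p _ ↦ integrable_pairing (hχs p) (hχc p) hη.isSpinor_nablaStar]
  exact Finset.sum_congr rfl fun p _ ↦ integral_formPairing_of_subset (hχs p) hη p (P.index p)
    (hχK p) (Set.inter_subset_right.trans (hf p)) (hχ0 p)

end Integral
end SpinStructure
end Adjoint

end

end SpinGeometry

theorem mainTheorem1 {n : ℕ} {M : Type*} [TopologicalSpace M] [T2Space M]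
    [SecondCountableTopology M] [ChartedSpace (EuclideanSpace ℝ (Fin n)) M]
    [IsManifold (𝓡 n) ∞ M] [MeasurableSpace M] [BorelSpace M]
    [RiemannianBundle (fun x : M ↦ TangentSpace (𝓡 n) x)]
    [IsContMDiffRiemannianBundle (𝓡 n) ∞ (EuclideanSpace ℝ (Fin n))
      (fun x : M ↦ TangentSpace (𝓡 n) x)]
    (P : SpinGeometry.SpinStructure n M)
    {Δ : Type*} [NormedAddCommGroup Δ] [InnerProductSpace ℂ Δ] [FiniteDimensional ℂ Δ]
    (S : SpinGeometry.SpinorModule n Δ) :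
    -- `∇`, `D` and `∇^*` act on smooth sections
    (∀ ψ : P.Index → M → Δ, P.IsSpinor S ψ →
      P.IsSpinorForm S (P.nabla S ψ) ∧ P.IsSpinor S (P.dirac S ψ)) ∧
    (∀ η : P.Index → (x : M) → TangentSpace (𝓡 n) x →L[ℝ] Δ, P.IsSpinorForm S η →
      P.IsSpinor S (P.nablaStar S η)) ∧
    -- `∇^*` is the formal adjoint of `∇`
    (∀ (φ : P.Index → M → Δ) (η : P.Index → (x : M) → TangentSpace (𝓡 n) x →L[ℝ] Δ),
      P.IsSpinor S φ → P.HasCompactSpinorSupport φ → P.IsSpinorForm S η →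
      Integrable (P.formPairing (P.nabla S φ) η) (SpinGeometry.riemannianVolume n) ∧
      Integrable (P.pairing φ (P.nablaStar S η)) (SpinGeometry.riemannianVolume n) ∧
      ∫ x, P.formPairing (P.nabla S φ) η x ∂(SpinGeometry.riemannianVolume n) =
        ∫ x, P.pairing φ (P.nablaStar S η) x ∂(SpinGeometry.riemannianVolume n)) ∧
    -- `D² = ∇^*∇ + R/4`
    (∀ ψ : P.Index → M → Δ, P.IsSpinor S ψ → ∀ i, ∀ x ∈ P.U i,
      P.dirac S (P.dirac S ψ) i x =
        P.nablaStar S (P.nabla S ψ) i x + (SpinGeometry.scalarCurvature (𝓡 n) x / 4) • ψ i x) := by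
  -- Local compactness and second countability give σ-compactness, which the smooth partition of
  -- unity requires.
  have : LocallyCompactSpace M := ChartedSpace.locallyCompactSpace (EuclideanSpace ℝ (Fin n)) M
  have : SigmaCompactSpace M := inferInstance
  exact ⟨fun ψ hψ ↦ ⟨hψ.isSpinorForm_nabla, hψ.isSpinor_dirac⟩, fun η hη ↦ hη.isSpinor_nablaStar,
    fun φ η hφ hc hη ↦ ⟨SpinGeometry.SpinStructure.integrable_formPairing hφ hc hη,
      SpinGeometry.SpinStructure.integrable_pairing hφ hc hη.isSpinor_nablaStar,
      SpinGeometry.SpinStructure.integral_formPairing hφ hc hη⟩,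
    fun ψ hψ i x hx ↦ hψ.lichnerowicz i hx⟩
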